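/- Let $\varepsilon>0$ and let $\mathbf S_\varepsilon$ be the set of real-valued measurable functions $f$ on $[0,1]$ with $\sup_{x\in[0,1]}|f(x)|\le 2^{-1/2}-\varepsilon$. For real functions on $[0,1]$ write $$\|f\|=\Big(\frac2\pi\int_0^1|f(x)|^2\frac{dx}{\sqrt{1-x^2}}\Big)^{1/2}.$$ Let $\mathbf P$ be the set of sequences $\Psi=(\psi_k)_{k\ge 0}$ with $\psi_k\in(-\frac\pi2,\frac\pi2)$, and let $\|\Psi\|_\infty=\sup_{k\ge0}|\psi_k|$ for bounded real sequences. For $x\in[0,1]$ put $$W(x)=\begin{pmatrix}x& i\sqrt{1-x^2}\\ i\sqrt{1-x^2}&x\end{pmatrix},\qquad Z=\begin{pmatrix}1&0\\0&-1\end{pmatrix},$$ and for $\Psi\in\mathbf P$ define recursively $U_0(\Psi,x)=e^{i\psi_0Z}$ and $$U_d(\Psi,x)=e^{i\psi_dZ}\,W(x)\,U_{d-1}(\Psi,x)\,W(x)\,e^{i\psi_dZ}\qquad(d\ge1).$$ Let $u_d(\Psi,x)$ be the upper left entry of $U_d(\Psi,x)$. For each $f\in\mathbf S_\varepsilon$ there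 exists a unique sequence $\Psi\in\mathbf P$ such that both $$\sum_{k\in\mathbb Z}\log\big(1+\tan^2\psi_{|k|}\big)=-\frac2\pi\int_0^1\log|1-f(x)^2|\,\frac{dx}{\sqrt{1-x^2}}$$ (in particular the series converges) and $$\|\operatorname{Im}u_d(\Psi,\cdot)-f\|\to0\quad\text{as } d\to\infty.$$ Moreover, if $f,\tilde f\in\mathbf S_\varepsilon$ and $\Psi,\tilde\Psi$ are the corresponding sequences, then $$\|\Psi-\tilde\Psi\|_\infty\le 7.3\,\varepsilon^{-3/2}\,\|f-\tilde f\|.$$ -/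

import Mathlib

noncomputable section

namespace QSP

/-- The square of the Chebyshev-weighted norm is `(2/π) ∫₀¹ |f(x)|² dx / √(1 - x²)`. Only the
values of `f` on `[0,1]` matter. -/
def chebNorm (f : ℝ → ℝ) : ℝ :=
  Real.sqrt (2 / Real.pi * ∫ x in (0 : ℝ)..1, |f x| ^ 2 * (1 / Real.sqrt (1 - x ^ 2)))

/-- The signal space `S_ε`: real functions that are (Lebesgue) measurable on `[0,1]` and satisfy
`sup_{[0,1]} |f| ≤ 2^{-1/2} - ε`. A function on `[0,1]` is represented by any extension of it
to `ℝ`. -/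
def signalSpace (ε : ℝ) : Set (ℝ → ℝ) :=
  {f | AEMeasurable f (MeasureTheory.volume.restrict (Set.Icc (0 : ℝ) 1)) ∧
    ∀ x ∈ Set.Icc (0 : ℝ) 1, |f x| ≤ (2 : ℝ) ^ (-(1 / 2) : ℝ) - ε}

/-- The space `P` of phase sequences with entries in `(-π/2, π/2)`. -/
def phaseSpace : Set (ℕ → ℝ) :=
  {Ψ | ∀ k, Ψ k ∈ Set.Ioo (-(Real.pi / 2)) (Real.pi / 2)}

/-- The sup norm of a bounded real sequence. -/
def supNorm (Ψ : ℕ → ℝ) : ℝ := ⨆ k : ℕ, |Ψ k|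

/-- The signal matrix `W(x)`. -/
def W (x : ℝ) : Matrix (Fin 2) (Fin 2) ℂ :=
  !![(x : ℂ), Complex.I * (Real.sqrt (1 - x ^ 2) : ℂ);
     Complex.I * (Real.sqrt (1 - x ^ 2) : ℂ), (x : ℂ)]

/-- The Pauli matrix `Z`. -/
def Z : Matrix (Fin 2) (Fin 2) ℂ := !![1, 0; 0, -1]

/-- The phase matrix `e^{iψZ}`. -/
def phase (ψ : ℝ) : Matrix (Fin 2) (Fin 2) ℂ :=
  NormedSpace.exp ((Complex.I * (ψ : ℂ)) • Z)

/-- The matrices `U_d(Ψ, x)`. -/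
def U (Ψ : ℕ → ℝ) (x : ℝ) : ℕ → Matrix (Fin 2) (Fin 2) ℂ
  | 0 => phase (Ψ 0)
  | d + 1 => phase (Ψ (d + 1)) * W x * U Ψ x d * W x * phase (Ψ (d + 1))

/-- The upper left entry `u_d(Ψ, x)` of `U_d(Ψ, x)`. -/
def u (d : ℕ) (Ψ : ℕ → ℝ) (x : ℝ) : ℂ := U Ψ x d 0 0

/-- `Ψ` lies in `P`, satisfies the nonlinear Plancherel identity for `f` (including convergence
of the series, whose terms are nonnegative), and `Im u_d(Ψ, ·) → f` in the weighted norm. -/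
def Represents (f : ℝ → ℝ) (Ψ : ℕ → ℝ) : Prop :=
  Ψ ∈ phaseSpace ∧
  HasSum (fun k : ℤ => Real.log (1 + Real.tan (Ψ k.natAbs) ^ 2))
    (-(2 / Real.pi) *
      ∫ x in (0 : ℝ)..1, Real.log |1 - f x ^ 2| * (1 / Real.sqrt (1 - x ^ 2))) ∧
  Filter.Tendsto (fun d : ℕ => chebNorm (fun x => (u d Ψ x).im - f x)) Filter.atTop (nhds 0)

end QSP

end

/-! ### Square integrable functions on the circle and their Fourier coefficients -/

noncomputable section

namespace QSP

open MeasureTheory AddCircle Filter Topology ComplexConjugate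
open scoped ENNReal

/-! The substitution `x = |cos θ|`, `z = e^{2iθ}` turns the Chebyshev norm into the `L²` norm on a
circle of length `π` and `f` into an even real function `F` (`integral_absCos`). Up to scalar
factors, the product of signal and phase matrices becomes a chain of unitary steps applied to `(1,
1)`. Its components `X`, `Y` are analytic in `z`, satisfy `X(1/z) = conj Y(z)`, and give `Im u_d =
-Im (e^{iψ₀} X conj Y)` (`im_u_eq`). In the same way the Plancherel identity becomes a limit of
products of cosines, these products being the means of the complementary diagonal entries
(`represents_iff`, `coanalytic_chainDiag`).

Let `exp g` be the outer function with modulus `√(1 - F²)` and let `r = iF / exp g`. For `|F| ≤ b`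
with `b² < 1/2` one has `|r| ≤ κ < 1`. The phases are encoded in a sequence of Riemann–Hilbert
problems: find an analytic `X_k` such that `X_k(z) + z^{-k} r(z) X_k(1/z)` is coanalytic with mean
`1`. Since `κ < 1`, each has exactly one solution (`IsSolution.exists`, `IsSolution.unique`), and
`X_k → 1` because the positive Fourier tail of `r` vanishes (`tendsto_l2_solution`).

Existence: choosing `ψ_k` so that `e^{iψ_k}` makes the mean of `X_k` positive, an inverse transfer
step maps `X_k` to a multiple of `X_{k+1}` (`IsSolution.strip`). After normalization in `L²`, `X_0`
is the image under `N` unitary steps of a pair close to `(1, 1)`, so it is close to the finite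
chain. A symmetric factorization (`IsSolution.symmetric`) recovers `F` from `X_0` and gives the
Plancherel identity by telescoping (`IsSignal.exists_represents`).

Stability: if `Ψ` represents `F`, the Plancherel identity forces the diagonal entries to converge to
`exp g` (`tendsto_chainDiag`), so finite chains solve the Riemann–Hilbert problem approximately.
Pairing the approximate equations of two signals against each other bounds `|sin((ψ_k - φ_k)/2)|` by
`‖r - r'‖`, and `r` depends on `F` in a Lipschitz way (`l2_reflCoeff_sub_le`). This gives
`CircleRepresents.abs_sub_le`; uniqueness is the case of equal signals. -/

lemma norm_fourier_apply {T : ℝ} (n : ℤ) (t : AddCircle T) : ‖fourier n t‖ = 1 := by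
  rw [fourier_apply]; exact Circle.norm_coe _

variable {T : ℝ} [hT : Fact (0 < T)]

/-- The `L²` norm of a function on the circle with respect to normalized Haar measure. -/
def l2 (φ : AddCircle T → ℂ) : ℝ := Real.sqrt (∫ t, ‖φ t‖ ^ 2 ∂haarAddCircle)

/-- Square integrability on the circle. -/
abbrev SqInt (φ : AddCircle T → ℂ) : Prop := MemLp φ 2 (haarAddCircle (T := T))

lemma l2_nonneg (φ : AddCircle T → ℂ) : 0 ≤ l2 φ := Real.sqrt_nonneg _

lemma l2_sq (φ : AddCircle T → ℂ) : l2 φ ^ 2 = ∫ t, ‖φ t‖ ^ 2 ∂haarAddCircle :=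
  Real.sq_sqrt (integral_nonneg fun _ => by positivity)

lemma SqInt.integrable_sq {φ : AddCircle T → ℂ} (h : SqInt φ) :
    Integrable (fun t => ‖φ t‖ ^ 2) (haarAddCircle (T := T)) :=
  h.integrable_norm_pow (by norm_num)

lemma SqInt.integrable' {φ : AddCircle T → ℂ} (h : SqInt φ) :
    Integrable φ (haarAddCircle (T := T)) := h.integrable (by norm_num)

lemma SqInt.mul_integrable {φ χ : AddCircle T → ℂ} (h : SqInt φ) (h' : SqInt χ) :
    Integrable (fun t => φ t * χ t) (haarAddCircle (T := T)) := h.integrable_mul h'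

lemma SqInt.l2_eq {φ : AddCircle T → ℂ} (h : SqInt φ) :
    l2 φ = (eLpNorm φ 2 (haarAddCircle (T := T))).toReal := by
  rw [h.eLpNorm_eq_integral_rpow_norm (by norm_num) (by norm_num), ENNReal.toReal_ofReal
    (by positivity), l2, Real.sqrt_eq_rpow]
  norm_num

lemma l2_congr {φ χ : AddCircle T → ℂ} (h : φ =ᵐ[haarAddCircle] χ) : l2 φ = l2 χ := by
  unfold l2
  rw [integral_congr_ae]
  filter_upwards [h] with t ht
  simp [ht]

lemma SqInt.l2_add_le {φ χ : AddCircle T → ℂ} (h : SqInt φ) (h' : SqInt χ) :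
    l2 (fun t => φ t + χ t) ≤ l2 φ + l2 χ := by
  have e : l2 (fun t => φ t + χ t) = _ := SqInt.l2_eq (h.add h')
  rw [e, h.l2_eq, h'.l2_eq,
    ← ENNReal.toReal_add h.eLpNorm_ne_top h'.eLpNorm_ne_top]
  exact ENNReal.toReal_mono (ENNReal.add_ne_top.2 ⟨h.eLpNorm_ne_top, h'.eLpNorm_ne_top⟩)
    (eLpNorm_add_le h.1 h'.1 (by norm_num))

lemma SqInt.l2_sub_le {φ χ : AddCircle T → ℂ} (h : SqInt φ) (h' : SqInt χ) :
    l2 (fun t => φ t - χ t) ≤ l2 φ + l2 χ := by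
  have := h.l2_add_le h'.neg
  simpa [l2, sub_eq_add_neg] using this

lemma SqInt.l2_le {φ χ : AddCircle T → ℂ} (h' : SqInt χ) {C : ℝ} (hC : 0 ≤ C)
    (H : ∀ᵐ t ∂haarAddCircle, ‖φ t‖ ≤ C * ‖χ t‖) : l2 φ ≤ C * l2 χ := by
  rw [l2, l2]
  apply Real.sqrt_le_iff.2 ⟨by positivity, ?_⟩
  rw [mul_pow, Real.sq_sqrt (integral_nonneg fun _ => by positivity), ← integral_const_mul]
  refine integral_mono_of_nonneg (ae_of_all _ fun _ => by positivity)
    (h'.integrable_sq.const_mul _) ?_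
  filter_upwards [H] with t ht
  rw [← mul_pow]
  exact pow_le_pow_left₀ (norm_nonneg _) ht 2

lemma l2_const (c : ℂ) : l2 (fun _ : AddCircle T => c) = ‖c‖ := by
  simp [l2]

lemma SqInt.const (c : ℂ) : SqInt (fun _ : AddCircle T => c) := memLp_const c

lemma l2_le_of_bound {φ : AddCircle T → ℂ} {C : ℝ} (hC : 0 ≤ C)
    (H : ∀ᵐ t ∂haarAddCircle, ‖φ t‖ ≤ C) : l2 φ ≤ C := by
  have := (SqInt.const (T := T) 1).l2_le (φ := φ) hC (by simpa using H)
  simpa [l2_const] using this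

lemma l2_const_mul (c : ℂ) (φ : AddCircle T → ℂ) : l2 (fun t => c * φ t) = ‖c‖ * l2 φ := by
  simp only [l2, norm_mul, mul_pow, integral_const_mul]
  rw [Real.sqrt_mul (by positivity), Real.sqrt_sq (norm_nonneg _)]

lemma SqInt.norm_integral_le {φ : AddCircle T → ℂ} (h : SqInt φ) :
    ‖∫ t, φ t ∂haarAddCircle‖ ≤ l2 φ := by
  refine (norm_integral_le_integral_norm _).trans ?_
  have h1 : ∫ t, ‖φ t‖ ∂haarAddCircle = (eLpNorm φ 1 (haarAddCircle (T := T))).toReal := by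
    rw [eLpNorm_one_eq_lintegral_enorm, integral_norm_eq_lintegral_enorm h.1]
  rw [h1, h.l2_eq]
  exact ENNReal.toReal_mono h.eLpNorm_ne_top
    (eLpNorm_le_eLpNorm_of_exponent_le (by norm_num) h.1)

/-- Multiplication by a bounded measurable function preserves square integrability. -/
lemma SqInt.bdd_mul' {φ m : AddCircle T → ℂ} (h : SqInt φ)
    (hm : AEStronglyMeasurable m (haarAddCircle (T := T))) {C : ℝ}
    (H : ∀ᵐ t ∂haarAddCircle, ‖m t‖ ≤ C) : SqInt (fun t => m t * φ t) := by
  refine MemLp.of_le_mul (c := C) h (hm.mul h.1) ?_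
  filter_upwards [H] with t ht
  rw [norm_mul]
  exact mul_le_mul_of_nonneg_right ht (norm_nonneg _)

lemma SqInt.of_bound {φ : AddCircle T → ℂ}
    (hm : AEStronglyMeasurable φ (haarAddCircle (T := T))) {C : ℝ}
    (H : ∀ᵐ t ∂haarAddCircle, ‖φ t‖ ≤ C) : SqInt φ := MemLp.of_bound hm C H

lemma SqInt.conj {φ : AddCircle T → ℂ} (h : SqInt φ) : SqInt (fun t => conj (φ t)) := h.star

lemma SqInt.refl {φ : AddCircle T → ℂ} (h : SqInt φ) : SqInt (fun t => φ (-t)) :=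
  h.comp_measurePreserving (Measure.measurePreserving_neg _)

lemma ae_refl {p : AddCircle T → Prop} (h : ∀ᵐ t ∂haarAddCircle, p t) :
    ∀ᵐ t ∂haarAddCircle, p (-t) :=
  (Measure.measurePreserving_neg (haarAddCircle (T := T))).quasiMeasurePreserving.ae h

lemma integral_refl (φ : AddCircle T → ℂ) :
    ∫ t, φ (-t) ∂haarAddCircle = ∫ t, φ t ∂haarAddCircle := integral_neg_eq_self φ _

lemma l2_refl (φ : AddCircle T → ℂ) : l2 (fun t => φ (-t)) = l2 φ := by
  unfold l2
  rw [integral_neg_eq_self (fun t => ‖φ t‖ ^ 2) (haarAddCircle (T := T))]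

lemma l2_conj (φ : AddCircle T → ℂ) : l2 (fun t => conj (φ t)) = l2 φ := by
  simp [l2]

lemma SqInt.ofReal_l2 {φ : AddCircle T → ℝ} : l2 (fun t => (φ t : ℂ)) ^ 2 = 
    ∫ t, φ t ^ 2 ∂haarAddCircle := by
  simp [l2_sq]

lemma SqInt.fourier_mul {φ : AddCircle T → ℂ} (h : SqInt φ) (n : ℤ) :
    SqInt (fun t => fourier n t * φ t) :=
  h.bdd_mul' (fourier n).continuous.aestronglyMeasurable (C := 1)
    (ae_of_all _ fun t => (norm_fourier_apply n t).le)

lemma sqInt_continuousMap (φ : C(AddCircle T, ℂ)) : SqInt (fun t => φ t) := by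
  refine SqInt.of_bound φ.continuous.aestronglyMeasurable (C := ‖φ‖) ?_
  exact ae_of_all _ fun t => φ.norm_coe_le_norm t

lemma fourierCoeff_eq (φ : AddCircle T → ℂ) (n : ℤ) :
    fourierCoeff φ n = ∫ t, fourier (-n) t * φ t ∂haarAddCircle := rfl

lemma fourierCoeff_zero_eq (φ : AddCircle T → ℂ) :
    fourierCoeff φ 0 = ∫ t, φ t ∂haarAddCircle := by
  simp [fourierCoeff_eq]

lemma SqInt.norm_fourierCoeff_le {φ : AddCircle T → ℂ} (h : SqInt φ) (n : ℤ) :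
    ‖fourierCoeff φ n‖ ≤ l2 φ := by
  rw [fourierCoeff_eq]
  refine (h.fourier_mul (-n)).norm_integral_le.trans ?_
  simpa using h.l2_le (φ := fun t => fourier (-n) t * φ t) zero_le_one
    (ae_of_all _ fun t => by rw [norm_mul, norm_fourier_apply])

lemma fourierCoeff_fourier_mul (φ : AddCircle T → ℂ) (m n : ℤ) :
    fourierCoeff (fun t => fourier m t * φ t) n = fourierCoeff φ (n - m) := by
  simp only [fourierCoeff_eq]
  refine integral_congr_ae (ae_of_all _ fun t => ?_)
  simp only
  rw [← mul_assoc, ← fourier_add]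
  congr 3; ring

lemma fourierCoeff_conj (φ : AddCircle T → ℂ) (n : ℤ) :
    fourierCoeff (fun t => conj (φ t)) n = conj (fourierCoeff φ (-n)) := by
  simp only [fourierCoeff_eq]
  rw [← integral_conj]
  refine integral_congr_ae (ae_of_all _ fun t => ?_)
  simp

lemma fourierCoeff_refl (φ : AddCircle T → ℂ) (n : ℤ) :
    fourierCoeff (fun t => φ (-t)) n = fourierCoeff φ (-n) := by
  simp only [fourierCoeff_eq]
  rw [← integral_refl (fun t => fourier (- -n) t * φ t)]
  refine integral_congr_ae (ae_of_all _ fun t => ?_)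
  simp [fourier_apply]

lemma fourierCoeff_add' {φ χ : AddCircle T → ℂ} (h : SqInt φ) (h' : SqInt χ) (n : ℤ) :
    fourierCoeff (fun t => φ t + χ t) n = fourierCoeff φ n + fourierCoeff χ n := by
  simp only [fourierCoeff_eq, mul_add]
  exact integral_add (h.fourier_mul _).integrable' (h'.fourier_mul _).integrable'

lemma fourierCoeff_sub' {φ χ : AddCircle T → ℂ} (h : SqInt φ) (h' : SqInt χ) (n : ℤ) :
    fourierCoeff (fun t => φ t - χ t) n = fourierCoeff φ n - fourierCoeff χ n := by
  simp only [fourierCoeff_eq, mul_sub]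
  exact integral_sub (h.fourier_mul _).integrable' (h'.fourier_mul _).integrable'

lemma fourierCoeff_const_mul' (c : ℂ) (φ : AddCircle T → ℂ) (n : ℤ) :
    fourierCoeff (fun t => c * φ t) n = c * fourierCoeff φ n :=
  fourierCoeff.const_mul φ c n

lemma fourierCoeff_const (c : ℂ) (n : ℤ) :
    fourierCoeff (fun _ : AddCircle T => c) n = if n = 0 then c else 0 := by
  have := fourierCoeff_const_mul' c (fun t : AddCircle T => fourier 0 t) n
  simp only [fourier_zero, mul_one] at this
  rw [this]
  have h := congrFun (fourierCoeff_fourier (T := T) 0) n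
  have : (fun t : AddCircle T => (1 : ℂ)) = fourier (T := T) 0 := by ext; simp
  rw [this, h]
  simp [Pi.single_apply]

lemma SqInt.fourierCoeff_toLp {φ : AddCircle T → ℂ} (h : SqInt φ) (n : ℤ) :
    fourierBasis.repr (h.toLp φ) n = fourierCoeff φ n := by
  rw [fourierBasis_repr]
  exact congrFun (fourierCoeff_congr_ae h.coeFn_toLp) n

/-- Parseval's formula for the bilinear pairing. -/
lemma SqInt.hasSum_integral_mul {φ χ : AddCircle T → ℂ} (h : SqInt φ) (h' : SqInt χ) :
    HasSum (fun m => fourierCoeff φ m * fourierCoeff χ (-m))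
      (∫ t, φ t * χ t ∂haarAddCircle) := by
  -- The conjugate of `χ` enters because the inner product is conjugate linear in its first slot,
  -- whereas the pairing here is bilinear.
  have key := fourierBasis.hasSum_inner_mul_inner (h'.conj.toLp _) (h.toLp φ)
  have e : ∀ i, inner ℂ (h'.conj.toLp _) (fourierBasis (T := T) i) *
      inner ℂ (fourierBasis i) (h.toLp φ) = fourierCoeff φ i * fourierCoeff χ (-i) := by
    intro i
    rw [← HilbertBasis.repr_apply_apply, h.fourierCoeff_toLp, ← inner_conj_symm,
      ← HilbertBasis.repr_apply_apply, h'.conj.fourierCoeff_toLp, fourierCoeff_conj,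
      Complex.conj_conj, mul_comm]
  simp only [e] at key
  suffices H : ∫ t, φ t * χ t ∂haarAddCircle =
      inner ℂ (h'.conj.toLp _) (h.toLp φ) by rw [H]; exact key
  rw [L2.inner_def]
  refine integral_congr_ae ?_
  filter_upwards [h.coeFn_toLp, h'.conj.coeFn_toLp] with t h1 h2
  simp [h1, h2]

lemma SqInt.hasSum_fourierCoeff_mul {φ χ : AddCircle T → ℂ} (h : SqInt φ) (h' : SqInt χ)
    (n : ℤ) : HasSum (fun m => fourierCoeff φ m * fourierCoeff χ (n - m))
      (fourierCoeff (fun t => φ t * χ t) n) := by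
  have := h.hasSum_integral_mul (h'.fourier_mul (-n))
  simp only [fourierCoeff_fourier_mul] at this
  convert this using 1
  · ext m; congr 2; ring
  · rw [fourierCoeff_eq]
    refine integral_congr_ae (ae_of_all _ fun t => ?_)
    simp only; ring

lemma SqInt.hasSum_norm_sq {φ : AddCircle T → ℂ} (h : SqInt φ) :
    HasSum (fun m => ‖fourierCoeff φ m‖ ^ 2) (l2 φ ^ 2) := by
  have := h.hasSum_integral_mul h.conj
  simp only [fourierCoeff_conj, neg_neg, Complex.mul_conj, Complex.normSq_eq_norm_sq] at this
  rw [l2_sq]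
  have e : ∫ t, ((‖φ t‖ ^ 2 : ℝ) : ℂ) ∂haarAddCircle =
      ((∫ t, ‖φ t‖ ^ 2 ∂haarAddCircle : ℝ) : ℂ) := integral_ofReal
  rw [e] at this
  exact_mod_cast this

lemma SqInt.ae_zero_of_l2 {φ : AddCircle T → ℂ} (h : SqInt φ) (h0 : l2 φ = 0) :
    ∀ᵐ t ∂haarAddCircle, φ t = 0 := by
  have h1 : eLpNorm φ 2 (haarAddCircle (T := T)) = 0 := by
    rw [h.l2_eq, ENNReal.toReal_eq_zero_iff] at h0
    exact h0.resolve_right h.eLpNorm_ne_top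
  exact (eLpNorm_eq_zero_iff h.1 (by norm_num)).1 h1

lemma SqInt.ae_zero {φ : AddCircle T → ℂ} (h : SqInt φ) (h0 : ∀ n, fourierCoeff φ n = 0) :
    ∀ᵐ t ∂haarAddCircle, φ t = 0 := by
  refine h.ae_zero_of_l2 ?_
  have := h.hasSum_norm_sq
  simp only [h0] at this
  simpa using this.unique (a₂ := 0) (by simp)

/-- Restricting the Fourier coefficients to a set of frequencies. -/
lemma SqInt.exists_restrict {φ : AddCircle T → ℂ} (h : SqInt φ) (s : Set ℤ) [DecidablePred (· ∈ s)] :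
    ∃ χ : AddCircle T → ℂ, SqInt χ ∧
      ∀ n, fourierCoeff χ n = if n ∈ s then fourierCoeff φ n else 0 := by
  have hmem : Memℓp (fun n : ℤ => if n ∈ s then fourierCoeff φ n else (0 : ℂ)) 2 := by
    refine (lp.memℓp (fourierBasis.repr (h.toLp φ))).mono' fun n => ?_
    rw [h.fourierCoeff_toLp]
    split_ifs <;> simp
  refine ⟨fourierBasis.repr.symm ⟨_, hmem⟩, Lp.memLp _, fun n => ?_⟩
  rw [← fourierBasis_repr, LinearIsometryEquiv.apply_symm_apply]

end QSP

end

/-! ### Analytic and coanalytic functions; exponentials and harmonic completion -/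

noncomputable section

namespace QSP

open MeasureTheory AddCircle Filter Topology ComplexConjugate
open scoped ENNReal

variable {T : ℝ} [hT : Fact (0 < T)]

/-- Square integrable functions whose Fourier coefficients at positive frequencies vanish. -/
structure Coanalytic (φ : AddCircle T → ℂ) : Prop where
  sqInt : SqInt φ
  coeff : ∀ n > 0, fourierCoeff φ n = 0

/-- Square integrable functions whose Fourier coefficients at negative frequencies vanish. -/
structure Analytic (φ : AddCircle T → ℂ) : Prop where
  sqInt : SqInt φ
  coeff : ∀ n < 0, fourierCoeff φ n = 0

lemma Analytic.conj {φ : AddCircle T → ℂ} (h : Analytic φ) : Coanalytic (fun t => conj (φ t)) :=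
  ⟨h.sqInt.conj, fun n hn => by rw [fourierCoeff_conj, h.coeff _ (by omega), map_zero]⟩

lemma Coanalytic.conj {φ : AddCircle T → ℂ} (h : Coanalytic φ) : Analytic (fun t => conj (φ t)) :=
  ⟨h.sqInt.conj, fun n hn => by rw [fourierCoeff_conj, h.coeff _ (by omega), map_zero]⟩

lemma Analytic.refl {φ : AddCircle T → ℂ} (h : Analytic φ) : Coanalytic (fun t => φ (-t)) :=
  ⟨h.sqInt.refl, fun n hn => by rw [fourierCoeff_refl, h.coeff _ (by omega)]⟩

lemma Coanalytic.refl {φ : AddCircle T → ℂ} (h : Coanalytic φ) : Analytic (fun t => φ (-t)) :=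
  ⟨h.sqInt.refl, fun n hn => by rw [fourierCoeff_refl, h.coeff _ (by omega)]⟩

lemma Coanalytic.const_mul {φ : AddCircle T → ℂ} (h : Coanalytic φ) (c : ℂ) :
    Coanalytic (fun t => c * φ t) :=
  ⟨h.sqInt.const_mul c, fun n hn => by rw [fourierCoeff_const_mul', h.coeff n hn, mul_zero]⟩

lemma Coanalytic.add {φ χ : AddCircle T → ℂ} (h : Coanalytic φ) (h' : Coanalytic χ) :
    Coanalytic (fun t => φ t + χ t) :=
  ⟨h.sqInt.add h'.sqInt, fun n hn => by
    rw [fourierCoeff_add' h.sqInt h'.sqInt, h.coeff n hn, h'.coeff n hn, add_zero]⟩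

lemma Coanalytic.sub {φ χ : AddCircle T → ℂ} (h : Coanalytic φ) (h' : Coanalytic χ) :
    Coanalytic (fun t => φ t - χ t) :=
  ⟨h.sqInt.sub h'.sqInt, fun n hn => by
    rw [fourierCoeff_sub' h.sqInt h'.sqInt, h.coeff n hn, h'.coeff n hn, sub_zero]⟩

lemma Coanalytic.const (c : ℂ) : Coanalytic (fun _ : AddCircle T => c) :=
  ⟨SqInt.const c, fun n hn => by rw [fourierCoeff_const, if_neg hn.ne']⟩

lemma Analytic.const_mul {φ : AddCircle T → ℂ} (h : Analytic φ) (c : ℂ) :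
    Analytic (fun t => c * φ t) :=
  ⟨h.sqInt.const_mul c, fun n hn => by rw [fourierCoeff_const_mul', h.coeff n hn, mul_zero]⟩

lemma Analytic.add {φ χ : AddCircle T → ℂ} (h : Analytic φ) (h' : Analytic χ) :
    Analytic (fun t => φ t + χ t) :=
  ⟨h.sqInt.add h'.sqInt, fun n hn => by
    rw [fourierCoeff_add' h.sqInt h'.sqInt, h.coeff n hn, h'.coeff n hn, add_zero]⟩

lemma Analytic.sub {φ χ : AddCircle T → ℂ} (h : Analytic φ) (h' : Analytic χ) :
    Analytic (fun t => φ t - χ t) :=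
  ⟨h.sqInt.sub h'.sqInt, fun n hn => by
    rw [fourierCoeff_sub' h.sqInt h'.sqInt, h.coeff n hn, h'.coeff n hn, sub_zero]⟩

lemma Analytic.const (c : ℂ) : Analytic (fun _ : AddCircle T => c) :=
  ⟨SqInt.const c, fun n hn => by rw [fourierCoeff_const, if_neg hn.ne]⟩

lemma SqInt.congr {φ χ : AddCircle T → ℂ} (h : SqInt φ) (e : φ =ᵐ[haarAddCircle] χ) : SqInt χ :=
  (memLp_congr_ae e).1 h

lemma Coanalytic.congr {φ χ : AddCircle T → ℂ} (h : Coanalytic φ) (e : φ =ᵐ[haarAddCircle] χ) :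
    Coanalytic χ :=
  ⟨h.sqInt.congr e, fun n hn => by rw [← fourierCoeff_congr_ae e, h.coeff n hn]⟩

lemma Coanalytic.coeff_mul {φ χ : AddCircle T → ℂ} (h : Coanalytic φ) (h' : Coanalytic χ) {n : ℤ}
    (hn : 0 < n) : fourierCoeff (fun t => φ t * χ t) n = 0 := by
  refine (h.sqInt.hasSum_fourierCoeff_mul h'.sqInt n).unique ?_
  convert hasSum_zero using 2 with m
  rcases lt_or_ge 0 m with hm | hm
  · rw [h.coeff m hm, zero_mul]
  · rw [h'.coeff _ (by omega), mul_zero]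

/-- In the convolution sum for frequency `0`, every index `m ≠ 0` puts a positive frequency on one
of the factors. Thus the mean is multiplicative on coanalytic functions, which is used throughout to
compute means of products. -/
lemma Coanalytic.coeff_zero_mul {φ χ : AddCircle T → ℂ} (h : Coanalytic φ) (h' : Coanalytic χ) :
    fourierCoeff (fun t => φ t * χ t) 0 = fourierCoeff φ 0 * fourierCoeff χ 0 := by
  refine (h.sqInt.hasSum_fourierCoeff_mul h'.sqInt 0).unique ?_
  refine hasSum_single 0 fun m hm => ?_
  rcases lt_or_gt_of_ne hm with hm | hm
  · rw [h'.coeff _ (by omega), mul_zero]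
  · rw [h.coeff m hm, zero_mul]

lemma Coanalytic.bdd_mul {φ m : AddCircle T → ℂ} (hm : Coanalytic m) (h : Coanalytic φ) {C : ℝ}
    (H : ∀ᵐ t ∂haarAddCircle, ‖m t‖ ≤ C) : Coanalytic (fun t => m t * φ t) :=
  ⟨h.sqInt.bdd_mul' hm.sqInt.1 H, fun _ hn => hm.coeff_mul h hn⟩

/-- A coanalytic function with real mean is controlled by its real part. -/
lemma Coanalytic.l2_sq_le {g : AddCircle T → ℂ} (h : Coanalytic g)
    (h0 : (fourierCoeff g 0).im = 0) :
    l2 g ^ 2 ≤ 2 * l2 (fun t => ((g t).re : ℂ)) ^ 2 := by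
  have h1 := h.coeff_zero_mul h
  rw [fourierCoeff_zero_eq] at h1
  have h2 : (∫ t, g t * g t ∂haarAddCircle).re = ∫ t, (g t * g t).re ∂haarAddCircle := by
    exact (Complex.reCLM.integral_comp_comm (h.sqInt.mul_integrable h.sqInt)).symm
  have hre : Integrable (fun t => (g t).re ^ 2) (haarAddCircle (T := T)) := by
    simpa using (MemLp.re h.sqInt).integrable_sq
  -- Pointwise `|g|² = 2 (Re g)² - Re (g²)`, and the integral of `g²` is the square of a real mean,
  -- hence nonnegative.
  have e1 : l2 g ^ 2 = ∫ t, (2 * (g t).re ^ 2 - (g t * g t).re) ∂haarAddCircle := by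
    rw [l2_sq]
    refine integral_congr_ae (ae_of_all _ fun t => ?_)
    simp only [← Complex.normSq_eq_norm_sq, Complex.normSq_apply, Complex.mul_re]
    ring
  have e2 : ∫ t, (2 * (g t).re ^ 2 - (g t * g t).re) ∂haarAddCircle =
      ∫ t, 2 * (g t).re ^ 2 ∂haarAddCircle - ∫ t, (g t * g t).re ∂haarAddCircle :=
    integral_sub (hre.const_mul 2) (h.sqInt.mul_integrable h.sqInt).re
  rw [e1, e2, ← h2, h1, integral_const_mul, SqInt.ofReal_l2, Complex.mul_re, h0]
  nlinarith [sq_nonneg (fourierCoeff g 0).re]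

lemma Coanalytic.pow {φ : AddCircle T → ℂ} (h : Coanalytic φ) {C : ℝ}
    (H : ∀ᵐ t ∂haarAddCircle, ‖φ t‖ ≤ C) (k : ℕ) :
    Coanalytic (fun t => φ t ^ k) ∧ fourierCoeff (fun t => φ t ^ k) 0 = fourierCoeff φ 0 ^ k := by
  induction k with
  | zero => simpa [fourierCoeff_const] using Coanalytic.const 1
  | succ k ih =>
    simp only [pow_succ']
    exact ⟨h.bdd_mul ih.1 H, by rw [h.coeff_zero_mul ih.1, ih.2]⟩

/-- The exponential series may be integrated term by term because its terms are dominated by `C^k /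
k!`. -/
lemma Coanalytic.hasSum_exp {φ : AddCircle T → ℂ} (h : Coanalytic φ) {C : ℝ}
    (H : ∀ᵐ t ∂haarAddCircle, ‖φ t‖ ≤ C) (n : ℤ) :
    HasSum (fun k : ℕ => (k.factorial : ℂ)⁻¹ * fourierCoeff (fun t => φ t ^ k) n)
      (fourierCoeff (fun t => Complex.exp (φ t)) n) := by
  have key := hasSum_integral_of_summable_integral_norm (μ := haarAddCircle (T := T))
    (F := fun (k : ℕ) t => (k.factorial : ℂ)⁻¹ * (fourier (-n) t * φ t ^ k))
    (fun k => (((h.pow H k).1.sqInt.fourier_mul (-n)).integrable').const_mul _) ?_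
  · simp only [integral_const_mul] at key
    have e : fourierCoeff (fun t => Complex.exp (φ t)) n = ∫ t, ∑' k : ℕ,
        (k.factorial : ℂ)⁻¹ * (fourier (-n) t * φ t ^ k) ∂haarAddCircle := by
      rw [fourierCoeff_eq]
      refine integral_congr_ae (ae_of_all _ fun t => ?_)
      simp only
      rw [Complex.exp_eq_exp_ℂ, NormedSpace.exp_eq_tsum_div]
      simp only [← tsum_mul_left]
      congr 1; ext k; ring
    rw [e]
    exact key
  · refine Summable.of_nonneg_of_le (fun k => integral_nonneg fun t => norm_nonneg _) (fun k => ?_)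
      (Real.summable_pow_div_factorial C)
    have : ∀ᵐ t ∂haarAddCircle (T := T), ‖(k.factorial : ℂ)⁻¹ * (fourier (-n) t * φ t ^ k)‖ ≤
        C ^ k / k.factorial := by
      filter_upwards [H] with t ht
      rw [norm_mul, norm_mul, norm_fourier_apply, one_mul, norm_pow, div_eq_inv_mul]
      simp only [norm_inv, Complex.norm_natCast]
      gcongr
    refine (integral_mono_of_nonneg (ae_of_all _ fun t => norm_nonneg _)
      (integrable_const _) this).trans ?_
    simp

lemma Coanalytic.exp_of_bdd {φ : AddCircle T → ℂ} (h : Coanalytic φ) {C : ℝ}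
    (H : ∀ᵐ t ∂haarAddCircle, ‖φ t‖ ≤ C) :
    Coanalytic (fun t => Complex.exp (φ t)) ∧
      fourierCoeff (fun t => Complex.exp (φ t)) 0 = Complex.exp (fourierCoeff φ 0) := by
  refine ⟨⟨SqInt.of_bound (Complex.continuous_exp.comp_aestronglyMeasurable h.sqInt.1)
    (C := Real.exp C) ?_, fun n hn => (h.hasSum_exp H n).unique ?_⟩, (h.hasSum_exp H 0).unique ?_⟩
  · filter_upwards [H] with t ht
    rw [Complex.norm_exp]
    exact Real.exp_le_exp.2 ((Complex.re_le_norm _).trans ht)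
  · simp only [(h.pow H _).1.coeff n hn, mul_zero]
    exact hasSum_zero
  · simp only [(h.pow H _).2]
    rw [Complex.exp_eq_exp_ℂ]
    simpa [div_eq_inv_mul] using NormedSpace.expSeries_div_hasSum_exp (fourierCoeff φ 0)

/-- This is the mean value inequality on a half plane. Only real parts need a bound, which matters
because harmonic conjugates of bounded functions can be unbounded. -/
lemma norm_exp_sub_exp_le {z w : ℂ} {C : ℝ} (hz : z.re ≤ C) (hw : w.re ≤ C) :
    ‖Complex.exp z - Complex.exp w‖ ≤ Real.exp C * ‖z - w‖ := by
  have hs : Convex ℝ {z : ℂ | z.re ≤ C} := convex_halfSpace_re_le C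
  refine hs.norm_image_sub_le_of_norm_deriv_le (f := Complex.exp)
    (fun x _ => Complex.differentiableAt_exp) (fun x hx => ?_) hw hz
  rw [Complex.deriv_exp, Complex.norm_exp]
  exact Real.exp_le_exp.2 hx

/-- A positive frequency term `c zⁿ` has the same real part as `conj c · z⁻ⁿ`, so every frequency
can be folded to the nonpositive side; an imaginary constant then makes the mean real. -/
lemma exists_coanalytic_re_eq {p : C(AddCircle T, ℂ)}
    (hp : p ∈ Submodule.span ℂ (Set.range (fourier (T := T)))) :
    ∃ q : C(AddCircle T, ℂ), Coanalytic (fun t => q t) ∧ (fourierCoeff (fun t => q t) 0).im = 0 ∧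
      ∀ t, (q t).re = (p t).re := by
  -- Taking real parts is not complex linear, so the induction carries an arbitrary scalar `c` in
  -- order to pass through the scalar multiplication case.
  have key : ∀ c : ℂ, ∃ q : C(AddCircle T, ℂ), Coanalytic (fun t => q t) ∧
      ∀ t, (q t).re = (c * p t).re := by
    induction hp using Submodule.span_induction with
    | mem x hx =>
      obtain ⟨n, rfl⟩ := hx
      have hco : ∀ m ≤ 0, Coanalytic (fun t => fourier (T := T) m t) := fun m hm =>
        ⟨sqInt_continuousMap _, fun k hk => by
          rw [show (fun t => fourier (T := T) m t) = fourier m from rfl, fourierCoeff_fourier,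
            Pi.single_eq_of_ne (by omega)]⟩
      intro c
      rcases le_or_gt n 0 with hn | hn
      · exact ⟨c • fourier n, (hco n hn).const_mul c, fun t => by simp⟩
      · exact ⟨conj c • fourier (-n), (hco (-n) (by omega)).const_mul _, fun t => by
          rw [ContinuousMap.smul_apply, fourier_neg, smul_eq_mul, ← map_mul, Complex.conj_re]⟩
    | zero => exact fun c => ⟨0, Coanalytic.const 0, fun t => by simp⟩
    | add x y _ _ hx hy =>
      intro c
      obtain ⟨q, h1, h2⟩ := hx c
      obtain ⟨q', h1', h2'⟩ := hy c
      refine ⟨q + q', h1.add h1', fun t => ?_⟩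
      rw [ContinuousMap.add_apply, ContinuousMap.add_apply, mul_add, Complex.add_re,
        Complex.add_re, h2, h2']
    | smul c x _ hx =>
      intro c'
      obtain ⟨q, h1, h2⟩ := hx (c' * c)
      exact ⟨q, h1, fun t => by rw [h2, ContinuousMap.smul_apply, smul_eq_mul, mul_assoc]⟩
  replace key := key 1
  simp only [one_mul] at key
  obtain ⟨q, h1, h2⟩ := key
  set c : ℂ := -(((fourierCoeff (fun t => q t) 0).im : ℂ) * Complex.I) with hc
  refine ⟨q + ContinuousMap.const _ c, h1.add (Coanalytic.const c), ?_, fun t => ?_⟩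
  · have := fourierCoeff_add' h1.sqInt (SqInt.const c) 0
    simp only [ContinuousMap.add_apply, ContinuousMap.const_apply]
    rw [this, fourierCoeff_const]
    simp [hc]
  · simp [h2, hc]

lemma exists_continuous_approx {v : AddCircle T → ℝ}
    (hv : AEStronglyMeasurable v (haarAddCircle (T := T))) {C : ℝ} (hC : 0 ≤ C)
    (H : ∀ᵐ t ∂haarAddCircle, |v t| ≤ C) {δ : ℝ} (hδ : 0 < δ) :
    ∃ w : C(AddCircle T, ℂ), (∀ t, ‖w t‖ ≤ C) ∧ l2 (fun t => (v t : ℂ) - w t) ≤ δ := by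
  have hm : MemLp v 2 (haarAddCircle (T := T)) := MemLp.of_bound hv C (by simpa using H)
  obtain ⟨w, hw, hw2⟩ := hm.exists_boundedContinuous_eLpNorm_sub_le (by norm_num)
    (ε := ENNReal.ofReal δ) (by simpa using hδ)
  have hvc : SqInt (fun t => (v t : ℂ)) := hm.ofReal
  have hwc : SqInt (fun t => (w t : ℂ)) := hw2.ofReal
  -- Truncation at `±C` does not increase the distance to `v`, because `v` itself lies in `[-C, C]`.
  let w' : C(AddCircle T, ℂ) := ⟨fun t => ((max (-C) (min C (w t)) : ℝ) : ℂ), by fun_prop⟩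
  have hw' : ∀ t, w' t = ((max (-C) (min C (w t)) : ℝ) : ℂ) := fun t => rfl
  have hb : ∀ t, |max (-C) (min C (w t))| ≤ C := fun t => by
    rw [abs_le]
    exact ⟨le_max_left _ _, max_le (by linarith) (min_le_left _ _)⟩
  refine ⟨w', fun t => ?_, ?_⟩
  · rw [hw', Complex.norm_real]
    exact hb t
  · have hs : SqInt (fun t => (v t : ℂ) - w t) := hvc.sub hwc
    have h1 : l2 (fun t => (v t : ℂ) - w' t) ≤ 1 * l2 (fun t => (v t : ℂ) - w t) := by
      refine hs.l2_le zero_le_one ?_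
      filter_upwards [H] with t ht
      rw [one_mul, hw']
      simp only [← Complex.ofReal_sub, Complex.norm_real, Real.norm_eq_abs]
      rw [abs_le] at ht
      rcases max_cases (-C) (min C (w t)) with h | h <;> rcases min_cases C (w t) with h' | h' <;>
        rw [h.1, abs_le] <;> constructor <;>
        linarith [le_abs_self (v t - w t), neg_abs_le (v t - w t)]
    refine h1.trans ?_
    rw [one_mul, hs.l2_eq]
    refine ENNReal.toReal_le_of_le_ofReal hδ.le (le_trans (le_of_eq ?_) hw)
    refine eLpNorm_congr_norm_ae (ae_of_all _ fun t => ?_)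
    simp [← Complex.ofReal_sub]

/-- Bounded real functions are `L²`-limits of uniformly bounded real parts of coanalytic
trigonometric polynomials. -/
lemma exists_coanalytic_approx {v : AddCircle T → ℝ}
    (hv : AEStronglyMeasurable v (haarAddCircle (T := T))) {C : ℝ} (hC : 0 ≤ C)
    (H : ∀ᵐ t ∂haarAddCircle, |v t| ≤ C) {δ : ℝ} (hδ : 0 < δ) :
    ∃ q : C(AddCircle T, ℂ), Coanalytic (fun t => q t) ∧ (fourierCoeff (fun t => q t) 0).im = 0 ∧
      (∀ t, |(q t).re| ≤ C + 1) ∧ l2 (fun t => (v t : ℂ) - ((q t).re : ℂ)) ≤ δ := by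
  obtain ⟨w, hw1, hw2⟩ := exists_continuous_approx hv hC H (half_pos hδ)
  have hm : MemLp v 2 (haarAddCircle (T := T)) := MemLp.of_bound hv C (by simpa using H)
  have hmem : w ∈ closure (Submodule.span ℂ (Set.range (fourier (T := T))) : Set C(AddCircle T, ℂ)) := by
    rw [← Submodule.topologicalClosure_coe, span_fourier_closure_eq_top]; trivial
  obtain ⟨p, hp, hwp⟩ := Metric.mem_closure_iff.1 hmem (min 1 (δ / 2)) (by positivity)
  obtain ⟨q, h1, h2, h3⟩ := exists_coanalytic_re_eq hp
  have hwp' : ∀ t, ‖w t - p t‖ ≤ min 1 (δ / 2) := fun t => by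
    rw [← dist_eq_norm]
    exact (ContinuousMap.dist_apply_le_dist t).trans hwp.le
  refine ⟨q, h1, h2, fun t => ?_, ?_⟩
  · rw [h3]
    refine (Complex.abs_re_le_norm _).trans ?_
    have e : p t = w t - (w t - p t) := by ring
    rw [e]
    exact (norm_sub_le _ _).trans (add_le_add (hw1 t) ((hwp' t).trans (min_le_left _ _)))
  · have hvw : SqInt (fun t => (v t : ℂ) - w t) := hm.ofReal.sub (sqInt_continuousMap w)
    have hwp2 : SqInt (fun t => w t - p t) := sqInt_continuousMap (w - p)
    have hvp : SqInt (fun t => ((v t : ℂ) - w t) + (w t - p t)) := hvw.add hwp2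
    have e1 : l2 (fun t => (v t : ℂ) - ((q t).re : ℂ)) ≤
        1 * l2 (fun t => ((v t : ℂ) - w t) + (w t - p t)) := by
      refine hvp.l2_le zero_le_one (ae_of_all _ fun t => ?_)
      rw [h3, one_mul, sub_add_sub_cancel, ← Complex.ofReal_sub, Complex.norm_real,
        Real.norm_eq_abs]
      simpa using Complex.abs_re_le_norm ((v t : ℂ) - p t)
    have e2 : l2 (fun t => w t - p t) ≤ δ / 2 :=
      l2_le_of_bound (by positivity) (ae_of_all _ fun t => (hwp' t).trans (min_le_right _ _))
    linarith [hvw.l2_add_le hwp2]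

lemma tendsto_fourierCoeff {φ : ℕ → AddCircle T → ℂ} {χ : AddCircle T → ℂ}
    (h : ∀ k, SqInt (φ k)) (h' : SqInt χ)
    (H : Tendsto (fun k => l2 (fun t => φ k t - χ t)) atTop (𝓝 0)) (n : ℤ) :
    Tendsto (fun k => fourierCoeff (φ k) n) atTop (𝓝 (fourierCoeff χ n)) := by
  rw [tendsto_iff_norm_sub_tendsto_zero]
  refine squeeze_zero (fun _ => norm_nonneg _) (fun k => ?_) H
  rw [← fourierCoeff_sub' (h k) h']
  exact SqInt.norm_fourierCoeff_le ((h k).sub h') n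

/-- The exponential of a coanalytic function with bounded real part is coanalytic. -/
lemma Coanalytic.exp {g : AddCircle T → ℂ} (h : Coanalytic g)
    (h0 : (fourierCoeff g 0).im = 0) {C : ℝ} (H : ∀ᵐ t ∂haarAddCircle, |(g t).re| ≤ C) :
    Coanalytic (fun t => Complex.exp (g t)) ∧
      fourierCoeff (fun t => Complex.exp (g t)) 0 = Complex.exp (fourierCoeff g 0) := by
  have hC : 0 ≤ C := by
    obtain ⟨t, ht⟩ := H.exists
    exact (abs_nonneg _).trans ht
  have hre : AEStronglyMeasurable (fun t => (g t).re) (haarAddCircle (T := T)) :=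
    Complex.continuous_re.comp_aestronglyMeasurable h.sqInt.1
  -- Since `Im g` may be unbounded, the power series argument does not apply to `g`. It applies to
  -- the approximating polynomials, whose real parts share the bound `C + 1`, so the exponentials
  -- converge in `L²`.
  choose q hq1 hq2 hq3 hq4 using fun k : ℕ =>
    exists_coanalytic_approx hre hC H (δ := 1 / ((k : ℝ) + 1)) (by positivity)
  have hgq : Tendsto (fun k => l2 (fun t => q k t - g t)) atTop (𝓝 0) := by
    have hlim : Tendsto (fun k : ℕ => 2 * (1 / ((k : ℝ) + 1))) atTop (𝓝 0) := by
      simpa using tendsto_one_div_add_atTop_nhds_zero_nat.const_mul (2 : ℝ)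
    refine squeeze_zero (fun _ => l2_nonneg _) (fun k => ?_) hlim
    -- Only the real parts are known to be close; coanalyticity with real mean upgrades this to
    -- closeness of the functions themselves.
    have h1 := ((hq1 k).sub h).l2_sq_le (by
      rw [fourierCoeff_sub' (hq1 k).sqInt h.sqInt, Complex.sub_im, hq2, h0, sub_zero])
    have e : l2 (fun t => ((q k t - g t).re : ℂ)) =
        l2 (fun t => ((g t).re : ℂ) - ((q k t).re : ℂ)) := by
      unfold l2
      congr 2; ext t
      simp only [← Complex.ofReal_sub, Complex.sub_re, Complex.norm_real, Real.norm_eq_abs]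
      rw [abs_sub_comm]
    rw [e] at h1
    have h2 := hq4 k
    have h3 := l2_nonneg (fun t => ((g t).re : ℂ) - ((q k t).re : ℂ))
    refine abs_le_of_sq_le_sq' ?_ (by positivity) |>.2
    nlinarith
  have hexpg : SqInt (fun t => Complex.exp (g t)) := by
    refine SqInt.of_bound (Complex.continuous_exp.comp_aestronglyMeasurable h.sqInt.1)
      (C := Real.exp C) ?_
    filter_upwards [H] with t ht
    rw [Complex.norm_exp]
    exact Real.exp_le_exp.2 ((le_abs_self _).trans ht)
  have hqe := fun k => (hq1 k).exp_of_bdd (C := ‖q k‖)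
    (ae_of_all _ fun t => (q k).norm_coe_le_norm t)
  have hlim : Tendsto (fun k => l2 (fun t => Complex.exp (q k t) - Complex.exp (g t))) atTop
      (𝓝 0) := by
    have := hgq.const_mul (Real.exp (C + 1))
    rw [mul_zero] at this
    refine squeeze_zero (fun _ => l2_nonneg _) (fun k => ?_) this
    refine ((hq1 k).sub h).sqInt.l2_le (by positivity) ?_
    filter_upwards [H] with t ht
    exact norm_exp_sub_exp_le ((le_abs_self _).trans (hq3 k t))
      (((le_abs_self _).trans ht).trans (by linarith))
  have hcoef := tendsto_fourierCoeff (fun k => (hqe k).1.sqInt) hexpg hlim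
  refine ⟨⟨hexpg, fun n hn => tendsto_nhds_unique (hcoef n) ?_⟩,
    tendsto_nhds_unique (hcoef 0) ?_⟩
  · simp only [(hqe _).1.coeff n hn]
    exact tendsto_const_nhds
  · simp only [(hqe _).2]
    exact (Complex.continuous_exp.tendsto _).comp
      (tendsto_fourierCoeff (fun k => (hq1 k).sqInt) h.sqInt hgq 0)

/-- Every bounded even real function is the real part of a coanalytic function with real mean and
the corresponding reflection symmetry. -/
lemma exists_coanalytic_completion {v : AddCircle T → ℝ}
    (hv : AEStronglyMeasurable v (haarAddCircle (T := T))) {C : ℝ}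
    (H : ∀ᵐ t ∂haarAddCircle, |v t| ≤ C) (heven : ∀ t, v (-t) = v t) :
    ∃ g : AddCircle T → ℂ, Coanalytic g ∧ fourierCoeff g 0 = ((∫ t, v t ∂haarAddCircle : ℝ) : ℂ) ∧
      (∀ᵐ t ∂haarAddCircle, (g t).re = v t) ∧ ∀ᵐ t ∂haarAddCircle, g (-t) = conj (g t) := by
  have hm : SqInt (fun t => (v t : ℂ)) := (MemLp.of_bound hv C (by simpa using H)).ofReal
  have hrefl : ∀ n, fourierCoeff (fun t => (v t : ℂ)) (-n) = fourierCoeff (fun t => (v t : ℂ)) n := by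
    intro n
    rw [← fourierCoeff_refl]
    simp only [heven]
  have hconj : ∀ n, conj (fourierCoeff (fun t => (v t : ℂ)) n) =
      fourierCoeff (fun t => (v t : ℂ)) n := by
    intro n
    have := fourierCoeff_conj (fun t => (v t : ℂ)) (-n)
    simp only [Complex.conj_ofReal, neg_neg] at this
    rw [← this, hrefl]
  -- The completion is the mean plus twice the negative frequency part. Evenness makes the
  -- coefficients of `v` real, and this yields both the real part and the reflection symmetry.
  obtain ⟨p, hp, hpc⟩ := hm.exists_restrict (Set.Iio 0)
  have h0 : fourierCoeff (fun t => (v t : ℂ)) 0 = ((∫ t, v t ∂haarAddCircle : ℝ) : ℂ) := by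
    rw [fourierCoeff_zero_eq]
    exact integral_ofReal
  set c : ℂ := ((∫ t, v t ∂haarAddCircle : ℝ) : ℂ) with hc
  have h2p : SqInt (fun t => 2 * p t) := hp.const_mul 2
  have hg : ∀ n, fourierCoeff (fun t => c + 2 * p t) n = (if n = 0 then c else 0) +
      2 * (if n < 0 then fourierCoeff (fun t => (v t : ℂ)) n else 0) := by
    intro n
    rw [fourierCoeff_add' (SqInt.const c) h2p, fourierCoeff_const,
      fourierCoeff_const_mul', hpc]
    rfl
  have hgs : SqInt (fun t => c + 2 * p t) := (SqInt.const c).add h2p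
  refine ⟨fun t => c + 2 * p t, ⟨hgs, fun n hn => ?_⟩, ?_, ?_, ?_⟩
  · rw [hg, if_neg hn.ne', if_neg (by omega)]; simp
  · rw [hg]; simp
  · have hd : SqInt (fun t => (c + 2 * p t) + conj (c + 2 * p t)) := hgs.add hgs.conj
    have h2v : SqInt (fun t => 2 * (v t : ℂ)) := hm.const_mul 2
    have : SqInt (fun t => ((c + 2 * p t) + conj (c + 2 * p t)) - 2 * (v t : ℂ)) := hd.sub h2v
    have hz := this.ae_zero fun n => by
      rw [fourierCoeff_sub' hd h2v, fourierCoeff_add' hgs hgs.conj, fourierCoeff_conj, hg, hg,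
        fourierCoeff_const_mul']
      rcases lt_trichotomy n 0 with hn | rfl | hn
      · simp [hn, hn.ne, hn.not_gt]
      · simp [h0, hc]; ring
      · simp [hn, hn.ne', hn.not_gt, hrefl, hconj, Complex.conj_ofNat]
    filter_upwards [hz] with t ht
    have := congrArg Complex.re ht
    simp at this ⊢
    linarith
  · have : SqInt (fun t => (c + 2 * p (-t)) - conj (c + 2 * p t)) := hgs.refl.sub hgs.conj
    have hz := this.ae_zero fun n => by
      rw [fourierCoeff_sub' hgs.refl hgs.conj, fourierCoeff_conj,
        fourierCoeff_refl (fun t => c + 2 * p t), hg]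
      split_ifs <;> simp [hconj, hc, Complex.conj_ofNat]
    filter_upwards [hz] with t ht
    exact sub_eq_zero.1 ht

end QSP

end

/-! ### The Riemann–Hilbert problem with contractive coefficient -/

noncomputable section

namespace QSP

open MeasureTheory AddCircle Filter Topology ComplexConjugate
open scoped ENNReal

variable {T : ℝ} [hT : Fact (0 < T)]

lemma SqInt.norm_integral_mul_le {φ χ : AddCircle T → ℂ} (h : SqInt φ) (h' : SqInt χ) :
    ‖∫ t, φ t * χ t ∂haarAddCircle‖ ≤ l2 φ * l2 χ := by
  have e : ∫ t, φ t * χ t ∂haarAddCircle = inner ℂ (h.conj.toLp _) (h'.toLp χ) := by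
    rw [L2.inner_def]
    refine integral_congr_ae ?_
    filter_upwards [h'.coeFn_toLp, h.conj.coeFn_toLp] with t h1 h2
    simp [h1, h2, mul_comm]
  rw [e]
  refine (norm_inner_le_norm _ _).trans (le_of_eq ?_)
  rw [Lp.norm_toLp, Lp.norm_toLp, ← h'.l2_eq, ← h.conj.l2_eq, l2_conj]

lemma SqInt.l2_le_of_coeff {φ χ : AddCircle T → ℂ} (h : SqInt φ) (h' : SqInt χ)
    (H : ∀ n, ‖fourierCoeff φ n‖ ≤ ‖fourierCoeff χ n‖) : l2 φ ≤ l2 χ := by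
  refine abs_le_of_sq_le_sq' ?_ (l2_nonneg _) |>.2
  exact hasSum_le (fun n => pow_le_pow_left₀ (norm_nonneg _) (H n) 2) h.hasSum_norm_sq
    h'.hasSum_norm_sq

lemma norm_lp_eq_l2 (X : Lp ℂ 2 (haarAddCircle (T := T))) : ‖X‖ = l2 X := by
  rw [Lp.norm_def, SqInt.l2_eq (Lp.memLp X)]

/-- `X` is analytic and `X(z) + m(z) X(1/z)` is coanalytic with mean `c`. -/
structure IsSolution (m : AddCircle T → ℂ) (c : ℂ) (X : AddCircle T → ℂ) : Prop where
  analytic : Analytic X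
  coanalytic : Coanalytic (fun t => X t + m t * X (-t))
  mean : fourierCoeff (fun t => X t + m t * X (-t)) 0 = c

lemma IsSolution.const_mul {m X : AddCircle T → ℂ} {c : ℂ} (h : IsSolution m c X) (b : ℂ) :
    IsSolution m (b * c) (fun t => b * X t) := by
  have e : (fun t => b * X t + m t * (b * X (-t))) = fun t => b * (X t + m t * X (-t)) := by
    ext t; ring
  refine ⟨h.analytic.const_mul b, ?_, ?_⟩ <;> rw [e]
  · exact h.coanalytic.const_mul b
  · rw [fourierCoeff_const_mul', h.mean]

lemma IsSolution.sub {m X Y : AddCircle T → ℂ} {c d : ℂ} (h : IsSolution m c X)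
    (h' : IsSolution m d Y) : IsSolution m (c - d) (fun t => X t - Y t) := by
  have e : (fun t => X t - Y t + m t * (X (-t) - Y (-t))) =
      fun t => (X t + m t * X (-t)) - (Y t + m t * Y (-t)) := by
    ext t; ring
  refine ⟨h.analytic.sub h'.analytic, ?_, ?_⟩ <;> rw [e]
  · exact h.coanalytic.sub h'.coanalytic
  · rw [fourierCoeff_sub' h.coanalytic.sqInt h'.coanalytic.sqInt, h.mean, h'.mean]

/-- Let `R` be the strictly coanalytic remainder `X + m X(1/z) - h`. Then `conj X · R` has mean
zero, so `‖X‖²` is the pairing of `conj X` with `h - m X(1/z)`, at most `‖X‖ (‖h‖ + κ ‖X‖)`. This a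
priori estimate gives uniqueness, and also the convergence of the solutions to `1`. -/
lemma l2_le_of_strictly_coanalytic {m X h : AddCircle T → ℂ} {κ : ℝ}
    (hm : AEStronglyMeasurable m (haarAddCircle (T := T)))
    (hmκ : ∀ᵐ t ∂haarAddCircle, ‖m t‖ ≤ κ) (hX : Analytic X) (hh : SqInt h)
    (hc : Coanalytic (fun t => X t + m t * X (-t) - h t))
    (hc0 : fourierCoeff (fun t => X t + m t * X (-t) - h t) 0 = 0) :
    (1 - κ) * l2 X ≤ l2 h := by
  have hκ0 : 0 ≤ κ := by
    obtain ⟨t, ht⟩ := hmκ.exists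
    exact (norm_nonneg _).trans ht
  have hmX : SqInt (fun t => m t * X (-t)) := hX.sqInt.refl.bdd_mul' hm hmκ
  have h1 := hX.conj.coeff_zero_mul hc
  rw [hc0, mul_zero, fourierCoeff_zero_eq] at h1
  have hd : SqInt (fun t => h t - m t * X (-t)) := hh.sub hmX
  have h2 : ((l2 X ^ 2 : ℝ) : ℂ) = ∫ t, conj (X t) * (h t - m t * X (-t)) ∂haarAddCircle := by
    have e : ((l2 X ^ 2 : ℝ) : ℂ) = ∫ t, conj (X t) * X t ∂haarAddCircle := by
      rw [l2_sq]
      refine integral_ofReal.symm.trans (integral_congr_ae (ae_of_all _ fun t => ?_))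
      simp [Complex.conj_mul']
    rw [e, ← sub_eq_zero, ← integral_sub (hX.sqInt.conj.mul_integrable hX.sqInt)
      (hX.sqInt.conj.mul_integrable hd), ← h1]
    refine integral_congr_ae (ae_of_all _ fun t => ?_)
    simp only; ring
  have h3 : l2 X ^ 2 ≤ l2 X * (l2 h + κ * l2 X) := by
    have h4 : l2 X ^ 2 = ‖((l2 X ^ 2 : ℝ) : ℂ)‖ := by
      rw [Complex.norm_real, Real.norm_of_nonneg (by positivity)]
    have h5 : l2 (fun t => m t * X (-t)) ≤ κ * l2 X := by
      rw [← l2_refl X]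
      refine hX.sqInt.refl.l2_le hκ0 ?_
      filter_upwards [hmκ] with t ht
      rw [norm_mul]
      exact mul_le_mul_of_nonneg_right ht (norm_nonneg _)
    rw [h4, h2]
    refine (hX.sqInt.conj.norm_integral_mul_le hd).trans ?_
    rw [l2_conj]
    refine mul_le_mul_of_nonneg_left ?_ (l2_nonneg _)
    linarith [hh.l2_sub_le hmX]
  rcases (l2_nonneg X).eq_or_lt with h0 | h0
  · rw [← h0, mul_zero]; exact l2_nonneg _
  · have : l2 X ≤ l2 h + κ * l2 X := le_of_mul_le_mul_left (by nlinarith) h0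
    linarith

lemma IsSolution.unique {m X Y : AddCircle T → ℂ} {c : ℂ} {κ : ℝ} (hκ : κ < 1)
    (hm : AEStronglyMeasurable m (haarAddCircle (T := T)))
    (hmκ : ∀ᵐ t ∂haarAddCircle, ‖m t‖ ≤ κ) (h : IsSolution m c X) (h' : IsSolution m c Y) :
    ∀ᵐ t ∂haarAddCircle, X t = Y t := by
  have hs := h.sub h'
  have := l2_le_of_strictly_coanalytic hm hmκ hs.analytic (SqInt.const 0)
    (by simpa using hs.coanalytic) (by simpa using hs.mean)
  rw [l2_const, norm_zero] at this
  have h0 : l2 (fun t => X t - Y t) = 0 := by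
    have := l2_nonneg (fun t => X t - Y t)
    nlinarith
  filter_upwards [hs.analytic.sqInt.ae_zero_of_l2 h0] with t ht
  exact sub_eq_zero.1 ht

/-- A solution is a fixed point of `Y ↦ P(1 - m Y(1/z))`, where `P` projects onto nonnegative
frequencies. Projection and reflection do not increase the norm, so the map contracts by `κ`. -/
lemma IsSolution.exists {m : AddCircle T → ℂ} {κ : ℝ} (hκ : κ < 1)
    (hm : AEStronglyMeasurable m (haarAddCircle (T := T)))
    (hmκ : ∀ᵐ t ∂haarAddCircle, ‖m t‖ ≤ κ) : ∃ X, IsSolution m 1 X := by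
  have hκ0 : 0 ≤ κ := by
    obtain ⟨t, ht⟩ := hmκ.exists
    exact (norm_nonneg _).trans ht
  have hmY : ∀ Y : AddCircle T → ℂ, SqInt Y → SqInt (fun t => m t * Y (-t)) := fun Y hY =>
    hY.refl.bdd_mul' hm hmκ
  have hG : ∀ Y : Lp ℂ 2 (haarAddCircle (T := T)), SqInt (fun t => 1 - m t * Y (-t)) := fun Y =>
    (SqInt.const 1).sub (hmY Y (Lp.memLp Y))
  choose P hP hPc using fun Y => (hG Y).exists_restrict (Set.Ici 0)
  obtain ⟨Φ, hΦP⟩ : ∃ Φ : Lp ℂ 2 (haarAddCircle (T := T)) → Lp ℂ 2 (haarAddCircle (T := T)),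
      ∀ Y, Φ Y =ᵐ[haarAddCircle] P Y :=
    ⟨fun Y => (hP Y).toLp (P Y), fun Y => (hP Y).coeFn_toLp⟩
  have hΦ : ContractingWith ⟨κ, hκ0⟩ Φ := by
    refine ⟨by exact_mod_cast hκ, LipschitzWith.of_dist_le_mul fun Y Z => ?_⟩
    have hPd : SqInt (fun t => P Y t - P Z t) := (hP Y).sub (hP Z)
    have hYZ : SqInt (fun t => Y t - Z t) := (Lp.memLp Y).sub (Lp.memLp Z)
    have hd : SqInt (fun t => m t * (Y (-t) - Z (-t))) := 
      hmY (fun t => Y t - Z t) hYZ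
    have e1 : dist (Φ Y) (Φ Z) = l2 (fun t => P Y t - P Z t) := by
      rw [dist_eq_norm, norm_lp_eq_l2]
      exact l2_congr ((Lp.coeFn_sub _ _).trans ((hΦP Y).sub (hΦP Z)))
    have e2 : dist Y Z = l2 (fun t => Y t - Z t) := by
      rw [dist_eq_norm, norm_lp_eq_l2]
      exact l2_congr (Lp.coeFn_sub Y Z)
    have h1 : l2 (fun t => P Y t - P Z t) ≤ l2 (fun t => m t * (Y (-t) - Z (-t))) := by
      refine hPd.l2_le_of_coeff hd fun n => ?_
      rw [fourierCoeff_sub' (hP Y) (hP Z), hPc, hPc]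
      split_ifs
      · rw [← fourierCoeff_sub' (hG Y) (hG Z), ← norm_neg, ← neg_one_mul,
          ← fourierCoeff_const_mul']
        refine le_of_eq (congrArg norm (congrFun (fourierCoeff_congr_ae (ae_of_all _ fun t => ?_)) n))
        ring
      · simp
    rw [e1, e2]
    refine h1.trans ?_
    rw [← l2_refl (fun t => Y t - Z t)]
    refine hYZ.refl.l2_le hκ0 ?_
    filter_upwards [hmκ] with t ht
    rw [norm_mul]
    exact mul_le_mul_of_nonneg_right ht (norm_nonneg _)
  set X := ContractingWith.fixedPoint Φ hΦ
  have hX : Φ X = X := hΦ.fixedPoint_isFixedPt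
  have hXP : (X : AddCircle T → ℂ) =ᵐ[haarAddCircle] P X := by
    conv_lhs => rw [← hX]
    exact hΦP X
  have hXs : SqInt (X : AddCircle T → ℂ) := Lp.memLp X
  have hXc : ∀ n, fourierCoeff X n =
      if n ∈ Set.Ici 0 then fourierCoeff (fun t => 1 - m t * X (-t)) n else 0 := fun n => by
    rw [fourierCoeff_congr_ae hXP, hPc]
  have hsum : SqInt (fun t => X t + m t * X (-t)) := hXs.add (hmY _ hXs)
  -- At nonnegative frequencies the fixed point equation says exactly that `X + m X(1/z)` agrees
  -- with the constant `1`.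
  have key : ∀ n ≥ 0, fourierCoeff (fun t => X t + m t * X (-t)) n = if n = 0 then 1 else 0 := by
    intro n hn
    rw [fourierCoeff_add' hXs (hmY _ hXs), hXc, if_pos (Set.mem_Ici.2 hn),
      fourierCoeff_sub' (SqInt.const 1) (hmY _ hXs), fourierCoeff_const]
    ring
  refine ⟨X, ⟨hXs, fun n hn => ?_⟩, ⟨hsum, fun n hn => ?_⟩, ?_⟩
  · rw [hXc, if_neg (by simpa using hn)]
  · rw [key n hn.le, if_neg hn.ne']
  · rw [key 0 le_rfl, if_pos rfl]

end QSP

end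

/-! ### Transfer chains and their relation to the matrices `U` -/

noncomputable section

namespace QSP

open ComplexConjugate Matrix

/-- One step of the transfer recursion satisfied by the (reversed, conjugated) half chains. -/
def step (ψ : ℝ) (z : ℂ) (v : ℂ × ℂ) : ℂ × ℂ :=
  (Complex.exp (-(ψ * Complex.I)) * ((1 + z) / 2 * v.1 + (1 - z) / 2 * v.2),
    Complex.exp (ψ * Complex.I) * ((1 - z) / 2 * v.1 + (1 + z) / 2 * v.2))

/-- The composition of the steps with phases `Ψ k, …, Ψ (k + n - 1)`. -/
def chain (Ψ : ℕ → ℝ) (z : ℂ) : ℕ → ℕ → ℂ × ℂ → ℂ × ℂ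
  | 0, _, v => v
  | n + 1, k, v => step (Ψ k) z (chain Ψ z n (k + 1) v)

lemma chain_succ_right (Ψ : ℕ → ℝ) (z : ℂ) (n k : ℕ) (v : ℂ × ℂ) :
    chain Ψ z (n + 1) k v = chain Ψ z n k (step (Ψ (k + n)) z v) := by
  induction n generalizing k with
  | zero => rfl
  | succ n ih =>
    rw [chain, ih (k + 1), chain]
    congr 4; ring

lemma step_sub (ψ : ℝ) (z : ℂ) (v w : ℂ × ℂ) : step ψ z (v - w) = step ψ z v - step ψ z w := by
  ext <;> simp [step] <;> ring

lemma chain_sub (Ψ : ℕ → ℝ) (z : ℂ) (n k : ℕ) (v w : ℂ × ℂ) :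
    chain Ψ z n k (v - w) = chain Ψ z n k v - chain Ψ z n k w := by
  induction n generalizing k with
  | zero => rfl
  | succ n ih => rw [chain, ih, step_sub]; rfl

lemma conj_exp_mul_I (ψ : ℝ) :
    conj (Complex.exp (ψ * Complex.I)) = Complex.exp (-(ψ * Complex.I)) := by
  rw [← Complex.exp_conj]; simp

lemma conj_exp_neg_mul_I (ψ : ℝ) :
    conj (Complex.exp (-(ψ * Complex.I))) = Complex.exp (ψ * Complex.I) := by
  rw [← Complex.exp_conj]; simp

lemma norm_exp_neg_mul_I (ψ : ℝ) : ‖Complex.exp (-(ψ * Complex.I))‖ = 1 := by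
  rw [← neg_mul, ← Complex.ofReal_neg]; exact Complex.norm_exp_ofReal_mul_I _

lemma exp_mul_exp_neg (w : ℂ) : Complex.exp w * Complex.exp (-w) = 1 := by
  rw [← Complex.exp_add]; simp

/-- The squared Euclidean norm on pairs of complex numbers. -/
def pairNormSq (v : ℂ × ℂ) : ℝ := ‖v.1‖ ^ 2 + ‖v.2‖ ^ 2

/-- For `|z| = 1` the matrix with entries `(1 ± z)/2` is unitary, and the phases have modulus one.
This isometry lets errors at the far end of a chain be carried to its start without growth. -/
lemma pairNormSq_step (ψ : ℝ) {z : ℂ} (hz : ‖z‖ = 1) (v : ℂ × ℂ) :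
    pairNormSq (step ψ z v) = pairNormSq v := by
  have hz2 : z.re * z.re + z.im * z.im = 1 := by
    rw [← Complex.normSq_apply, Complex.normSq_eq_norm_sq, hz]; norm_num
  simp only [pairNormSq, step, norm_mul, norm_exp_neg_mul_I, Complex.norm_exp_ofReal_mul_I, one_mul]
  simp only [← Complex.normSq_eq_norm_sq, Complex.normSq_apply, Complex.add_re, Complex.add_im,
    Complex.mul_re, Complex.mul_im, Complex.div_ofNat_re, Complex.div_ofNat_im, Complex.sub_re,
    Complex.sub_im, Complex.one_re, Complex.one_im]
  linear_combination (1 / 2 * (v.1.re ^ 2 + v.1.im ^ 2 + v.2.re ^ 2 + v.2.im ^ 2) -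
    (v.1.re * v.2.re + v.1.im * v.2.im)) * hz2

lemma pairNormSq_chain (Ψ : ℕ → ℝ) {z : ℂ} (hz : ‖z‖ = 1) (n k : ℕ) (v : ℂ × ℂ) :
    pairNormSq (chain Ψ z n k v) = pairNormSq v := by
  induction n generalizing k with
  | zero => rfl
  | succ n ih => rw [chain, pairNormSq_step _ hz, ih]

/-- Conjugating the coefficients of a step and exchanging its two components gives the step at `conj
z`. On the circle this relates the two components of a chain started at `(1, 1)` by reflection. -/
lemma chain_conj (Ψ : ℕ → ℝ) (z : ℂ) (n k : ℕ) (v : ℂ × ℂ) :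
    chain Ψ (conj z) n k (conj v.2, conj v.1) =
      (conj (chain Ψ z n k v).2, conj (chain Ψ z n k v).1) := by
  induction n generalizing k with
  | zero => rfl
  | succ n ih =>
    rw [chain, ih, chain]
    ext <;> simp [step, ← Complex.exp_conj, Complex.conj_ofNat] <;> ring

lemma chain_one_conj_fst (Ψ : ℕ → ℝ) (z : ℂ) (n k : ℕ) :
    (chain Ψ (conj z) n k (1, 1)).1 = conj (chain Ψ z n k (1, 1)).2 := by
  have := chain_conj Ψ z n k (1, 1)
  simp only [map_one] at this
  rw [this]

lemma chain_one_conj_snd (Ψ : ℕ → ℝ) (z : ℂ) (n k : ℕ) :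
    (chain Ψ (conj z) n k (1, 1)).2 = conj (chain Ψ z n k (1, 1)).1 := by
  have := chain_conj Ψ z n k (1, 1)
  simp only [map_one] at this
  rw [this]

lemma phase_eq (ψ : ℝ) : phase ψ =
    !![Complex.exp (ψ * Complex.I), 0; 0, Complex.exp (-(ψ * Complex.I))] := by
  have h : (Complex.I * (ψ : ℂ)) • Z = diagonal ![ψ * Complex.I, -(ψ * Complex.I)] := by
    ext i j
    fin_cases i <;> fin_cases j <;> simp [Z, mul_comm]
  rw [phase, h, Matrix.exp_diagonal]
  ext i j
  fin_cases i <;> fin_cases j <;> simp [Complex.exp_eq_exp_ℂ, Pi.coe_exp]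

/-- The product `e^{iψ₀Z} W e^{iψ₁Z} W ⋯ W e^{iψ_dZ}`. -/
def halfChain (Ψ : ℕ → ℝ) (x : ℝ) : ℕ → Matrix (Fin 2) (Fin 2) ℂ
  | 0 => phase (Ψ 0)
  | d + 1 => halfChain Ψ x d * W x * phase (Ψ (d + 1))

/-- The product defining `U` is a palindrome. Each half contains the central phase `ψ₀` once, and
the middle factor removes the duplicate. -/
lemma U_eq (Ψ : ℕ → ℝ) (x : ℝ) (d : ℕ) :
    U Ψ x d = (halfChain Ψ x d)ᵀ * phase (-Ψ 0) * halfChain Ψ x d := by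
  have hp : ∀ ψ, (phase ψ)ᵀ = phase ψ := fun ψ => by
    rw [phase_eq]; ext i j; fin_cases i <;> fin_cases j <;> rfl
  have hW : (W x)ᵀ = W x := by
    rw [W]; ext i j; fin_cases i <;> fin_cases j <;> rfl
  induction d with
  | zero =>
    rw [U, halfChain, hp]
    simp only [phase_eq]
    ext i j
    fin_cases i <;> fin_cases j <;> simp [Matrix.mul_apply, ← Complex.exp_add]
  | succ d ih =>
    rw [U, halfChain, ih, transpose_mul, transpose_mul, hp, hW]
    simp only [Matrix.mul_assoc]

lemma halfChain_entries (Ψ : ℕ → ℝ) (x : ℝ) (d : ℕ) :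
    halfChain Ψ x d 1 1 = conj (halfChain Ψ x d 0 0) ∧
      halfChain Ψ x d 1 0 = -conj (halfChain Ψ x d 0 1) := by
  induction d with
  | zero =>
    rw [halfChain, phase_eq]
    simp [← Complex.exp_conj]
  | succ d ih =>
    rw [halfChain, phase_eq, W]
    simp [Matrix.mul_apply, Fin.sum_univ_two, ih.1, ih.2, ← Complex.exp_conj]
    constructor <;> ring

/-- With first row `(α, β)`, the `SU(2)` shape of the half chain gives `u = e^{-iψ₀} α² + e^{iψ₀}
(conj β)²`, so `Im u = Im (e^{-iψ₀} (α + β)(α - β))`. Only the image of `(1, 1)` under the half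
chain matters. -/
lemma im_u_eq_halfChain (Ψ : ℕ → ℝ) (x : ℝ) (d : ℕ) :
    (u d Ψ x).im = (Complex.exp (-(Ψ 0 * Complex.I)) *
      ((halfChain Ψ x d 0 0 + halfChain Ψ x d 0 1) *
        conj (halfChain Ψ x d 1 0 + halfChain Ψ x d 1 1))).im := by
  obtain ⟨h1, h2⟩ := halfChain_entries Ψ x d
  rw [u, U_eq, phase_eq]
  simp only [Matrix.mul_apply, Fin.sum_univ_two, h1, h2, transpose_apply]
  set α := halfChain Ψ x d 0 0
  set β := halfChain Ψ x d 0 1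
  have e : Complex.exp (-(Ψ 0 * Complex.I)) * ((α + β) * conj (-conj β + conj α)) =
      Complex.exp (-(Ψ 0 * Complex.I)) * α ^ 2 - Complex.exp (-(Ψ 0 * Complex.I)) * β ^ 2 := by
    simp; ring
  rw [e, Complex.sub_im]
  have e2 : -(Complex.exp (-(Ψ 0 * Complex.I)) * β ^ 2).im =
      (Complex.exp (Ψ 0 * Complex.I) * conj β ^ 2).im := by
    rw [← Complex.conj_im, map_mul, conj_exp_neg_mul_I, map_pow]
  rw [sub_eq_add_neg, e2, ← Complex.add_im]
  congr 1
  simp; ring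

/-- With `z = e^{2iθ}`, the entries of `W` are `cos θ = e^{iθ} (1 + conj z)/2` and `i sin θ = e^{iθ}
(1 - conj z)/2`. Factoring out `e^{iθ}` leaves the conjugate of a transfer step; `hs` fixes the sign
of the sine. -/
lemma halfChain_mulVec (Ψ : ℕ → ℝ) (θ : ℝ) (hs : Real.sqrt (1 - Real.cos θ ^ 2) = Real.sin θ)
    (d : ℕ) (w : ℂ × ℂ) :
    (halfChain Ψ (Real.cos θ) d * W (Real.cos θ)) *ᵥ ![conj w.1, conj w.2] =
      Complex.exp (((d + 1 : ℕ) : ℂ) * (θ * Complex.I)) •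
        ![conj (chain Ψ (Complex.exp (2 * (θ * Complex.I))) (d + 1) 0 w).1,
          conj (chain Ψ (Complex.exp (2 * (θ * Complex.I))) (d + 1) 0 w).2] := by
  have hstep : ∀ (ψ : ℝ) (w : ℂ × ℂ), (phase ψ * W (Real.cos θ)) *ᵥ ![conj w.1, conj w.2] =
      Complex.exp (θ * Complex.I) • ![conj (step ψ (Complex.exp (2 * (θ * Complex.I))) w).1,
        conj (step ψ (Complex.exp (2 * (θ * Complex.I))) w).2] := by
    intro ψ w
    have hc : ((Real.cos θ : ℝ) : ℂ) =
        (Complex.exp (θ * Complex.I) + Complex.exp (-(θ * Complex.I))) / 2 := by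
      rw [Complex.ofReal_cos, Complex.cos, neg_mul]
    have hsn : Complex.I * ((Real.sin θ : ℝ) : ℂ) =
        (Complex.exp (θ * Complex.I) - Complex.exp (-(θ * Complex.I))) / 2 := by
      rw [Complex.ofReal_sin, Complex.sin, neg_mul]
      linear_combination (-(Complex.exp (-(θ * Complex.I)) - Complex.exp (θ * Complex.I)) / 2) *
        (-Complex.I_sq)
    have h1 := exp_mul_exp_neg (θ * Complex.I)
    have h2 : Complex.exp (2 * (θ * Complex.I)) = Complex.exp (θ * Complex.I) ^ 2 := by
      rw [← Complex.exp_nat_mul]; norm_num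
    rw [W, hs, hc, hsn, phase_eq, h2]
    ext i
    fin_cases i
    · simp [step, Matrix.mulVec, dotProduct, Fin.sum_univ_two, conj_exp_mul_I,
        conj_exp_neg_mul_I, Complex.conj_ofNat]
      linear_combination (-Complex.exp (ψ * Complex.I) / 2 * Complex.exp (-(θ * Complex.I)) *
        (conj w.1 - conj w.2)) * h1
    · simp [step, Matrix.mulVec, dotProduct, Fin.sum_univ_two, conj_exp_mul_I,
        conj_exp_neg_mul_I, Complex.conj_ofNat]
      linear_combination (Complex.exp (-(ψ * Complex.I)) / 2 * Complex.exp (-(θ * Complex.I)) *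
        (conj w.1 - conj w.2)) * h1
  induction d generalizing w with
  | zero =>
    rw [halfChain, hstep]
    simp [chain]
  | succ d ih =>
    rw [halfChain, Matrix.mul_assoc, ← Matrix.mulVec_mulVec, hstep, Matrix.mulVec_smul, ih,
      smul_smul, ← Complex.exp_add, chain_succ_right _ _ (d + 1), zero_add]
    congr 2
    push_cast; ring

lemma im_u_eq (Ψ : ℕ → ℝ) {θ : ℝ} (hs : Real.sqrt (1 - Real.cos θ ^ 2) = Real.sin θ) (d : ℕ) :
    (u d Ψ (Real.cos θ)).im = -(Complex.exp (Ψ 0 * Complex.I) *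
      ((chain Ψ (Complex.exp (2 * (θ * Complex.I))) (d + 1) 0 (1, 1)).1 *
        conj (chain Ψ (Complex.exp (2 * (θ * Complex.I))) (d + 1) 0 (1, 1)).2)).im := by
  have h := halfChain_mulVec Ψ θ hs d (1, 1)
  -- The vector `(1, 1)` is an eigenvector of `W` with eigenvalue `e^{iθ}`, so appending one more
  -- `W` costs a scalar phase, which drops out of `X conj Y`. This is why `u_d` corresponds to `d +
  -- 1` steps.
  have hW : W (Real.cos θ) *ᵥ ![conj (1 : ℂ), conj (1 : ℂ)] =
      Complex.exp (θ * Complex.I) • ![1, 1] := by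
    rw [W, hs, Complex.exp_mul_I, Complex.ofReal_cos, Complex.ofReal_sin]
    ext i
    fin_cases i <;> simp [Matrix.mulVec, dotProduct, Fin.sum_univ_two] <;> ring
  rw [← Matrix.mulVec_mulVec, hW, Matrix.mulVec_smul] at h
  have h0 := congrFun h 0
  have h1 := congrFun h 1
  have e : Complex.exp (((d + 1 : ℕ) : ℂ) * (θ * Complex.I)) =
      Complex.exp (θ * Complex.I) * Complex.exp (d * (θ * Complex.I)) := by
    rw [← Complex.exp_add]; congr 1; push_cast; ring
  rw [e] at h0 h1
  simp only [Pi.smul_apply, smul_eq_mul, mul_assoc, mul_eq_mul_left_iff, Complex.exp_ne_zero,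
    or_false, Matrix.mulVec, dotProduct, Fin.sum_univ_two, Matrix.cons_val_zero,
    Matrix.cons_val_one, mul_one] at h0 h1
  rw [im_u_eq_halfChain, h0, h1]
  set X := (chain Ψ (Complex.exp (2 * (θ * Complex.I))) (d + 1) 0 (1, 1)).1
  set Y := (chain Ψ (Complex.exp (2 * (θ * Complex.I))) (d + 1) 0 (1, 1)).2
  have hE : Complex.exp (d * (θ * Complex.I)) * conj (Complex.exp (d * (θ * Complex.I))) = 1 := by
    rw [← Complex.exp_conj, ← Complex.exp_add]; simp
  have e2 : Complex.exp (-(Ψ 0 * Complex.I)) * (Complex.exp (d * (θ * Complex.I)) * conj X *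
      conj (Complex.exp (d * (θ * Complex.I)) * conj Y)) =
      conj (Complex.exp (Ψ 0 * Complex.I) * (X * conj Y)) := by
    simp only [map_mul, conj_exp_mul_I, Complex.conj_conj]
    linear_combination (Complex.exp (-(Ψ 0 * Complex.I)) * conj X * Y) * hE
  rw [e2, Complex.conj_im]

end QSP

end

/-! ### Finite chains as functions on the circle: analyticity, means, diagonal entries -/

noncomputable section

namespace QSP

open MeasureTheory AddCircle Filter Topology ComplexConjugate
open scoped ENNReal

/-- First component of the finite transfer chain, as a function on the circle. -/
def chainX {T : ℝ} (Ψ : ℕ → ℝ) (n k : ℕ) (t : AddCircle T) : ℂ := (chain Ψ (fourier 1 t) n k (1, 1)).1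

/-- Second component of the finite transfer chain, as a function on the circle. -/
def chainY {T : ℝ} (Ψ : ℕ → ℝ) (n k : ℕ) (t : AddCircle T) : ℂ := (chain Ψ (fourier 1 t) n k (1, 1)).2

/-- The product of the cosines of the phases `Ψ k, …, Ψ (k + n - 1)`. -/
def cosProd (Ψ : ℕ → ℝ) (n k : ℕ) : ℝ := ∏ j ∈ Finset.range n, Real.cos (Ψ (k + j))

lemma cosProd_succ (Ψ : ℕ → ℝ) (n k : ℕ) :
    cosProd Ψ (n + 1) k = Real.cos (Ψ k) * cosProd Ψ n (k + 1) := by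
  rw [cosProd, Finset.prod_range_succ', mul_comm, cosProd]
  simp [add_assoc, add_comm 1]

section pointwise

variable {T : ℝ} (Ψ : ℕ → ℝ)

lemma fourier_refl (n : ℤ) (t : AddCircle T) : fourier n (-t) = conj (fourier n t) := by
  rw [← fourier_neg]
  simp [fourier_apply]

lemma chainX_succ (n k : ℕ) (t : AddCircle T) : chainX Ψ (n + 1) k t =
    Complex.exp (-(Ψ k * Complex.I)) * ((1 + fourier 1 t) / 2 * chainX Ψ n (k + 1) t +
      (1 - fourier 1 t) / 2 * chainY Ψ n (k + 1) t) := rfl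

lemma chainY_succ (n k : ℕ) (t : AddCircle T) : chainY Ψ (n + 1) k t =
    Complex.exp (Ψ k * Complex.I) * ((1 - fourier 1 t) / 2 * chainX Ψ n (k + 1) t +
      (1 + fourier 1 t) / 2 * chainY Ψ n (k + 1) t) := rfl

lemma chainX_refl (n k : ℕ) (t : AddCircle T) : chainX Ψ n k (-t) = conj (chainY Ψ n k t) := by
  rw [chainX, fourier_refl, chain_one_conj_fst]; rfl

lemma chainY_refl (n k : ℕ) (t : AddCircle T) : chainY Ψ n k (-t) = conj (chainX Ψ n k t) := by
  rw [chainY, fourier_refl, chain_one_conj_snd]; rfl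

lemma norm_sq_chain (n k : ℕ) (t : AddCircle T) :
    ‖chainX Ψ n k t‖ ^ 2 + ‖chainY Ψ n k t‖ ^ 2 = 2 := by
  have := pairNormSq_chain Ψ (norm_fourier_apply 1 t) n k (1, 1)
  simp only [pairNormSq, norm_one] at this
  rw [chainX, chainY, this]; norm_num

lemma norm_chainX_le (n k : ℕ) (t : AddCircle T) : ‖chainX Ψ n k t‖ ≤ Real.sqrt 2 :=
  Real.le_sqrt_of_sq_le (by nlinarith [norm_sq_chain Ψ n k t, sq_nonneg ‖chainY Ψ n k t‖])

lemma norm_chainY_le (n k : ℕ) (t : AddCircle T) : ‖chainY Ψ n k t‖ ≤ Real.sqrt 2 :=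
  Real.le_sqrt_of_sq_le (by nlinarith [norm_sq_chain Ψ n k t, sq_nonneg ‖chainX Ψ n k t‖])

lemma mul_conj_chain (n k : ℕ) (t : AddCircle T) : chainX Ψ n k t * conj (chainX Ψ n k t) +
    chainY Ψ n k t * conj (chainY Ψ n k t) = 2 := by
  rw [Complex.mul_conj, Complex.mul_conj, Complex.normSq_eq_norm_sq, Complex.normSq_eq_norm_sq,
    ← Complex.ofReal_add, norm_sq_chain]
  norm_num

lemma fourier_neg_mul (t : AddCircle T) : fourier (-1) t * fourier 1 t = 1 := by
  rw [← fourier_add]; simp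

/-- A step is unitary on the circle, so its inverse is its adjoint, with `z⁻¹` in place of `z`. -/
lemma chainX_eq_succ (n k : ℕ) (t : AddCircle T) : chainX Ψ n (k + 1) t =
    (1 + fourier (-1) t) / 2 * (Complex.exp (Ψ k * Complex.I) * chainX Ψ (n + 1) k t) +
      (1 - fourier (-1) t) / 2 * (Complex.exp (-(Ψ k * Complex.I)) * chainY Ψ (n + 1) k t) := by
  have h1 := exp_mul_exp_neg (Ψ k * Complex.I)
  have h2 := fourier_neg_mul t
  rw [chainX_succ, chainY_succ]
  set X := chainX Ψ n (k + 1) t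
  set Y := chainY Ψ n (k + 1) t
  set z := fourier 1 t
  set w := fourier (-1) t
  linear_combination (-((1 + w) * ((1 + z) * X + (1 - z) * Y) +
    (1 - w) * ((1 - z) * X + (1 + z) * Y)) / 4) * h1 - (X - Y) / 2 * h2

lemma chainY_eq_succ (n k : ℕ) (t : AddCircle T) : chainY Ψ n (k + 1) t =
    (1 - fourier (-1) t) / 2 * (Complex.exp (Ψ k * Complex.I) * chainX Ψ (n + 1) k t) +
      (1 + fourier (-1) t) / 2 * (Complex.exp (-(Ψ k * Complex.I)) * chainY Ψ (n + 1) k t) := by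
  have h1 := exp_mul_exp_neg (Ψ k * Complex.I)
  have h2 := fourier_neg_mul t
  rw [chainX_succ, chainY_succ]
  set X := chainX Ψ n (k + 1) t
  set Y := chainY Ψ n (k + 1) t
  set z := fourier 1 t
  set w := fourier (-1) t
  linear_combination (-((1 - w) * ((1 + z) * X + (1 - z) * Y) +
    (1 + w) * ((1 - z) * X + (1 + z) * Y)) / 4) * h1 + (X - Y) / 2 * h2

/-- The imaginary part of the upper left entry of `U`, as a function on the circle. -/
def chainIm (N : ℕ) (t : AddCircle T) : ℝ :=
  -(Complex.exp (Ψ 0 * Complex.I) * (chainX Ψ N 0 t * conj (chainY Ψ N 0 t))).im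

/-- The diagonal entry complementary to `chainIm`. -/
def chainDiag (N : ℕ) (t : AddCircle T) : ℂ :=
  (Complex.exp (-(Ψ 0 * Complex.I)) * (conj (chainX Ψ N 0 t) * conj (chainX Ψ N 0 t)) +
    Complex.exp (Ψ 0 * Complex.I) * (conj (chainY Ψ N 0 t) * conj (chainY Ψ N 0 t))) / 2

lemma I_mul_chainIm (N : ℕ) (t : AddCircle T) : Complex.I * chainIm Ψ N t =
    (Complex.exp (-(Ψ 0 * Complex.I)) * (conj (chainX Ψ N 0 t) * chainY Ψ N 0 t) -
      Complex.exp (Ψ 0 * Complex.I) * (chainX Ψ N 0 t * conj (chainY Ψ N 0 t))) / 2 := by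
  set w := Complex.exp (Ψ 0 * Complex.I) * (chainX Ψ N 0 t * conj (chainY Ψ N 0 t)) with hw
  have e : Complex.exp (-(Ψ 0 * Complex.I)) * (conj (chainX Ψ N 0 t) * chainY Ψ N 0 t) =
      conj w := by
    simp only [hw, map_mul, conj_exp_mul_I, Complex.conj_conj]
  have h2 := Complex.sub_conj w
  rw [e, chainIm]
  push_cast at h2 ⊢
  linear_combination (1 / 2) * h2

/-- Substituting the definitions makes the right side appear with the factor `(|X|² + |Y|²)/2 = 1`.
This is the finite form of the symmetric factorization: the scattering data carry the chain to a
rotated complex conjugate of itself. -/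
lemma chainDiag_eq_fst (N : ℕ) (t : AddCircle T) :
    chainDiag Ψ N t * chainX Ψ N 0 t + Complex.I * chainIm Ψ N t * conj (chainY Ψ N 0 t) =
      Complex.exp (-(Ψ 0 * Complex.I)) * conj (chainX Ψ N 0 t) := by
  have := mul_conj_chain Ψ N 0 t
  rw [I_mul_chainIm, chainDiag]
  linear_combination (Complex.exp (-(Ψ 0 * Complex.I)) * conj (chainX Ψ N 0 t) / 2) * this

lemma chainDiag_eq_snd (N : ℕ) (t : AddCircle T) :
    chainDiag Ψ N t * chainY Ψ N 0 t - Complex.I * chainIm Ψ N t * conj (chainX Ψ N 0 t) =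
      Complex.exp (Ψ 0 * Complex.I) * conj (chainY Ψ N 0 t) := by
  have := mul_conj_chain Ψ N 0 t
  rw [I_mul_chainIm, chainDiag]
  linear_combination (Complex.exp (Ψ 0 * Complex.I) * conj (chainY Ψ N 0 t) / 2) * this

/-- Adding the squared moduli of the two preceding identities gives `(|a|² + f²) · 2 = 2`, where `a`
is the diagonal entry and `f` the imaginary part. -/
lemma norm_sq_chainDiag (N : ℕ) (t : AddCircle T) :
    ‖chainDiag Ψ N t‖ ^ 2 + chainIm Ψ N t ^ 2 = 1 := by
  have h := mul_conj_chain Ψ N 0 t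
  have h1 := chainDiag_eq_fst Ψ N t
  have h2 := chainDiag_eq_snd Ψ N t
  have h1' := congrArg conj h1
  have h2' := congrArg conj h2
  have he := exp_mul_exp_neg (Ψ 0 * Complex.I)
  simp only [map_mul, map_add, map_sub, Complex.conj_conj, Complex.conj_I, Complex.conj_ofReal,
    conj_exp_mul_I, conj_exp_neg_mul_I] at h1' h2'
  have key : (chainDiag Ψ N t * conj (chainDiag Ψ N t) + (chainIm Ψ N t : ℂ) ^ 2) = 1 := by
    set a := chainDiag Ψ N t
    set X := chainX Ψ N 0 t
    set Y := chainY Ψ N 0 t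
    set f : ℂ := (chainIm Ψ N t : ℂ)
    have e1 : (a * X + Complex.I * f * conj Y) * (conj a * conj X + -Complex.I * f * Y) +
        (a * Y - Complex.I * f * conj X) * (conj a * conj Y - -Complex.I * f * X) =
        (a * conj a + f ^ 2) * (X * conj X + Y * conj Y) := by
      linear_combination (-f ^ 2 * (X * conj X + Y * conj Y)) * Complex.I_sq
    rw [h1, h2, h1', h2', h] at e1
    linear_combination (-1 / 2) * e1 + (1 / 2) * (X * conj X + Y * conj Y) * he + (1 / 2) * h
  rw [Complex.mul_conj, Complex.normSq_eq_norm_sq] at key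
  exact_mod_cast key

end pointwise

variable {T : ℝ} [hT : Fact (0 < T)]

lemma Analytic.fourier_mul {φ : AddCircle T → ℂ} (h : Analytic φ) :
    Analytic (fun t => fourier 1 t * φ t) ∧ fourierCoeff (fun t => fourier 1 t * φ t) 0 = 0 :=
  ⟨⟨h.sqInt.fourier_mul 1, fun n hn => by
    rw [fourierCoeff_fourier_mul, h.coeff _ (by omega)]⟩, by
    rw [fourierCoeff_fourier_mul, h.coeff _ (by omega)]⟩

lemma Coanalytic.fourier_mul {φ : AddCircle T → ℂ} (h : Coanalytic φ) :
    Coanalytic (fun t => fourier (-1) t * φ t) ∧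
      fourierCoeff (fun t => fourier (-1) t * φ t) 0 = 0 :=
  ⟨⟨h.sqInt.fourier_mul (-1), fun n hn => by
    rw [fourierCoeff_fourier_mul, h.coeff _ (by omega)]⟩, by
    rw [fourierCoeff_fourier_mul, h.coeff _ (by omega)]⟩

/-- Only the difference of the two inputs is multiplied by `z`, and that product has mean zero, so
the mean of the output sees only the sum of the inputs. -/
lemma Analytic.half_combination {φ χ : AddCircle T → ℂ} (h : Analytic φ) (h' : Analytic χ)
    (e : ℂ) {ω : AddCircle T → ℂ}
    (hω : ∀ t, ω t = e * ((1 + fourier 1 t) / 2 * φ t + (1 - fourier 1 t) / 2 * χ t)) :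
    Analytic ω ∧ fourierCoeff ω 0 = e * ((fourierCoeff φ 0 + fourierCoeff χ 0) / 2) := by
  have e1 : ω = fun t => e / 2 * ((φ t + χ t) + fourier 1 t * (φ t - χ t)) := by
    ext t; rw [hω]; ring
  have h1 := (h.sub h').fourier_mul
  rw [e1]
  refine ⟨((h.add h').add h1.1).const_mul _, ?_⟩
  rw [fourierCoeff_const_mul', fourierCoeff_add' (h.add h').sqInt h1.1.sqInt, h1.2,
    fourierCoeff_add' h.sqInt h'.sqInt]
  ring

lemma Coanalytic.half_combination {φ χ : AddCircle T → ℂ} (h : Coanalytic φ) (h' : Coanalytic χ)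
    (e e' : ℂ) {ω : AddCircle T → ℂ}
    (hω : ∀ t, ω t = (1 + fourier (-1) t) / 2 * (e * φ t) +
      (1 - fourier (-1) t) / 2 * (e' * χ t)) :
    Coanalytic ω ∧ fourierCoeff ω 0 = (e * fourierCoeff φ 0 + e' * fourierCoeff χ 0) / 2 := by
  have h1 := h.const_mul (e / 2)
  have h2 := h'.const_mul (e' / 2)
  have e1 : ω = fun t => (e / 2 * φ t + e' / 2 * χ t) +
      fourier (-1) t * (e / 2 * φ t - e' / 2 * χ t) := by
    ext t; rw [hω]; ring
  have h3 := (h1.sub h2).fourier_mul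
  rw [e1]
  refine ⟨(h1.add h2).add h3.1, ?_⟩
  rw [fourierCoeff_add' (h1.add h2).sqInt h3.1.sqInt, h3.2,
    fourierCoeff_add' h1.sqInt h2.sqInt, fourierCoeff_const_mul', fourierCoeff_const_mul']
  ring

lemma exp_add_exp_neg (x : ℝ) :
    Complex.exp (x * Complex.I) + Complex.exp (-(x * Complex.I)) = 2 * (Real.cos x : ℂ) := by
  rw [Complex.ofReal_cos, Complex.cos, neg_mul]; ring

/-- The induction tracks the sum of the two means because each step multiplies it by `(e^{iψ} +
e^{-iψ})/2 = cos ψ`; the individual means are then read off from the last step. -/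
lemma analytic_chain_aux (Ψ : ℕ → ℝ) (n k : ℕ) :
    (Analytic (chainX (T := T) Ψ n k) ∧ Analytic (chainY (T := T) Ψ n k)) ∧
      fourierCoeff (chainX (T := T) Ψ n k) 0 + fourierCoeff (chainY (T := T) Ψ n k) 0 =
        2 * (cosProd Ψ n k : ℂ) := by
  induction n generalizing k with
  | zero =>
    have hX : chainX (T := T) Ψ 0 k = fun _ => 1 := rfl
    have hY : chainY (T := T) Ψ 0 k = fun _ => 1 := rfl
    rw [hX, hY, fourierCoeff_const]
    exact ⟨⟨Analytic.const 1, Analytic.const 1⟩, by simp [cosProd]; norm_num⟩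
  | succ n ih =>
    obtain ⟨⟨h1, h2⟩, h3⟩ := ih (k + 1)
    obtain ⟨hX, hX0⟩ := h1.half_combination h2 _ (chainX_succ Ψ n k)
    obtain ⟨hY, hY0⟩ := h2.half_combination h1 _
      (fun t => (chainY_succ Ψ n k t).trans (by rw [add_comm]))
    refine ⟨⟨hX, hY⟩, ?_⟩
    rw [hX0, hY0, add_comm (fourierCoeff (chainY Ψ n (k + 1)) 0), h3, cosProd_succ]
    have := exp_add_exp_neg (Ψ k)
    push_cast at this ⊢
    linear_combination (cosProd Ψ n (k + 1) : ℂ) * this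

lemma analytic_chainX (Ψ : ℕ → ℝ) (n k : ℕ) : Analytic (chainX (T := T) Ψ n k) :=
  (analytic_chain_aux Ψ n k).1.1

lemma analytic_chainY (Ψ : ℕ → ℝ) (n k : ℕ) : Analytic (chainY (T := T) Ψ n k) :=
  (analytic_chain_aux Ψ n k).1.2

lemma mean_chainX (Ψ : ℕ → ℝ) (n k : ℕ) : fourierCoeff (chainX (T := T) Ψ (n + 1) k) 0 =
    Complex.exp (-(Ψ k * Complex.I)) * cosProd Ψ n (k + 1) := by
  obtain ⟨⟨h1, h2⟩, h3⟩ := analytic_chain_aux (T := T) Ψ n (k + 1)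
  rw [(h1.half_combination h2 _ (chainX_succ Ψ n k)).2, h3]
  ring

lemma mean_chainY (Ψ : ℕ → ℝ) (n k : ℕ) : fourierCoeff (chainY (T := T) Ψ (n + 1) k) 0 =
    Complex.exp (Ψ k * Complex.I) * cosProd Ψ n (k + 1) := by
  obtain ⟨⟨h1, h2⟩, h3⟩ := analytic_chain_aux (T := T) Ψ n (k + 1)
  rw [(h2.half_combination h1 _ (fun t => (chainY_succ Ψ n k t).trans (by rw [add_comm]))).2,
    add_comm (fourierCoeff (chainY Ψ n (k + 1)) 0), h3]
  ring

/-- With `s` the product of the cosines of `ψ₁, …, ψ_N`, the means of the conjugate components are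
`e^{± iψ₀} s`. Multiplicativity of means gives `(e^{iψ₀} + e^{-iψ₀}) s²/2 = cos ψ₀ · s²`: the phase
`ψ₀` counts once and the others twice, as in the sum over `ℤ`. -/
lemma coanalytic_chainDiag (Ψ : ℕ → ℝ) (N : ℕ) : Coanalytic (chainDiag (T := T) Ψ (N + 1)) ∧
    fourierCoeff (chainDiag (T := T) Ψ (N + 1)) 0 = cosProd Ψ (N + 1) 0 * cosProd Ψ N 1 := by
  have hX := (analytic_chainX (T := T) Ψ (N + 1) 0).conj
  have hY := (analytic_chainY (T := T) Ψ (N + 1) 0).conj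
  have hXX := hX.bdd_mul hX (ae_of_all _ fun t => by
    simpa using norm_chainX_le Ψ (N + 1) 0 t)
  have hYY := hY.bdd_mul hY (ae_of_all _ fun t => by
    simpa using norm_chainY_le Ψ (N + 1) 0 t)
  have h1 := hXX.const_mul (Complex.exp (-(Ψ 0 * Complex.I)) / 2)
  have h2 := hYY.const_mul (Complex.exp (Ψ 0 * Complex.I) / 2)
  have e : chainDiag (T := T) Ψ (N + 1) = fun t =>
      Complex.exp (-(Ψ 0 * Complex.I)) / 2 *
        (conj (chainX Ψ (N + 1) 0 t) * conj (chainX Ψ (N + 1) 0 t)) +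
      Complex.exp (Ψ 0 * Complex.I) / 2 *
        (conj (chainY Ψ (N + 1) 0 t) * conj (chainY Ψ (N + 1) 0 t)) := by
    ext t; rw [chainDiag]; ring
  rw [e]
  refine ⟨h1.add h2, ?_⟩
  rw [fourierCoeff_add' h1.sqInt h2.sqInt, fourierCoeff_const_mul', fourierCoeff_const_mul',
    hX.coeff_zero_mul hX, hY.coeff_zero_mul hY, fourierCoeff_conj, fourierCoeff_conj, neg_zero,
    mean_chainX, mean_chainY, cosProd_succ]
  simp only [map_mul, conj_exp_mul_I, conj_exp_neg_mul_I, Complex.conj_ofReal]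
  have h3 := exp_add_exp_neg (Ψ 0)
  have h4 := exp_mul_exp_neg (Ψ 0 * Complex.I)
  push_cast at h3 ⊢
  linear_combination ((Complex.exp (Ψ 0 * Complex.I) + Complex.exp (-(Ψ 0 * Complex.I))) *
    (cosProd Ψ N 1 : ℂ) ^ 2 / 2) * h4 + (cosProd Ψ N 1 : ℂ) ^ 2 / 2 * h3

/-- The finite analogue of the Riemann–Hilbert equation for the tail of the phase sequence. -/
lemma exists_coanalytic_chain (Ψ : ℕ → ℝ) (N n k : ℕ) (hN : n + k = N + 1) :
    ∃ (V V' : AddCircle T → ℂ) (c : ℝ), Coanalytic V ∧ Coanalytic V' ∧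
      fourierCoeff V 0 = c ∧ fourierCoeff V' 0 = c ∧
      c * cosProd Ψ n k = cosProd Ψ (N + 1) 0 * cosProd Ψ N 1 ∧
      (∀ t, chainDiag Ψ (N + 1) t * chainX Ψ n k t + fourier (-k) t *
        (Complex.I * chainIm Ψ (N + 1) t) * conj (chainY Ψ n k t) = V t) ∧
      ∀ t, chainDiag Ψ (N + 1) t * chainY Ψ n k t - fourier (-k) t *
        (Complex.I * chainIm Ψ (N + 1) t) * conj (chainX Ψ n k t) = V' t := by
  -- The case `k = 0` is the factorization of the whole chain. Removing one phase applies an inverse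
  -- step to `(V, V')`: this keeps both coanalytic, and since their means agree, multiplies the
  -- common mean by `cos ψ_k`.
  induction k generalizing n with
  | zero =>
    obtain rfl : n = N + 1 := by omega
    have hX := (analytic_chainX (T := T) Ψ (N + 1) 0).conj
    have hY := (analytic_chainY (T := T) Ψ (N + 1) 0).conj
    have h4 := exp_mul_exp_neg (Ψ 0 * Complex.I)
    refine ⟨_, _, cosProd Ψ N 1, hX.const_mul (Complex.exp (-(Ψ 0 * Complex.I))),
      hY.const_mul (Complex.exp (Ψ 0 * Complex.I)), ?_, ?_, mul_comm _ _, fun t => ?_, fun t => ?_⟩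
    · rw [fourierCoeff_const_mul', fourierCoeff_conj, neg_zero, mean_chainX, map_mul,
        conj_exp_neg_mul_I, Complex.conj_ofReal]
      linear_combination (cosProd Ψ N 1 : ℂ) * h4
    · rw [fourierCoeff_const_mul', fourierCoeff_conj, neg_zero, mean_chainY, map_mul,
        conj_exp_mul_I, Complex.conj_ofReal]
      linear_combination (cosProd Ψ N 1 : ℂ) * h4
    · simpa using chainDiag_eq_fst Ψ (N + 1) t
    · simpa using chainDiag_eq_snd Ψ (N + 1) t
  | succ k ih =>
    obtain ⟨V, V', c, hV, hV', hV0, hV0', hc, h1, h2⟩ := ih (n + 1) (by omega)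
    obtain ⟨g1, g2⟩ := hV.half_combination hV' (Complex.exp (Ψ k * Complex.I))
      (Complex.exp (-(Ψ k * Complex.I))) (fun t => rfl)
    obtain ⟨g1', g2'⟩ := hV'.half_combination hV (Complex.exp (-(Ψ k * Complex.I)))
      (Complex.exp (Ψ k * Complex.I)) (fun t => rfl)
    have h3 := exp_add_exp_neg (Ψ k)
    refine ⟨_, _, Real.cos (Ψ k) * c, g1, g1', ?_, ?_, ?_, fun t => ?_, fun t => ?_⟩
    · rw [g2, hV0, hV0']; push_cast at h3 ⊢; linear_combination (c : ℂ) / 2 * h3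
    · rw [g2', hV0, hV0']; push_cast at h3 ⊢; linear_combination (c : ℂ) / 2 * h3
    · rw [← hc, cosProd_succ]; ring
    · have hz := fourier_neg_mul t
      have hk : fourier (-((k + 1 : ℕ) : ℤ)) t = fourier (-1) t * fourier (-(k : ℤ)) t := by
        rw [← fourier_add, show (-((k + 1 : ℕ) : ℤ)) = -1 + -(k : ℤ) by push_cast; ring]
      rw [← h1, ← h2, chainX_eq_succ, chainY_eq_succ, hk]
      simp only [map_add, map_mul, map_sub, map_div₀, map_one, Complex.conj_ofNat,
        conj_exp_mul_I, conj_exp_neg_mul_I, ← fourier_neg, neg_neg]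
      linear_combination (fourier (-(k : ℤ)) t * (Complex.I * chainIm Ψ (N + 1) t) *
        (Complex.exp (Ψ k * Complex.I) * conj (chainY Ψ (n + 1) k t) -
          Complex.exp (-(Ψ k * Complex.I)) * conj (chainX Ψ (n + 1) k t)) / 2) * hz
    · have hz := fourier_neg_mul t
      have hk : fourier (-((k + 1 : ℕ) : ℤ)) t = fourier (-1) t * fourier (-(k : ℤ)) t := by
        rw [← fourier_add, show (-((k + 1 : ℕ) : ℤ)) = -1 + -(k : ℤ) by push_cast; ring]
      rw [← h1, ← h2, chainX_eq_succ, chainY_eq_succ, hk]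
      simp only [map_add, map_mul, map_sub, map_div₀, map_one, Complex.conj_ofNat,
        conj_exp_mul_I, conj_exp_neg_mul_I, ← fourier_neg, neg_neg]
      linear_combination (fourier (-(k : ℤ)) t * (Complex.I * chainIm Ψ (N + 1) t) *
        (Complex.exp (Ψ k * Complex.I) * conj (chainY Ψ (n + 1) k t) -
          Complex.exp (-(Ψ k * Complex.I)) * conj (chainX Ψ (n + 1) k t)) / 2) * hz

end QSP

end

/-! ### The outer function and the reflection coefficient -/

noncomputable section

namespace QSP

open MeasureTheory AddCircle Filter Topology ComplexConjugate
open scoped ENNReal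

variable {T : ℝ} [hT : Fact (0 < T)]

/-- Even measurable functions on the circle bounded by `b`. -/
structure IsSignal (b : ℝ) (F : AddCircle T → ℝ) : Prop where
  meas : AEStronglyMeasurable F (haarAddCircle (T := T))
  bound : ∀ t, |F t| ≤ b
  even : ∀ t, F (-t) = F t

/-- `exp g` is the outer function with modulus `√(1 - F²)`. -/
structure IsOuterExponent (F : AddCircle T → ℝ) (g : AddCircle T → ℂ) : Prop where
  coanalytic : Coanalytic g
  mean : fourierCoeff g 0 = ((∫ t, Real.log (1 - F t ^ 2) / 2 ∂haarAddCircle : ℝ) : ℂ)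
  re_eq : ∀ᵐ t ∂haarAddCircle, (g t).re = Real.log (1 - F t ^ 2) / 2
  refl : ∀ᵐ t ∂haarAddCircle, g (-t) = conj (g t)

lemma IsSignal.half_le {b : ℝ} {F : AddCircle T → ℝ} (hF : IsSignal b F) (hb : b ^ 2 ≤ 1 / 2)
    (t : AddCircle T) : 1 / 2 ≤ 1 - F t ^ 2 := by
  have h := hF.bound t
  have h0 : 0 ≤ |F t| := abs_nonneg _
  nlinarith [sq_abs (F t)]

lemma IsSignal.log_bound {b : ℝ} {F : AddCircle T → ℝ} (hF : IsSignal b F) (hb : b ^ 2 ≤ 1 / 2)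
    (t : AddCircle T) : |Real.log (1 - F t ^ 2) / 2| ≤ Real.log 2 / 2 := by
  have h1 := hF.half_le hb t
  have h2 : Real.log (1 - F t ^ 2) ≤ 0 :=
    Real.log_nonpos (by linarith) (by nlinarith [sq_nonneg (F t)])
  have h3 : -Real.log 2 ≤ Real.log (1 - F t ^ 2) := by
    rw [← Real.log_inv]
    exact Real.log_le_log (by norm_num) (by linarith)
  rw [abs_le]
  constructor <;> linarith

lemma IsSignal.exists_outer {b : ℝ} {F : AddCircle T → ℝ} (hF : IsSignal b F)
    (hb : b ^ 2 ≤ 1 / 2) : ∃ g, IsOuterExponent F g := by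
  have hm : AEMeasurable F (haarAddCircle (T := T)) := hF.meas.aemeasurable
  have hv : AEStronglyMeasurable (fun t => Real.log (1 - F t ^ 2) / 2) (haarAddCircle (T := T)) :=
    ((Real.measurable_log.comp_aemeasurable
      ((hm.pow_const 2).const_sub 1)).div_const 2).aestronglyMeasurable
  obtain ⟨g, h1, h2, h3, h4⟩ := exists_coanalytic_completion hv (ae_of_all _ (hF.log_bound hb))
    (fun t => by rw [hF.even])
  exact ⟨g, h1, h2, h3, h4⟩

section outer

variable {b : ℝ} {F : AddCircle T → ℝ} {g : AddCircle T → ℂ}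

lemma IsOuterExponent.mean_im (hg : IsOuterExponent F g) : (fourierCoeff g 0).im = 0 := by
  rw [hg.mean]; exact Complex.ofReal_im _

lemma IsOuterExponent.re_bound (hg : IsOuterExponent F g) (hF : IsSignal b F)
    (hb : b ^ 2 ≤ 1 / 2) : ∀ᵐ t ∂haarAddCircle, |(g t).re| ≤ Real.log 2 / 2 := by
  filter_upwards [hg.re_eq] with t ht
  rw [ht]; exact hF.log_bound hb t

lemma IsOuterExponent.exp (hg : IsOuterExponent F g) (hF : IsSignal b F) (hb : b ^ 2 ≤ 1 / 2) :
    Coanalytic (fun t => Complex.exp (g t)) ∧ fourierCoeff (fun t => Complex.exp (g t)) 0 =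
      (Real.exp (∫ t, Real.log (1 - F t ^ 2) / 2 ∂haarAddCircle) : ℂ) := by
  have := hg.coanalytic.exp hg.mean_im (hg.re_bound hF hb)
  rw [hg.mean] at this
  simpa using this

lemma IsOuterExponent.exp_neg (hg : IsOuterExponent F g) (hF : IsSignal b F)
    (hb : b ^ 2 ≤ 1 / 2) :
    Coanalytic (fun t => Complex.exp (-g t)) ∧ fourierCoeff (fun t => Complex.exp (-g t)) 0 =
      ((Real.exp (∫ t, Real.log (1 - F t ^ 2) / 2 ∂haarAddCircle))⁻¹ : ℂ) := by
  have h1 := hg.coanalytic.const_mul (-1)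
  simp only [neg_mul, one_mul] at h1
  have e : fourierCoeff (fun t => -g t) 0 = -fourierCoeff g 0 := by
    simpa using fourierCoeff_const_mul' (-1) g 0
  have := h1.exp (by rw [e, Complex.neg_im, hg.mean_im, neg_zero]) (C := Real.log 2 / 2) (by
    filter_upwards [hg.re_bound hF hb] with t ht
    simpa using ht)
  rw [e, hg.mean] at this
  rw [← Complex.ofReal_inv, ← Real.exp_neg]
  simpa using this

lemma IsOuterExponent.norm_exp_sq (hg : IsOuterExponent F g) (hF : IsSignal b F)
    (hb : b ^ 2 ≤ 1 / 2) :
    ∀ᵐ t ∂haarAddCircle, ‖Complex.exp (g t)‖ ^ 2 = 1 - F t ^ 2 := by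
  filter_upwards [hg.re_eq] with t ht
  rw [Complex.norm_exp, ht, ← Real.exp_nat_mul, Nat.cast_ofNat, mul_div_cancel₀ _ (by norm_num),
    Real.exp_log (by linarith [hF.half_le hb t])]

lemma IsOuterExponent.norm_exp_neg_sq (hg : IsOuterExponent F g) (hF : IsSignal b F)
    (hb : b ^ 2 ≤ 1 / 2) :
    ∀ᵐ t ∂haarAddCircle, ‖Complex.exp (-g t)‖ ^ 2 = (1 - F t ^ 2)⁻¹ := by
  filter_upwards [hg.norm_exp_sq hF hb] with t ht
  rw [Complex.exp_neg, norm_inv, inv_pow, ht]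

lemma IsOuterExponent.norm_exp_neg_le (hg : IsOuterExponent F g) (hF : IsSignal b F)
    (hb : b ^ 2 ≤ 1 / 2) : ∀ᵐ t ∂haarAddCircle, ‖Complex.exp (-g t)‖ ≤ Real.sqrt 2 := by
  filter_upwards [hg.norm_exp_neg_sq hF hb] with t ht
  refine Real.le_sqrt_of_sq_le ?_
  rw [ht]
  exact inv_le_of_inv_le₀ (by norm_num) (by linarith [hF.half_le hb t])

/-- The reflection coefficient `iF / exp g`. -/
def reflCoeff (F : AddCircle T → ℝ) (g : AddCircle T → ℂ) (t : AddCircle T) : ℂ :=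
  Complex.I * F t * Complex.exp (-g t)

lemma IsOuterExponent.reflCoeff_meas (hg : IsOuterExponent F g) (hF : IsSignal b F) :
    AEStronglyMeasurable (reflCoeff F g) (haarAddCircle (T := T)) := by
  have h1 : AEStronglyMeasurable (fun t => (F t : ℂ)) (haarAddCircle (T := T)) :=
    Complex.continuous_ofReal.comp_aestronglyMeasurable hF.meas
  have h2 : AEStronglyMeasurable (fun t => Complex.exp (-g t)) (haarAddCircle (T := T)) :=
    Complex.continuous_exp.comp_aestronglyMeasurable hg.coanalytic.sqInt.1.neg
  exact (h1.const_mul Complex.I).mul h2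

/-- The modulus squared is `F²/(1 - F²)`, which stays below `1` exactly when `F²` stays below `1/2`.
This is where the threshold `2^{-1/2}` enters. -/
lemma IsOuterExponent.exists_reflCoeff_bound (hg : IsOuterExponent F g) (hF : IsSignal b F)
    (hb : b ^ 2 < 1 / 2) :
    ∃ κ < 1, ∀ᵐ t ∂haarAddCircle, ‖reflCoeff F g t‖ ≤ κ := by
  refine ⟨Real.sqrt (b ^ 2 / (1 - b ^ 2)), ?_, ?_⟩
  · rw [Real.sqrt_lt' one_pos, div_lt_iff₀ (by linarith)]
    linarith
  · filter_upwards [hg.norm_exp_neg_sq hF hb.le] with t ht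
    refine Real.le_sqrt_of_sq_le ?_
    have h1 : F t ^ 2 ≤ b ^ 2 := sq_le_sq' (abs_le.1 (hF.bound t)).1 (abs_le.1 (hF.bound t)).2
    rw [reflCoeff, norm_mul, norm_mul, Complex.norm_I, one_mul, mul_pow, ht, Complex.norm_real,
      Real.norm_eq_abs, sq_abs, ← div_eq_mul_inv]
    exact div_le_div₀ (sq_nonneg _) h1 (by linarith) (by linarith)

lemma IsOuterExponent.reflCoeff_refl (hg : IsOuterExponent F g) (hF : IsSignal b F) :
    ∀ᵐ t ∂haarAddCircle, reflCoeff F g (-t) = -conj (reflCoeff F g t) := by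
  filter_upwards [hg.refl] with t ht
  rw [reflCoeff, reflCoeff, hF.even, ht]
  simp only [map_mul, Complex.conj_I, Complex.conj_ofReal, ← Complex.exp_conj, map_neg]
  ring

/-- The Lipschitz constant `√2` is the maximum of `|x|/(1 - x²)` on `|x| ≤ 2^{-1/2}`; the proof uses
`log t ≤ t - 1` instead of the derivative. -/
lemma abs_log_one_sub_sq_sub_le {x y b : ℝ} (hb : b ^ 2 ≤ 1 / 2) (hx : |x| ≤ b) (hy : |y| ≤ b) :
    |Real.log (1 - x ^ 2) / 2 - Real.log (1 - y ^ 2) / 2| ≤ Real.sqrt 2 * |x - y| := by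
  have hb0 : 0 ≤ b := (abs_nonneg x).trans hx
  have key : ∀ x y : ℝ, |x| ≤ b → |y| ≤ b →
      Real.log (1 - x ^ 2) / 2 - Real.log (1 - y ^ 2) / 2 ≤ Real.sqrt 2 * |x - y| := by
    intro x y hx hy
    have hx2 : 1 / 2 ≤ 1 - x ^ 2 := by nlinarith [sq_abs x, abs_nonneg x]
    have hy2 : 1 / 2 ≤ 1 - y ^ 2 := by nlinarith [sq_abs y, abs_nonneg y]
    have h1 : Real.log (1 - x ^ 2) - Real.log (1 - y ^ 2) ≤ (y ^ 2 - x ^ 2) / (1 - y ^ 2) := by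
      rw [← Real.log_div (by linarith) (by linarith)]
      refine (Real.log_le_sub_one_of_pos (div_pos (by linarith) (by linarith))).trans (le_of_eq ?_)
      have : 1 - y ^ 2 ≠ 0 := by linarith
      field_simp
      ring
    have h2 : (y ^ 2 - x ^ 2) / (1 - y ^ 2) ≤ 2 * |y ^ 2 - x ^ 2| := by
      rw [div_le_iff₀ (by linarith)]
      nlinarith [le_abs_self (y ^ 2 - x ^ 2), abs_nonneg (y ^ 2 - x ^ 2)]
    have h3 : |y ^ 2 - x ^ 2| = |x - y| * |x + y| := by
      rw [← abs_mul, ← abs_neg]; congr 1; ring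
    have h4 : |x + y| ≤ Real.sqrt 2 := by
      refine Real.le_sqrt_of_sq_le ?_
      have := (abs_add_le x y).trans (add_le_add hx hy)
      nlinarith [abs_nonneg (x + y)]
    have h5 : |x - y| * |x + y| ≤ |x - y| * Real.sqrt 2 :=
      mul_le_mul_of_nonneg_left h4 (abs_nonneg _)
    linarith
  rw [abs_le]
  refine ⟨?_, key x y hx hy⟩
  have := key y x hy hx
  rw [abs_sub_comm] at this
  linarith

/-- The reflection coefficient is a Lipschitz function of the signal. -/
lemma l2_reflCoeff_sub_le {F' : AddCircle T → ℝ} {g' : AddCircle T → ℂ}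
    (hg : IsOuterExponent F g) (hF : IsSignal b F) (hg' : IsOuterExponent F' g')
    (hF' : IsSignal b F') (hb : b ^ 2 ≤ 1 / 2) :
    l2 (fun t => reflCoeff F g t - reflCoeff F' g' t) ≤
      (2 + Real.sqrt 2) * l2 (fun t => (F t : ℂ) - F' t) := by
  have hs2 : Real.sqrt 2 ^ 2 = 2 := Real.sq_sqrt (by norm_num)
  have hs0 : 0 ≤ Real.sqrt 2 := Real.sqrt_nonneg 2
  have hFs : SqInt (fun t => (F t : ℂ)) := SqInt.of_bound (C := b)
    (Complex.continuous_ofReal.comp_aestronglyMeasurable hF.meas)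
    (ae_of_all _ fun t => by simpa using hF.bound t)
  have hFs' : SqInt (fun t => (F' t : ℂ)) := SqInt.of_bound (C := b)
    (Complex.continuous_ofReal.comp_aestronglyMeasurable hF'.meas)
    (ae_of_all _ fun t => by simpa using hF'.bound t)
  have hd : SqInt (fun t => (F t : ℂ) - F' t) := hFs.sub hFs'
  have hgd := hg.coanalytic.sub hg'.coanalytic
  have h1 : l2 (fun t => ((g t - g' t).re : ℂ)) ≤ Real.sqrt 2 * l2 (fun t => (F t : ℂ) - F' t) := by
    refine hd.l2_le hs0 ?_
    filter_upwards [hg.re_eq, hg'.re_eq] with t ht ht'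
    rw [Complex.norm_real, Complex.sub_re, ht, ht', ← Complex.ofReal_sub, Complex.norm_real]
    exact abs_log_one_sub_sq_sub_le hb (hF.bound t) (hF'.bound t)
  -- The constant is `√2 · √2`: one factor from the logarithm, the other from recovering a
  -- coanalytic function from its real part.
  have h2 : l2 (fun t => g t - g' t) ≤ 2 * l2 (fun t => (F t : ℂ) - F' t) := by
    have := hgd.l2_sq_le (by
      rw [fourierCoeff_sub' hg.coanalytic.sqInt hg'.coanalytic.sqInt, Complex.sub_im, hg.mean_im,
        hg'.mean_im, sub_zero])
    refine abs_le_of_sq_le_sq' ?_ (mul_nonneg zero_le_two (l2_nonneg _)) |>.2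
    have h3 := pow_le_pow_left₀ (l2_nonneg _) h1 2
    rw [mul_pow, hs2] at h3
    nlinarith
  have he := (hg.exp_neg hF hb).1.sqInt
  have he' := (hg'.exp_neg hF' hb).1.sqInt
  have hed : SqInt (fun t => Complex.exp (-g t) - Complex.exp (-g' t)) := he.sub he'
  have h3 : l2 (fun t => Complex.exp (-g t) - Complex.exp (-g' t)) ≤
      Real.sqrt 2 * l2 (fun t => g t - g' t) := by
    refine hgd.sqInt.l2_le hs0 ?_
    filter_upwards [hg.re_bound hF hb, hg'.re_bound hF' hb] with t ht ht'
    have := norm_exp_sub_exp_le (z := -g t) (w := -g' t) (C := Real.log 2 / 2)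
      (by rw [Complex.neg_re]; linarith [abs_le.1 ht]) (by rw [Complex.neg_re]; linarith [abs_le.1 ht'])
    rw [Real.sqrt_eq_rpow, Real.rpow_def_of_pos two_pos]
    convert this using 2
    · ring_nf
    · rw [← norm_neg]; congr 1; ring
  have hp1 : SqInt (fun t => Complex.exp (-g t) * ((F t : ℂ) - F' t)) :=
    hd.bdd_mul' he.1 (hg.norm_exp_neg_le hF hb)
  have hp2 : SqInt (fun t => (F' t : ℂ) * (Complex.exp (-g t) - Complex.exp (-g' t))) :=
    hed.bdd_mul' hFs'.1 (C := b) (ae_of_all _ fun t => by simpa using hF'.bound t)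
  have hp : SqInt (fun t => Complex.exp (-g t) * ((F t : ℂ) - F' t) +
      (F' t : ℂ) * (Complex.exp (-g t) - Complex.exp (-g' t))) := hp1.add hp2
  have e1 : l2 (fun t => reflCoeff F g t - reflCoeff F' g' t) ≤
      1 * l2 (fun t => Complex.exp (-g t) * ((F t : ℂ) - F' t) +
        (F' t : ℂ) * (Complex.exp (-g t) - Complex.exp (-g' t))) := by
    refine hp.l2_le zero_le_one (ae_of_all _ fun t => ?_)
    -- In this product rule splitting, the first term contributes `√2` and the second contributes `b
    -- · √2 · 2 ≤ 2`.
    have : reflCoeff F g t - reflCoeff F' g' t = Complex.I * (Complex.exp (-g t) *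
        ((F t : ℂ) - F' t) + (F' t : ℂ) * (Complex.exp (-g t) - Complex.exp (-g' t))) := by
      rw [reflCoeff, reflCoeff]; ring
    rw [this, norm_mul, Complex.norm_I]
  have e2 : l2 (fun t => Complex.exp (-g t) * ((F t : ℂ) - F' t)) ≤
      Real.sqrt 2 * l2 (fun t => (F t : ℂ) - F' t) := by
    refine hd.l2_le hs0 ?_
    filter_upwards [hg.norm_exp_neg_le hF hb] with t ht
    rw [norm_mul]
    exact mul_le_mul_of_nonneg_right ht (norm_nonneg _)
  have hb0 : 0 ≤ b := (abs_nonneg _).trans (hF.bound 0)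
  have e3 : l2 (fun t => (F' t : ℂ) * (Complex.exp (-g t) - Complex.exp (-g' t))) ≤
      b * l2 (fun t => Complex.exp (-g t) - Complex.exp (-g' t)) := by
    refine hed.l2_le hb0 (ae_of_all _ fun t => ?_)
    rw [norm_mul]
    exact mul_le_mul_of_nonneg_right (by simpa using hF'.bound t) (norm_nonneg _)
  have hb2 : b * Real.sqrt 2 ≤ 1 := by nlinarith
  have e4 : b * l2 (fun t => Complex.exp (-g t) - Complex.exp (-g' t)) ≤
      2 * l2 (fun t => (F t : ℂ) - F' t) := by
    calc _ ≤ b * (Real.sqrt 2 * l2 (fun t => g t - g' t)) := mul_le_mul_of_nonneg_left h3 hb0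
      _ = b * Real.sqrt 2 * l2 (fun t => g t - g' t) := by ring
      _ ≤ 1 * l2 (fun t => g t - g' t) := mul_le_mul_of_nonneg_right hb2 (l2_nonneg _)
      _ ≤ _ := by linarith
  linarith [hp1.l2_add_le hp2]

end outer

end QSP

end

/-! ### Stability of the phases -/

noncomputable section

namespace QSP

open MeasureTheory AddCircle Filter Topology ComplexConjugate
open scoped ENNReal

variable {T : ℝ} [hT : Fact (0 < T)]

/-- The circle version of the statement that `Ψ` represents `F`. -/
structure CircleRepresents (F : AddCircle T → ℝ) (Ψ : ℕ → ℝ) : Prop where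
  phase : ∀ k, Ψ k ∈ Set.Ioo (-(Real.pi / 2)) (Real.pi / 2)
  prod : Tendsto (fun N => cosProd Ψ (N + 1) 0 * cosProd Ψ N 1) atTop
    (𝓝 (Real.exp (∫ t, Real.log (1 - F t ^ 2) / 2 ∂haarAddCircle)))
  conv : Tendsto (fun N => l2 (fun t => (chainIm Ψ (N + 1) t : ℂ) - F t)) atTop (𝓝 0)

lemma SqInt.l2_sub_one_sq {q : AddCircle T → ℂ} (h : SqInt q) :
    l2 (fun t => q t - 1) ^ 2 = l2 q ^ 2 - 2 * (fourierCoeff q 0).re + 1 := by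
  have hre : (fourierCoeff q 0).re = ∫ t, (q t).re ∂haarAddCircle := by
    rw [fourierCoeff_zero_eq]
    exact (Complex.reCLM.integral_comp_comm h.integrable').symm
  have i1 : Integrable (fun t => ‖q t‖ ^ 2 - 2 * (q t).re) (haarAddCircle (T := T)) :=
    h.integrable_sq.sub (h.integrable'.re.const_mul 2)
  have e : ∫ t, (‖q t‖ ^ 2 - 2 * (q t).re + 1) ∂haarAddCircle =
      ∫ t, ‖q t‖ ^ 2 ∂haarAddCircle - 2 * ∫ t, (q t).re ∂haarAddCircle + 1 := by
    rw [integral_add i1 (integrable_const _), integral_const, ← integral_const_mul]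
    congr 1
    · exact integral_sub h.integrable_sq (h.integrable'.re.const_mul 2)
    · simp
  rw [l2_sq, l2_sq, hre, ← e]
  refine integral_congr_ae (ae_of_all _ fun t => ?_)
  simp only [← Complex.normSq_eq_norm_sq, Complex.normSq_apply, Complex.sub_re, Complex.sub_im,
    Complex.one_re, Complex.one_im]
  ring

section limit

variable {b : ℝ} {F : AddCircle T → ℝ} {g : AddCircle T → ℂ} {Ψ : ℕ → ℝ}

lemma abs_chainIm_le {T : ℝ} (Ψ : ℕ → ℝ) (N : ℕ) (t : AddCircle T) : |chainIm Ψ N t| ≤ 1 := by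
  have := norm_sq_chainDiag Ψ N t
  exact abs_le_one_iff_mul_self_le_one.2 (by nlinarith [sq_nonneg ‖chainDiag Ψ N t‖])

lemma continuous_chain {T : ℝ} (Ψ : ℕ → ℝ) (n k : ℕ) :
    Continuous (chainX (T := T) Ψ n k) ∧ Continuous (chainY (T := T) Ψ n k) := by
  induction n generalizing k with
  | zero => exact ⟨continuous_const, continuous_const⟩
  | succ n ih =>
    obtain ⟨h1, h2⟩ := ih (k + 1)
    have hX : chainX (T := T) Ψ (n + 1) k = _ := funext (chainX_succ Ψ n k)
    have hY : chainY (T := T) Ψ (n + 1) k = _ := funext (chainY_succ Ψ n k)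
    rw [hX, hY]
    constructor <;> fun_prop

lemma continuous_chainIm {T : ℝ} (Ψ : ℕ → ℝ) (N : ℕ) : Continuous (chainIm (T := T) Ψ N) := by
  obtain ⟨h1, h2⟩ := continuous_chain (T := T) Ψ N 0
  unfold chainIm
  exact (Complex.continuous_im.comp (continuous_const.mul
    (h1.mul (Complex.continuous_conj.comp h2)))).neg

lemma IsSignal.sqInt (hF : IsSignal b F) : SqInt (fun t => (F t : ℂ)) :=
  SqInt.of_bound (C := b) (Complex.continuous_ofReal.comp_aestronglyMeasurable hF.meas)
    (ae_of_all _ fun t => by simpa using hF.bound t)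

lemma sqInt_chainIm (Ψ : ℕ → ℝ) (N : ℕ) : SqInt (fun t : AddCircle T => (chainIm Ψ N t : ℂ)) :=
  SqInt.of_bound (C := 1) (Complex.continuous_ofReal.comp
    (continuous_chainIm Ψ N)).aestronglyMeasurable
    (ae_of_all _ fun t => by simpa using abs_chainIm_le Ψ N t)

/-- The diagonal entries converge to the outer function. -/
lemma tendsto_chainDiag (hg : IsOuterExponent F g) (hF : IsSignal b F) (hb : b ^ 2 ≤ 1 / 2)
    (h : CircleRepresents F Ψ) :
    Tendsto (fun N => l2 (fun t => Complex.exp (-g t) * chainDiag Ψ (N + 1) t - 1)) atTop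
      (𝓝 0) := by
  set A := Real.exp (∫ t, Real.log (1 - F t ^ 2) / 2 ∂haarAddCircle) with hA
  have hA0 : 0 < A := Real.exp_pos _
  obtain ⟨he, he0⟩ := hg.exp_neg hF hb
  rw [← hA] at he0
  have hq : ∀ N, Coanalytic (fun t => Complex.exp (-g t) * chainDiag Ψ (N + 1) t) := fun N =>
    he.bdd_mul (coanalytic_chainDiag Ψ N).1 (hg.norm_exp_neg_le hF hb)
  have hmean : ∀ N, fourierCoeff (fun t => Complex.exp (-g t) * chainDiag Ψ (N + 1) t) 0 =
      ((A⁻¹ * (cosProd Ψ (N + 1) 0 * cosProd Ψ N 1) : ℝ) : ℂ) := fun N => by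
    rw [he.coeff_zero_mul (coanalytic_chainDiag Ψ N).1, he0, (coanalytic_chainDiag Ψ N).2]
    push_cast; ring
  -- The integrand is `(1 - F_N²)/(1 - F²)`, where `F_N` is the chain's imaginary part; the factor
  -- `4` comes from `1 - F² ≥ 1/2` and `|F_N + F| ≤ 2`.
  have hsq : ∀ N, l2 (fun t => Complex.exp (-g t) * chainDiag Ψ (N + 1) t) ^ 2 ≤
      1 + 4 * l2 (fun t => (chainIm Ψ (N + 1) t : ℂ) - F t) := by
    intro N
    have hd : SqInt (fun t => (chainIm Ψ (N + 1) t : ℂ) - F t) :=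
      (sqInt_chainIm Ψ (N + 1)).sub hF.sqInt
    have i1 : Integrable (fun t => 1 + 4 * ‖(chainIm Ψ (N + 1) t : ℂ) - F t‖)
        (haarAddCircle (T := T)) := (integrable_const _).add (hd.integrable'.norm.const_mul 4)
    have h1 : l2 (fun t => Complex.exp (-g t) * chainDiag Ψ (N + 1) t) ^ 2 ≤
        ∫ t, (1 + 4 * ‖(chainIm Ψ (N + 1) t : ℂ) - F t‖) ∂haarAddCircle := by
      rw [l2_sq]
      refine integral_mono_ae (hq N).sqInt.integrable_sq i1 ?_
      filter_upwards [hg.norm_exp_neg_sq hF hb] with t ht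
      have h2 := norm_sq_chainDiag Ψ (N + 1) t
      have h3 := hF.half_le hb t
      have h4 := abs_chainIm_le Ψ (N + 1) t
      have h5 : |F t| ≤ 1 := abs_le_one_iff_mul_self_le_one.2 (by nlinarith)
      rw [norm_mul, mul_pow, ht, ← Complex.ofReal_sub, Complex.norm_real, Real.norm_eq_abs,
        inv_mul_le_iff₀ (by linarith)]
      have h6 : ‖chainDiag Ψ (N + 1) t‖ ^ 2 - (1 - F t ^ 2) ≤ 2 * |chainIm Ψ (N + 1) t - F t| := by
        have e : ‖chainDiag Ψ (N + 1) t‖ ^ 2 - (1 - F t ^ 2) =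
            (chainIm Ψ (N + 1) t - F t) * (-(chainIm Ψ (N + 1) t + F t)) := by linarith
        rw [e, mul_comm]
        refine (le_abs_self _).trans ?_
        rw [abs_mul, abs_neg]
        refine mul_le_mul_of_nonneg_right ?_ (abs_nonneg _)
        exact (abs_add_le _ _).trans (by linarith)
      nlinarith [abs_nonneg (chainIm Ψ (N + 1) t - F t)]
    refine h1.trans ?_
    rw [integral_add (integrable_const _) (hd.integrable'.norm.const_mul 4), integral_const_mul]
    have h7 : ∫ t, ‖(chainIm Ψ (N + 1) t : ℂ) - F t‖ ∂haarAddCircle ≤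
        l2 (fun t => (chainIm Ψ (N + 1) t : ℂ) - F t) := by
      have hn : SqInt (fun t => ((‖(chainIm Ψ (N + 1) t : ℂ) - F t‖ : ℝ) : ℂ)) := hd.norm.ofReal
      have h8 := hn.norm_integral_le
      have e : ∫ t, ((‖(chainIm Ψ (N + 1) t : ℂ) - F t‖ : ℝ) : ℂ) ∂haarAddCircle =
          ((∫ t, ‖(chainIm Ψ (N + 1) t : ℂ) - F t‖ ∂haarAddCircle : ℝ) : ℂ) := integral_ofReal
      rw [e, Complex.norm_real] at h8
      refine (le_abs_self _).trans (h8.trans (le_of_eq ?_))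
      simp [l2]
    simp only [integral_const, probReal_univ, one_smul]
    linarith
  -- The Plancherel identity says that the mean of the quotient tends to `1`. Together with a
  -- squared norm at most `1 + o(1)`, this forces convergence to `1` in `L²`.
  have hlim : Tendsto (fun N => 1 + 4 * l2 (fun t => (chainIm Ψ (N + 1) t : ℂ) - F t) -
      2 * (A⁻¹ * (cosProd Ψ (N + 1) 0 * cosProd Ψ N 1)) + 1) atTop (𝓝 0) := by
    have := (((h.conv.const_mul 4).const_add 1).sub ((h.prod.const_mul A⁻¹).const_mul 2)).add_const 1
    convert this using 2
    rw [← hA, inv_mul_cancel₀ hA0.ne']; norm_num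
  have hlim2 : Tendsto (fun N => l2 (fun t => Complex.exp (-g t) * chainDiag Ψ (N + 1) t - 1) ^ 2)
      atTop (𝓝 0) := by
    refine squeeze_zero (fun _ => sq_nonneg _) (fun N => ?_) hlim
    rw [(hq N).sqInt.l2_sub_one_sq, hmean, Complex.ofReal_re]
    linarith [hsq N]
  have := hlim2.sqrt
  simpa [Real.sqrt_sq (l2_nonneg _)] using this

/-- The finite chains approximately solve the limiting Riemann–Hilbert equation. -/
lemma exists_chain_approx (hg : IsOuterExponent F g) (hF : IsSignal b F) (hb : b ^ 2 ≤ 1 / 2)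
    (h : CircleRepresents F Ψ) (k : ℕ) : ∃ (E : ℕ → AddCircle T → ℂ) (V : ℕ → AddCircle T → ℂ),
      (∀ n, SqInt (E n)) ∧ Tendsto (fun n => l2 (E n)) atTop (𝓝 0) ∧ (∀ n, Coanalytic (V n)) ∧
      (∀ n, ∃ c : ℝ, fourierCoeff (V n) 0 = c ∧ c * (Real.cos (Ψ k) * cosProd Ψ n (k + 1)) =
        (Real.exp (∫ t, Real.log (1 - F t ^ 2) / 2 ∂haarAddCircle))⁻¹ *
          (cosProd Ψ (n + k + 1) 0 * cosProd Ψ (n + k) 1)) ∧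
      ∀ n t, chainX Ψ (n + 1) k t + fourier (-k) t * reflCoeff F g t * chainX Ψ (n + 1) k (-t) =
        V n t + E n t := by
  set A := Real.exp (∫ t, Real.log (1 - F t ^ 2) / 2 ∂haarAddCircle) with hA
  obtain ⟨he, he0⟩ := hg.exp_neg hF hb
  rw [← hA] at he0
  choose V V' c hV _ hV0 _ hc hVeq _ using fun n =>
    exists_coanalytic_chain (T := T) Ψ (n + k) (n + 1) k (by ring)
  have hs0 : 0 ≤ Real.sqrt 2 := Real.sqrt_nonneg 2
  have hEV : ∀ n, Coanalytic (fun t => Complex.exp (-g t) * V n t) := fun n =>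
    he.bdd_mul (hV n) (hg.norm_exp_neg_le hF hb)
  have hE1 : ∀ n, SqInt (fun t => Complex.exp (-g t) * chainDiag Ψ (n + k + 1) t - 1) := fun n =>
    (he.bdd_mul (coanalytic_chainDiag Ψ (n + k)).1 (hg.norm_exp_neg_le hF hb)).sqInt.sub
      (SqInt.const 1)
  have hE2 : ∀ n, SqInt (fun t => (chainIm Ψ (n + k + 1) t : ℂ) - F t) := fun n =>
    (sqInt_chainIm Ψ (n + k + 1)).sub hF.sqInt
  have hE1' : ∀ n, SqInt (fun t => -chainX Ψ (n + 1) k t *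
      (Complex.exp (-g t) * chainDiag Ψ (n + k + 1) t - 1)) := fun n =>
    (hE1 n).bdd_mul' (C := Real.sqrt 2) (continuous_chain Ψ (n + 1) k).1.neg.aestronglyMeasurable
      (ae_of_all _ fun t => by simpa using norm_chainX_le Ψ (n + 1) k t)
  have hm : ∀ n, AEStronglyMeasurable (fun t => -(Complex.exp (-g t) * (fourier (-k) t *
      Complex.I * conj (chainY Ψ (n + 1) k t)))) (haarAddCircle (T := T)) := fun n => by
    refine (he.sqInt.1.mul (Continuous.aestronglyMeasurable ?_)).neg
    exact ((fourier (-(k : ℤ))).continuous.mul continuous_const).mul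
      (Complex.continuous_conj.comp (continuous_chain Ψ (n + 1) k).2)
  have hmb : ∀ n, ∀ᵐ t ∂haarAddCircle (T := T), ‖-(Complex.exp (-g t) * (fourier (-k) t *
      Complex.I * conj (chainY Ψ (n + 1) k t)))‖ ≤ 2 := fun n => by
    filter_upwards [hg.norm_exp_neg_le hF hb] with t ht
    rw [norm_neg, norm_mul, norm_mul, norm_mul, norm_fourier_apply, Complex.norm_I, one_mul,
      one_mul, RCLike.norm_conj]
    refine (mul_le_mul ht (norm_chainY_le Ψ (n + 1) k t) (norm_nonneg _) hs0).trans (le_of_eq ?_)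
    exact Real.mul_self_sqrt (by norm_num)
  have hE2' := fun n => (hE2 n).bdd_mul' (hm n) (hmb n)
  -- After division of the finite equation by `exp g`, the error collects the replacement of the
  -- diagonal entry by `exp g` and of the finite signal by `F`.
  refine ⟨fun n t => -chainX Ψ (n + 1) k t *
      (Complex.exp (-g t) * chainDiag Ψ (n + k + 1) t - 1) +
      -(Complex.exp (-g t) * (fourier (-k) t * Complex.I * conj (chainY Ψ (n + 1) k t))) *
      ((chainIm Ψ (n + k + 1) t : ℂ) - F t), fun n t => Complex.exp (-g t) * V n t,
    fun n => (hE1' n).add (hE2' n), ?_, hEV, fun n => ⟨A⁻¹ * c n, ?_, ?_⟩, fun n t => ?_⟩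
  · have l1 := ((tendsto_chainDiag hg hF hb h).comp (tendsto_add_atTop_nat k)).const_mul (Real.sqrt 2)
    have l2' := (h.conv.comp (tendsto_add_atTop_nat k)).const_mul 2
    have l3 := l1.add l2'
    simp only [mul_zero, add_zero] at l3
    refine squeeze_zero (fun _ => l2_nonneg _) (fun n => ?_) l3
    refine ((hE1' n).l2_add_le (hE2' n)).trans (add_le_add ?_ ?_)
    · refine (hE1 n).l2_le hs0 (ae_of_all _ fun t => ?_)
      rw [norm_mul, norm_neg]
      exact mul_le_mul_of_nonneg_right (norm_chainX_le Ψ (n + 1) k t) (norm_nonneg _)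
    · refine (hE2 n).l2_le zero_le_two ?_
      filter_upwards [hmb n] with t ht
      rw [norm_mul]
      exact mul_le_mul_of_nonneg_right ht (norm_nonneg _)
  · rw [he.coeff_zero_mul (hV n), he0, hV0]; push_cast; ring
  · rw [← hc, ← cosProd_succ]; ring
  · simp only
    rw [← hVeq, chainX_refl, reflCoeff]
    ring

end limit

/-- With `p = s' c` and `q = s c'`, the law of cosines gives `(p - q)² + 4 p q sin²((ψ - φ)/2)` on
the right. -/
lemma four_sin_sq_le (s c s' c' ψ φ : ℝ) :
    4 * ((s' * c) * (s * c')) * Real.sin ((ψ - φ) / 2) ^ 2 ≤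
      ‖Complex.exp (-(φ * Complex.I)) * s' * c - Complex.exp (-(ψ * Complex.I)) * s * c'‖ ^ 2 := by
  have h1 : ‖Complex.exp (-(φ * Complex.I)) * s' * c - Complex.exp (-(ψ * Complex.I)) * s * c'‖ ^ 2 =
      (s' * c) ^ 2 + (s * c') ^ 2 - 2 * ((s' * c) * (s * c')) * Real.cos (ψ - φ) := by
    rw [← Complex.normSq_eq_norm_sq, Complex.normSq_apply, Real.cos_sub]
    simp only [← neg_mul, ← Complex.ofReal_neg, mul_assoc, ← Complex.ofReal_mul, Complex.sub_re,
      Complex.sub_im, Complex.re_mul_ofReal, Complex.im_mul_ofReal, Complex.exp_ofReal_mul_I_re,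
      Complex.exp_ofReal_mul_I_im, Real.cos_neg, Real.sin_neg]
    linear_combination (s' * c) ^ 2 * Real.sin_sq_add_cos_sq φ +
      (s * c') ^ 2 * Real.sin_sq_add_cos_sq ψ
  have h2 : Real.cos (ψ - φ) = 1 - 2 * Real.sin ((ψ - φ) / 2) ^ 2 := by
    have := Real.cos_two_mul ((ψ - φ) / 2)
    rw [mul_div_cancel₀ _ (by norm_num)] at this
    rw [this, Real.cos_sq']; ring
  rw [h1, h2]
  nlinarith [sq_nonneg (s' * c - s * c')]

lemma cosProd_pos {Ψ : ℕ → ℝ} (h : ∀ k, Ψ k ∈ Set.Ioo (-(Real.pi / 2)) (Real.pi / 2)) (n k : ℕ) :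
    0 < cosProd Ψ n k := Finset.prod_pos fun _ _ => Real.cos_pos_of_mem_Ioo (h _)

/-- Each phase is a Lipschitz function of the represented signal. -/
theorem CircleRepresents.abs_sub_le {b : ℝ} {F F' : AddCircle T → ℝ} {Ψ Φ : ℕ → ℝ}
    (hF : IsSignal b F) (hF' : IsSignal b F') (hb : b ^ 2 ≤ 1 / 2)
    (h : CircleRepresents F Ψ) (h' : CircleRepresents F' Φ) (k : ℕ) :
    |Ψ k - Φ k| ≤ Real.pi * (2 + Real.sqrt 2) * l2 (fun t => (F t : ℂ) - F' t) := by
  obtain ⟨g, hg⟩ := hF.exists_outer hb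
  obtain ⟨g', hg'⟩ := hF'.exists_outer hb
  obtain ⟨E, V, hE, hElim, hV, hVc, hVE⟩ := exists_chain_approx hg hF hb h k
  obtain ⟨E', V', hE', hElim', hV', hVc', hVE'⟩ := exists_chain_approx hg' hF' hb h' k
  set A := Real.exp (∫ t, Real.log (1 - F t ^ 2) / 2 ∂haarAddCircle) with hA
  set A' := Real.exp (∫ t, Real.log (1 - F' t ^ 2) / 2 ∂haarAddCircle) with hA'
  set w : ℕ → ℝ := fun n => A⁻¹ * (cosProd Ψ (n + k + 1) 0 * cosProd Ψ (n + k) 1) with hw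
  set w' : ℕ → ℝ := fun n => A'⁻¹ * (cosProd Φ (n + k + 1) 0 * cosProd Φ (n + k) 1) with hw'
  have hw1 : Tendsto w atTop (𝓝 1) := by
    have := (h.prod.comp (tendsto_add_atTop_nat k)).const_mul A⁻¹
    rwa [inv_mul_cancel₀ (Real.exp_pos _).ne'] at this
  have hw1' : Tendsto w' atTop (𝓝 1) := by
    have := (h'.prod.comp (tendsto_add_atTop_nat k)).const_mul A'⁻¹
    rwa [inv_mul_cancel₀ (Real.exp_pos _).ne'] at this
  have hs0 : 0 ≤ Real.sqrt 2 := Real.sqrt_nonneg 2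
  have hss : Real.sqrt 2 * Real.sqrt 2 = 2 := Real.mul_self_sqrt (by norm_num)
  set r := reflCoeff F g
  set r' := reflCoeff F' g'
  set D := l2 (fun t => r t - r' t) with hD
  have hr : SqInt r := by
    obtain ⟨κ, hκ⟩ : ∃ κ, ∀ᵐ t ∂haarAddCircle, ‖r t‖ ≤ κ := by
      refine ⟨b * Real.sqrt 2, ?_⟩
      filter_upwards [hg.norm_exp_neg_le hF hb] with t ht
      simp only [r, reflCoeff, norm_mul, Complex.norm_I, one_mul, Complex.norm_real]
      exact mul_le_mul (hF.bound t) ht (norm_nonneg _) ((abs_nonneg _).trans (hF.bound t))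
    exact SqInt.of_bound (hg.reflCoeff_meas hF) hκ
  have hr' : SqInt r' := by
    obtain ⟨κ, hκ⟩ : ∃ κ, ∀ᵐ t ∂haarAddCircle, ‖r' t‖ ≤ κ := by
      refine ⟨b * Real.sqrt 2, ?_⟩
      filter_upwards [hg'.norm_exp_neg_le hF' hb] with t ht
      simp only [r', reflCoeff, norm_mul, Complex.norm_I, one_mul, Complex.norm_real]
      exact mul_le_mul (hF'.bound t) ht (norm_nonneg _) ((abs_nonneg _).trans (hF'.bound t))
    exact SqInt.of_bound (hg'.reflCoeff_meas hF') hκ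
  have hrd : SqInt (fun t => r t - r' t) := hr.sub hr'
  have key : ∀ n, 4 * (w n * w' n) * Real.sin ((Ψ k - Φ k) / 2) ^ 2 ≤
      (2 * D + Real.sqrt 2 * (l2 (E n) + l2 (E' n))) ^ 2 := by
    intro n
    obtain ⟨c, hc0, hc⟩ := hVc n
    obtain ⟨c', hc0', hc'⟩ := hVc' n
    have hX := (analytic_chainX (T := T) Ψ (n + 1) k)
    have hZ := (analytic_chainX (T := T) Φ (n + 1) k)
    -- Let `X` and `Z` be the chains for `Ψ` and `Φ`. Multiply the equation of `X` by `Z(1/z)`, that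
    -- of `Z` by `X(1/z)`, and subtract. The antisymmetric remainder integrates to zero by
    -- reflection, and the coanalytic products contribute only products of means, which contain the
    -- phases.
    have hJ : ∫ t, (fourier (-k) t * (r t - r' t)) *
        (chainX Ψ (n + 1) k (-t) * chainX Φ (n + 1) k (-t)) ∂haarAddCircle =
        (fourierCoeff (chainX (T := T) Φ (n + 1) k) 0 * c +
          ∫ t, chainX Φ (n + 1) k (-t) * E n t ∂haarAddCircle) -
        (fourierCoeff (chainX (T := T) Ψ (n + 1) k) 0 * c' +
          ∫ t, chainX Ψ (n + 1) k (-t) * E' n t ∂haarAddCircle) := by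
      have e1 := hZ.refl.coeff_zero_mul (hV n)
      have e2 := hX.refl.coeff_zero_mul (hV' n)
      rw [fourierCoeff_refl, neg_zero, hc0, fourierCoeff_zero_eq] at e1
      rw [fourierCoeff_refl, neg_zero, hc0', fourierCoeff_zero_eq] at e2
      have i1 := hZ.refl.sqInt.mul_integrable (hV n).sqInt
      have i2 := hZ.refl.sqInt.mul_integrable (hE n)
      have i3 := hX.refl.sqInt.mul_integrable (hV' n).sqInt
      have i4 := hX.refl.sqInt.mul_integrable (hE' n)
      have i5 := hZ.refl.sqInt.mul_integrable hX.sqInt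
      have i6 := hZ.sqInt.mul_integrable hX.refl.sqInt
      have e3 := integral_refl (fun t : AddCircle T => chainX Φ (n + 1) k (-t) * chainX Ψ (n + 1) k t)
      simp only [neg_neg] at e3
      rw [← e1, ← e2, ← integral_add i1 i2, ← integral_add i3 i4]
      have e4 : ∀ t : AddCircle T, (fourier (-k) t * (r t - r' t)) *
          (chainX Ψ (n + 1) k (-t) * chainX Φ (n + 1) k (-t)) =
          ((chainX Φ (n + 1) k (-t) * V n t + chainX Φ (n + 1) k (-t) * E n t) -
          (chainX Ψ (n + 1) k (-t) * V' n t + chainX Ψ (n + 1) k (-t) * E' n t)) +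
          (chainX Φ (n + 1) k t * chainX Ψ (n + 1) k (-t) -
            chainX Φ (n + 1) k (-t) * chainX Ψ (n + 1) k t) := by
        intro t
        linear_combination chainX Φ (n + 1) k (-t) * hVE n t - chainX Ψ (n + 1) k (-t) * hVE' n t
      simp only [e4]
      have i7 : Integrable (fun t : AddCircle T =>
          (chainX Φ (n + 1) k (-t) * V n t + chainX Φ (n + 1) k (-t) * E n t) -
          (chainX Ψ (n + 1) k (-t) * V' n t + chainX Ψ (n + 1) k (-t) * E' n t))
          haarAddCircle := (i1.add i2).sub (i3.add i4)
      have i8 : Integrable (fun t : AddCircle T => chainX Φ (n + 1) k t * chainX Ψ (n + 1) k (-t) -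
            chainX Φ (n + 1) k (-t) * chainX Ψ (n + 1) k t) haarAddCircle := i6.sub i5
      have i9 : Integrable (fun t : AddCircle T =>
          chainX Φ (n + 1) k (-t) * V n t + chainX Φ (n + 1) k (-t) * E n t)
          haarAddCircle := i1.add i2
      have i10 : Integrable (fun t : AddCircle T =>
          chainX Ψ (n + 1) k (-t) * V' n t + chainX Ψ (n + 1) k (-t) * E' n t)
          haarAddCircle := i3.add i4
      rw [integral_add i7 i8, integral_sub i9 i10, integral_sub i6 i5, e3, sub_self, add_zero]
    have b1 : ‖∫ t, (fourier (-k) t * (r t - r' t)) *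
        (chainX Ψ (n + 1) k (-t) * chainX Φ (n + 1) k (-t)) ∂haarAddCircle‖ ≤ 2 * D := by
      have hb1 : ∀ t : AddCircle T, ‖fourier (-k) t *
          (chainX Ψ (n + 1) k (-t) * chainX Φ (n + 1) k (-t))‖ ≤ 2 := fun t => by
        rw [norm_mul, norm_mul, norm_fourier_apply, one_mul, ← hss]
        exact mul_le_mul (norm_chainX_le _ _ _ _) (norm_chainX_le _ _ _ _) (norm_nonneg _) hs0
      have hm1 : AEStronglyMeasurable (fun t : AddCircle T => fourier (-k) t *
          (chainX Ψ (n + 1) k (-t) * chainX Φ (n + 1) k (-t))) haarAddCircle :=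
        ((fourier (-(k : ℤ))).continuous.mul
          (((continuous_chain Ψ (n + 1) k).1.comp continuous_neg).mul
            ((continuous_chain Φ (n + 1) k).1.comp continuous_neg))).aestronglyMeasurable
      have := (hrd.bdd_mul' hm1 (ae_of_all _ hb1)).norm_integral_le
      have e5 : ∀ t : AddCircle T, (fourier (-k) t * (r t - r' t)) *
        (chainX Ψ (n + 1) k (-t) * chainX Φ (n + 1) k (-t)) = (fourier (-k) t *
          (chainX Ψ (n + 1) k (-t) * chainX Φ (n + 1) k (-t))) * (r t - r' t) := fun t => by ring
      simp only [e5]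
      refine this.trans (hrd.l2_le zero_le_two (ae_of_all _ fun t => ?_))
      rw [norm_mul]
      exact mul_le_mul_of_nonneg_right (hb1 t) (norm_nonneg _)
    have b2 : ∀ (Θ : ℕ → ℝ) (e : AddCircle T → ℂ), SqInt e →
        ‖∫ t, chainX Θ (n + 1) k (-t) * e t ∂haarAddCircle‖ ≤ Real.sqrt 2 * l2 e := by
      intro Θ e he
      have := (he.bdd_mul' (m := fun t => chainX Θ (n + 1) k (-t)) (C := Real.sqrt 2)
        ((continuous_chain Θ (n + 1) k).1.comp continuous_neg).aestronglyMeasurable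
        (ae_of_all _ fun t => norm_chainX_le _ _ _ _)).norm_integral_le
      refine this.trans (he.l2_le hs0 (ae_of_all _ fun t => ?_))
      rw [norm_mul]
      exact mul_le_mul_of_nonneg_right (norm_chainX_le _ _ _ _) (norm_nonneg _)
    rw [mean_chainX, mean_chainX] at hJ
    set s := cosProd Ψ n (k + 1)
    set s' := cosProd Φ n (k + 1)
    have hspos : 0 < s := cosProd_pos h.phase _ _
    have hspos' : 0 < s' := cosProd_pos h'.phase _ _
    have b3 : ‖Complex.exp (-(Φ k * Complex.I)) * s' * c -
        Complex.exp (-(Ψ k * Complex.I)) * s * c'‖ ≤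
        2 * D + Real.sqrt 2 * (l2 (E n) + l2 (E' n)) := by
      have e6 : Complex.exp (-(Φ k * Complex.I)) * s' * c -
          Complex.exp (-(Ψ k * Complex.I)) * s * c' =
          ∫ t, (fourier (-k) t * (r t - r' t)) *
            (chainX Ψ (n + 1) k (-t) * chainX Φ (n + 1) k (-t)) ∂haarAddCircle -
          ∫ t, chainX Φ (n + 1) k (-t) * E n t ∂haarAddCircle +
          ∫ t, chainX Ψ (n + 1) k (-t) * E' n t ∂haarAddCircle := by
        rw [hJ]; ring
      rw [e6]
      refine (norm_add_le _ _).trans ?_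
      have := norm_sub_le (∫ t, (fourier (-k) t * (r t - r' t)) *
            (chainX Ψ (n + 1) k (-t) * chainX Φ (n + 1) k (-t)) ∂haarAddCircle)
          (∫ t, chainX Φ (n + 1) k (-t) * E n t ∂haarAddCircle)
      linarith [b2 Φ _ (hE n), b2 Ψ _ (hE' n)]
    refine le_trans ?_ ((four_sin_sq_le s c s' c' (Ψ k) (Φ k)).trans
      (pow_le_pow_left₀ (norm_nonneg _) b3 2))
    refine mul_le_mul_of_nonneg_right ?_ (sq_nonneg _)
    have hcψ := Real.cos_pos_of_mem_Ioo (h.phase k)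
    have hcφ := Real.cos_pos_of_mem_Ioo (h'.phase k)
    have hwn : w n = c * (Real.cos (Ψ k) * s) := hc.symm
    have hwn' : w' n = c' * (Real.cos (Φ k) * s') := hc'.symm
    have hwpos : 0 < w n := mul_pos (inv_pos.2 (Real.exp_pos _))
      (mul_pos (cosProd_pos h.phase _ _) (cosProd_pos h.phase _ _))
    have hwpos' : 0 < w' n := mul_pos (inv_pos.2 (Real.exp_pos _))
      (mul_pos (cosProd_pos h'.phase _ _) (cosProd_pos h'.phase _ _))
    have hcpos : 0 < c := (pos_iff_pos_of_mul_pos (hwn ▸ hwpos)).2 (mul_pos hcψ hspos)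
    have hcpos' : 0 < c' := (pos_iff_pos_of_mul_pos (hwn' ▸ hwpos')).2 (mul_pos hcφ hspos')
    -- The amplitudes in the sine bound exceed `w n * w' n`, which tends to `1`, by the factor
    -- `1/(cos ψ_k cos φ_k) ≥ 1`.
    have e7 : w n * w' n = (Real.cos (Ψ k) * Real.cos (Φ k)) * ((s' * c) * (s * c')) := by
      rw [hwn, hwn']; ring
    have e8 : Real.cos (Ψ k) * Real.cos (Φ k) ≤ 1 :=
      mul_le_one₀ (Real.cos_le_one _) hcφ.le (Real.cos_le_one _)
    have e9 : 0 < (s' * c) * (s * c') := by positivity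
    rw [e7]
    nlinarith
  have hlim : 4 * (1 * 1) * Real.sin ((Ψ k - Φ k) / 2) ^ 2 ≤
      (2 * D + Real.sqrt 2 * (0 + 0)) ^ 2 :=
    le_of_tendsto_of_tendsto' (((hw1.mul hw1').const_mul 4).mul_const _)
      ((((hElim.add hElim').const_mul _).const_add _).pow 2) key
  have hD0 : 0 ≤ D := l2_nonneg _
  have hsin : |Real.sin ((Ψ k - Φ k) / 2)| ≤ D := by
    refine abs_le_of_sq_le_sq ?_ hD0
    nlinarith
  -- Both phases lie in an interval of length `π`, so half their difference is in the range of
  -- Jordan's inequality.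
  have hle : |(Ψ k - Φ k) / 2| ≤ Real.pi / 2 := by
    have h1 := h.phase k
    have h2 := h'.phase k
    rw [abs_le]
    constructor <;> linarith [h1.1, h1.2, h2.1, h2.2]
  have hj := Real.mul_abs_le_abs_sin hle
  rw [abs_div, abs_two] at hj
  have hDF := l2_reflCoeff_sub_le hg hF hg' hF' hb
  have hpi := Real.pi_pos
  have : |Ψ k - Φ k| ≤ Real.pi * D := by
    have h3 : 2 / Real.pi * (|Ψ k - Φ k| / 2) = |Ψ k - Φ k| / Real.pi := by
      field_simp
    rw [h3, div_le_iff₀ hpi] at hj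
    nlinarith
  refine this.trans ?_
  rw [mul_assoc]
  exact mul_le_mul_of_nonneg_left hDF hpi.le

end QSP

end

/-! ### Symmetry, stripping and asymptotics of the solutions -/

noncomputable section

namespace QSP

open MeasureTheory AddCircle Filter Topology ComplexConjugate
open scoped ENNReal

variable {T : ℝ} [hT : Fact (0 < T)]

section solution

variable {m X : AddCircle T → ℂ} {c : ℂ}

/-- The symmetry of `m` makes `conj X(1/z)` a solution for `-m`. It plays the role of the second
chain component. -/
lemma IsSolution.conj_refl (hm : ∀ᵐ t ∂haarAddCircle, m (-t) = -conj (m t))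
    (h : IsSolution m c X) : Analytic (fun t => conj (X (-t))) ∧
      Coanalytic (fun t => conj (X (-t)) - m t * conj (X t)) ∧
      fourierCoeff (fun t => conj (X (-t)) - m t * conj (X t)) 0 = conj c := by
  have e : (fun t => conj (X (-t) + m (-t) * X (- -t))) =ᵐ[haarAddCircle]
      fun t => conj (X (-t)) - m t * conj (X t) := by
    filter_upwards [hm] with t ht
    rw [ht, neg_neg, map_add, map_mul, map_neg, Complex.conj_conj]
    ring
  refine ⟨h.analytic.refl.conj, h.coanalytic.refl.conj.congr e, ?_⟩
  rw [← fourierCoeff_congr_ae e, fourierCoeff_conj,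
    fourierCoeff_refl (fun t => X t + m t * X (-t)), neg_zero, neg_zero, h.mean]

/-- Pairing the equation with `conj X` gives `‖X‖²` plus an integral `J` on one side and the
conjugate mean of `X` on the other. Reflection and the symmetry of `m` give `J = -conj J`, so `J` is
purely imaginary. -/
lemma IsSolution.re_mean (hm : ∀ᵐ t ∂haarAddCircle, m (-t) = -conj (m t))
    (hms : AEStronglyMeasurable m (haarAddCircle (T := T))) {κ : ℝ}
    (hmκ : ∀ᵐ t ∂haarAddCircle, ‖m t‖ ≤ κ) (h : IsSolution m 1 X) :
    (fourierCoeff X 0).re = l2 X ^ 2 := by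
  have hX := h.analytic.sqInt
  have hmX : SqInt (fun t => m t * X (-t)) := hX.refl.bdd_mul' hms hmκ
  have h1 := h.analytic.conj.coeff_zero_mul h.coanalytic
  rw [h.mean, mul_one, fourierCoeff_conj, neg_zero, fourierCoeff_zero_eq] at h1
  set J := ∫ t, conj (X t) * (m t * X (-t)) ∂haarAddCircle with hJ
  have hJre : J.re = 0 := by
    have e : J = -conj J := by
      conv_lhs => rw [hJ, ← integral_refl]
      rw [hJ, ← integral_conj, ← integral_neg]
      refine integral_congr_ae ?_
      filter_upwards [hm] with t ht
      rw [ht, neg_neg]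
      simp only [map_mul, Complex.conj_conj]
      ring
    have := congrArg Complex.re e
    rw [Complex.neg_re, Complex.conj_re] at this
    linarith
  have e2 : ((l2 X ^ 2 : ℝ) : ℂ) = ∫ t, conj (X t) * X t ∂haarAddCircle := by
    rw [l2_sq]
    refine integral_ofReal.symm.trans (integral_congr_ae (ae_of_all _ fun t => ?_))
    simp [Complex.conj_mul']
  have e3 : conj (fourierCoeff X 0) = ((l2 X ^ 2 : ℝ) : ℂ) + J := by
    rw [← h1, e2, hJ, ← integral_add (hX.conj.mul_integrable hX) (hX.conj.mul_integrable hmX)]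
    refine integral_congr_ae (ae_of_all _ fun t => ?_)
    simp only; ring
  have := congrArg Complex.re e3
  rwa [Complex.conj_re, Complex.add_re, Complex.ofReal_re, hJre, add_zero] at this

lemma IsSolution.l2_pos (h : IsSolution m 1 X) : 0 < l2 X := by
  refine (l2_nonneg X).lt_of_ne fun h0 => ?_
  have hz := h.analytic.sqInt.ae_zero_of_l2 h0.symm
  have e : (fun t => X t + m t * X (-t)) =ᵐ[haarAddCircle] fun _ => 0 := by
    filter_upwards [hz, ae_refl hz] with t h1 h2
    rw [h1, h2]; ring
  have := h.mean
  rw [fourierCoeff_congr_ae e, fourierCoeff_const] at this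
  simp at this

/-- Removing the first phase turns a solution for `m` into one for `m / z`. -/
lemma IsSolution.strip (hm : ∀ᵐ t ∂haarAddCircle, m (-t) = -conj (m t))
    (h : IsSolution m 1 X) {ψ : ℝ}
    (hψ : (Complex.exp (ψ * Complex.I) * fourierCoeff X 0).im = 0) :
    IsSolution (fun t => fourier (-1) t * m t) (Real.cos ψ)
      (fun t => (1 + fourier (-1) t) / 2 * (Complex.exp (ψ * Complex.I) * X t) +
        (1 - fourier (-1) t) / 2 * (Complex.exp (-(ψ * Complex.I)) * conj (X (-t)))) ∧
    (fourierCoeff (fun t => (1 + fourier (-1) t) / 2 * (Complex.exp (ψ * Complex.I) * X t) +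
        (1 - fourier (-1) t) / 2 * (Complex.exp (-(ψ * Complex.I)) * conj (X (-t)))) 0).re =
      (Complex.exp (ψ * Complex.I) * fourierCoeff X 0).re := by
  obtain ⟨hA, hC, hC0⟩ := h.conj_refl hm
  have hc : ∀ n, fourierCoeff (fun t => conj (X (-t))) n = conj (fourierCoeff X n) := fun n => by
    rw [fourierCoeff_conj, fourierCoeff_refl, neg_neg]
  have h1 := h.analytic.const_mul (Complex.exp (ψ * Complex.I))
  have h2 := hA.const_mul (Complex.exp (-(ψ * Complex.I)))
  have hs := (h1.add h2).const_mul (1 / 2)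
  have hd := (h1.sub h2).const_mul (1 / 2)
  have e : (fun t => (1 + fourier (-1) t) / 2 * (Complex.exp (ψ * Complex.I) * X t) +
        (1 - fourier (-1) t) / 2 * (Complex.exp (-(ψ * Complex.I)) * conj (X (-t)))) =
      fun t => 1 / 2 * (Complex.exp (ψ * Complex.I) * X t +
        Complex.exp (-(ψ * Complex.I)) * conj (X (-t))) + fourier (-1) t *
        (1 / 2 * (Complex.exp (ψ * Complex.I) * X t -
        Complex.exp (-(ψ * Complex.I)) * conj (X (-t)))) := by
    ext t; ring
  have hcoeff : ∀ n, fourierCoeff (fun t => (1 + fourier (-1) t) / 2 *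
        (Complex.exp (ψ * Complex.I) * X t) +
        (1 - fourier (-1) t) / 2 * (Complex.exp (-(ψ * Complex.I)) * conj (X (-t)))) n =
      1 / 2 * (Complex.exp (ψ * Complex.I) * fourierCoeff X n +
        conj (Complex.exp (ψ * Complex.I) * fourierCoeff X n)) +
      1 / 2 * (Complex.exp (ψ * Complex.I) * fourierCoeff X (n + 1) -
        conj (Complex.exp (ψ * Complex.I) * fourierCoeff X (n + 1))) := by
    intro n
    rw [e, fourierCoeff_add' hs.sqInt (hd.sqInt.fourier_mul (-1)), fourierCoeff_fourier_mul,
      fourierCoeff_const_mul', fourierCoeff_const_mul', fourierCoeff_add' h1.sqInt h2.sqInt,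
      fourierCoeff_sub' h1.sqInt h2.sqInt, fourierCoeff_const_mul', fourierCoeff_const_mul',
      fourierCoeff_const_mul', fourierCoeff_const_mul', hc, hc, map_mul, map_mul, conj_exp_mul_I,
      sub_neg_eq_add]
  obtain ⟨k1, k2⟩ := h.coanalytic.half_combination hC (Complex.exp (ψ * Complex.I))
    (Complex.exp (-(ψ * Complex.I))) (fun t => rfl)
  have e2 : (fun t => (1 + fourier (-1) t) / 2 * (Complex.exp (ψ * Complex.I) * X t) +
      (1 - fourier (-1) t) / 2 * (Complex.exp (-(ψ * Complex.I)) * conj (X (-t))) +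
      fourier (-1) t * m t * ((1 + fourier (-1) (-t)) / 2 * (Complex.exp (ψ * Complex.I) * X (-t)) +
      (1 - fourier (-1) (-t)) / 2 * (Complex.exp (-(ψ * Complex.I)) * conj (X (- -t))))) =
      fun t => (1 + fourier (-1) t) / 2 * (Complex.exp (ψ * Complex.I) * (X t + m t * X (-t))) +
        (1 - fourier (-1) t) / 2 *
          (Complex.exp (-(ψ * Complex.I)) * (conj (X (-t)) - m t * conj (X t))) := by
    ext t
    have hz := fourier_neg_mul t
    rw [neg_neg, fourier_refl, ← fourier_neg, neg_neg]
    linear_combination (m t / 2 * (Complex.exp (ψ * Complex.I) * X (-t) -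
      Complex.exp (-(ψ * Complex.I)) * conj (X t))) * hz
  refine ⟨⟨⟨?_, fun n hn => ?_⟩, ?_, ?_⟩, ?_⟩
  · rw [e]; exact hs.sqInt.add (hd.sqInt.fourier_mul (-1))
  · rw [hcoeff, h.analytic.coeff n hn]
    -- The factor `z⁻¹` can only spoil analyticity at frequency `-1`, where the coefficient is the
    -- imaginary part of `e^{iψ}` times the mean of `X`, made zero by `hψ`.
    rcases lt_or_eq_of_le (show n + 1 ≤ 0 by omega) with h3 | h3
    · rw [h.analytic.coeff _ h3]; simp
    · rw [h3, Complex.conj_eq_iff_im.2 hψ]; simp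
  · rw [e2]; exact k1
  · rw [e2, k2, h.mean, hC0, map_one]
    have := exp_add_exp_neg ψ
    linear_combination (1 / 2) * this
  · rw [hcoeff, Complex.add_re]
    set w := Complex.exp (ψ * Complex.I) * fourierCoeff X 0
    set w' := Complex.exp (ψ * Complex.I) * fourierCoeff X (0 + 1)
    have q1 : (1 / 2 * (w + conj w)).re = w.re := by
      rw [Complex.add_conj, ← Complex.ofReal_one, ← Complex.ofReal_ofNat, ← Complex.ofReal_div,
        ← Complex.ofReal_mul, Complex.ofReal_re]
      ring
    have q2 : (1 / 2 * (w' - conj w')).re = 0 := by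
      rw [Complex.sub_conj]
      simp
    rw [q1, q2, add_zero]

end solution

/-- The difference `X_k - 1` solves the problem with source the nonnegative frequency part of
`-z^{-k} r`. Its norm is the `ℓ²` tail of the coefficients of `r` from index `k` on, and the a
priori estimate applies. -/
lemma tendsto_l2_solution {r : AddCircle T → ℂ} {κ : ℝ} (hκ : κ < 1)
    (hr : AEStronglyMeasurable r (haarAddCircle (T := T)))
    (hrκ : ∀ᵐ t ∂haarAddCircle, ‖r t‖ ≤ κ) {X : ℕ → AddCircle T → ℂ}
    (hX : ∀ k : ℕ, IsSolution (fun t => fourier (-k) t * r t) 1 (X k)) :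
    Tendsto (fun k => l2 (fun t => X k t - 1)) atTop (𝓝 0) := by
  have hrs : SqInt r := SqInt.of_bound hr hrκ
  have hms : ∀ k : ℕ, SqInt (fun t => fourier (-k) t * r t) := fun k => hrs.fourier_mul _
  have hmκ : ∀ k : ℕ, ∀ᵐ t ∂haarAddCircle (T := T), ‖fourier (-k) t * r t‖ ≤ κ := fun k => by
    filter_upwards [hrκ] with t ht
    rwa [norm_mul, norm_fourier_apply, one_mul]
  choose P hP hPc using fun k => (hms k).exists_restrict (Set.Ici 0)
  have hsum : Summable (fun n : ℕ => ‖fourierCoeff r n‖ ^ 2) :=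
    hrs.hasSum_norm_sq.summable.comp_injective Nat.cast_injective
  have hPl : ∀ k, l2 (P k) = Real.sqrt (∑' n : ℕ, ‖fourierCoeff r ((n + k : ℕ) : ℤ)‖ ^ 2) := by
    intro k
    have h1 := (hP k).hasSum_norm_sq
    have h2 : HasSum (fun n : ℕ => ‖fourierCoeff r ((n + k : ℕ) : ℤ)‖ ^ 2) (l2 (P k) ^ 2) := by
      convert (Nat.cast_injective (R := ℤ)).hasSum_iff (fun n hn => ?_) |>.2 h1 using 2 with n
      · rw [Function.comp_apply, hPc, if_pos (Set.mem_Ici.2 (Int.natCast_nonneg n)),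
          fourierCoeff_fourier_mul]
        push_cast; ring_nf
      · rw [hPc, if_neg]
        · simp
        · exact fun h0 => hn ⟨n.toNat, Int.toNat_of_nonneg h0⟩
    rw [h2.tsum_eq, Real.sqrt_sq (l2_nonneg _)]
  have hP0 : Tendsto (fun k => (1 - κ)⁻¹ * l2 (P k)) atTop (𝓝 0) := by
    have := (tendsto_sum_nat_add (fun n : ℕ => ‖fourierCoeff r n‖ ^ 2)).sqrt.const_mul (1 - κ)⁻¹
    simp only [Real.sqrt_zero, mul_zero] at this
    simpa only [hPl] using this
  refine squeeze_zero (fun _ => l2_nonneg _) (fun k => ?_) hP0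
  rw [← div_eq_inv_mul, le_div_iff₀ (by linarith), mul_comm]
  have hD : Analytic (fun t => X k t - 1) := (hX k).analytic.sub (Analytic.const 1)
  have hNP : SqInt (fun t => -P k t) := (hP k).neg
  have e : (fun t => X k t - 1 + fourier (-k) t * r t * (X k (-t) - 1) - -P k t) =
      fun t => (X k t + fourier (-k) t * r t * X k (-t) - 1) -
        (fourier (-k) t * r t - P k t) := by
    ext t; ring
  have s1 := (hX k).coanalytic.sub (Coanalytic.const 1)
  have s2 : SqInt (fun t => fourier (-k) t * r t - P k t) := (hms k).sub (hP k)
  have hcoef : ∀ n ≥ 0, fourierCoeff (fun t => X k t - 1 + fourier (-k) t * r t * (X k (-t) - 1) -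
      -P k t) n = 0 := by
    intro n hn
    rw [e, fourierCoeff_sub' s1.sqInt s2, fourierCoeff_sub' (hX k).coanalytic.sqInt (SqInt.const 1),
      fourierCoeff_sub' (hms k) (hP k), hPc, if_pos (Set.mem_Ici.2 hn), fourierCoeff_const]
    rcases hn.eq_or_lt with h0 | h0
    · rw [← h0, (hX k).mean]; simp
    · rw [(hX k).coanalytic.coeff n h0, if_neg h0.ne']; simp
  have := l2_le_of_strictly_coanalytic (hms k).1 (hmκ k) hD hNP
    ⟨by rw [e]; exact s1.sqInt.sub s2, fun n hn => hcoef n hn.le⟩ (hcoef 0 le_rfl)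
  refine this.trans (le_of_eq ?_)
  simp [l2]

end QSP

end

/-! ### Symmetric factorization and existence of the phases -/

noncomputable section

namespace QSP

open MeasureTheory AddCircle Filter Topology ComplexConjugate
open scoped ENNReal

variable {T : ℝ} [hT : Fact (0 < T)]

/-- The symmetric factorization: the solution for the full signal is mapped by the scattering
matrix to a multiple of its complex conjugate. -/
lemma IsSolution.symmetric {b : ℝ} {F : AddCircle T → ℝ} {g X : AddCircle T → ℂ}
    (hg : IsOuterExponent F g) (hF : IsSignal b F) (hb : b ^ 2 < 1 / 2)
    (h : IsSolution (reflCoeff F g) 1 X) :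
    ‖fourierCoeff X 0‖ = Real.exp (∫ t, Real.log (1 - F t ^ 2) / 2 ∂haarAddCircle) ∧
    ∀ᵐ t ∂haarAddCircle, ‖fourierCoeff X 0‖ * (Complex.exp (g t) * X t +
      Complex.I * F t * X (-t)) = fourierCoeff X 0 * conj (X t) := by
  obtain ⟨ha, ha0⟩ := hg.exp hF hb.le
  obtain ⟨he, he0⟩ := hg.exp_neg hF hb.le
  obtain ⟨κ, hκ, hrκ⟩ := hg.exists_reflCoeff_bound hF hb
  have hr := hg.reflCoeff_meas hF
  set A := Real.exp (∫ t, Real.log (1 - F t ^ 2) / 2 ∂haarAddCircle) with hA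
  have hA0 : 0 < A := Real.exp_pos _
  have hA0' : (A : ℂ) ≠ 0 := by exact_mod_cast hA0.ne'
  set x := fourierCoeff X 0 with hx
  have hab : ∀ᵐ t ∂haarAddCircle, ‖Complex.exp (g t)‖ ≤ 1 := by
    filter_upwards [hg.norm_exp_sq hF hb.le] with t ht
    nlinarith [sq_nonneg (F t), norm_nonneg (Complex.exp (g t))]
  have hY : Coanalytic (fun t => Complex.exp (g t) * (X t + reflCoeff F g t * X (-t))) :=
    ha.bdd_mul h.coanalytic hab
  have hY0 : fourierCoeff (fun t => Complex.exp (g t) * (X t + reflCoeff F g t * X (-t))) 0 = A := by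
    rw [ha.coeff_zero_mul h.coanalytic, ha0, h.mean, mul_one]
  have hYe : ∀ t, Complex.exp (g t) * (X t + reflCoeff F g t * X (-t)) =
      Complex.exp (g t) * X t + Complex.I * F t * X (-t) := fun t => by
    rw [reflCoeff]
    linear_combination Complex.I * F t * X (-t) * exp_mul_exp_neg (g t)
  simp only [hYe] at hY hY0
  have hV : Coanalytic (fun t => Complex.exp (-g t) * conj (X t)) :=
    he.bdd_mul h.analytic.conj (hg.norm_exp_neg_le hF hb.le)
  have hV0 : fourierCoeff (fun t => Complex.exp (-g t) * conj (X t)) 0 = conj x / A := by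
    rw [he.coeff_zero_mul h.analytic.conj, he0, fourierCoeff_conj, neg_zero, hx, div_eq_inv_mul]
  -- Set `Y = exp g · X + iF X(1/z)`, which is coanalytic. Because `|exp g|² = 1 - F²`, applying the
  -- same equation to `conj Y` returns `exp(-g) conj X`, so `conj Y` solves the original problem
  -- with another mean.
  have hsol : IsSolution (reflCoeff F g) (conj x / A)
      (fun t => conj (Complex.exp (g t) * X t + Complex.I * F t * X (-t))) := by
    have e : (fun t => Complex.exp (-g t) * conj (X t)) =ᵐ[haarAddCircle]
        fun t => conj (Complex.exp (g t) * X t + Complex.I * F t * X (-t)) + reflCoeff F g t *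
          conj (Complex.exp (g (-t)) * X (-t) + Complex.I * F (-t) * X (- -t)) := by
      filter_upwards [hg.refl, hg.norm_exp_sq hF hb.le] with t h1 h2
      have h3 : Complex.exp (g t) * conj (Complex.exp (g t)) = 1 - (F t : ℂ) ^ 2 := by
        rw [Complex.mul_conj, Complex.normSq_eq_norm_sq, h2]; push_cast; ring
      have h4 : conj (Complex.exp (g (-t))) = Complex.exp (g t) := by
        rw [h1, ← Complex.exp_conj, Complex.conj_conj]
      have h5 := exp_mul_exp_neg (g t)
      rw [reflCoeff, neg_neg, hF.even]
      simp only [map_add, map_mul, h4, Complex.conj_I, Complex.conj_ofReal]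
      linear_combination (conj (Complex.exp (g t)) * conj (X t) -
        Complex.I * F t * conj (X (-t))) * h5 - Complex.exp (-g t) * conj (X t) * h3 +
        Complex.exp (-g t) * conj (X t) * F t ^ 2 * Complex.I_sq
    exact ⟨hY.conj, hV.congr e, by rw [← fourierCoeff_congr_ae e, hV0]⟩
  have hu := hsol.unique hκ hr hrκ (by simpa using h.const_mul (conj x / A))
  -- Uniqueness gives `conj Y = (conj x / A) X`; comparing means yields `|x| = A`.
  have hnorm : (A : ℂ) = conj x / A * x := by
    have h1 : fourierCoeff (fun t => conj (Complex.exp (g t) * X t +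
        Complex.I * F t * X (-t))) 0 = A := by
      rw [fourierCoeff_conj, neg_zero, hY0, Complex.conj_ofReal]
    conv_lhs => rw [← h1]
    rw [fourierCoeff_congr_ae hu, fourierCoeff_const_mul']
  have hxA : ‖x‖ = A := by
    have h1 : ((A ^ 2 : ℝ) : ℂ) = ((‖x‖ ^ 2 : ℝ) : ℂ) := by
      push_cast
      rw [← Complex.mul_conj']
      field_simp at hnorm
      rw [hnorm]; ring
    have h2 : A ^ 2 = ‖x‖ ^ 2 := by exact_mod_cast h1
    exact ((sq_eq_sq₀ hA0.le (norm_nonneg _)).1 h2).symm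
  refine ⟨hxA, ?_⟩
  filter_upwards [hu] with t ht
  have := congrArg conj ht
  rw [Complex.conj_conj, map_mul, map_div₀, Complex.conj_conj, Complex.conj_ofReal] at this
  rw [this, hxA]
  field_simp

/-- Recover the signal from the symmetric factorization. -/
lemma signal_eq_of_symmetric {a x y E : ℂ} {F : ℝ}
    (h1 : a * x + Complex.I * F * conj y = conj E * conj x)
    (h2 : conj a * conj y + Complex.I * F * x = conj E * y)
    (h3 : ‖x‖ ^ 2 + ‖y‖ ^ 2 = 2) : F = -(E * (x * conj y)).im := by
  have h2' := congrArg conj h2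
  simp only [map_mul, map_add, Complex.conj_conj, Complex.conj_I, Complex.conj_ofReal] at h2'
  have h3' : x * conj x + y * conj y = 2 := by
    rw [Complex.mul_conj, Complex.mul_conj, Complex.normSq_eq_norm_sq, Complex.normSq_eq_norm_sq,
      ← Complex.ofReal_add, h3]
    norm_num
  have h4 := Complex.sub_conj (E * (x * conj y))
  simp only [map_mul, Complex.conj_conj] at h4
  have h5 : Complex.I * (F : ℂ) = Complex.I * ((-(E * (x * conj y)).im : ℝ) : ℂ) := by
    push_cast at h4 ⊢
    linear_combination (1 / 2) * (y * h1 - x * h2') - Complex.I * F / 2 * h3' - (1 / 2) * h4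
  exact_mod_cast mul_left_cancel₀ Complex.I_ne_zero h5

/-- The polar form of a complex number in the right half plane. -/
lemma exists_phase {x : ℂ} (hx : 0 < x.re) : ∃ ψ ∈ Set.Ioo (-(Real.pi / 2)) (Real.pi / 2),
    Complex.exp (ψ * Complex.I) * x = ‖x‖ ∧ x = ‖x‖ * Complex.exp (-(ψ * Complex.I)) ∧
      x.re = ‖x‖ * Real.cos ψ := by
  have h1 : Complex.exp ((-x.arg : ℝ) * Complex.I) * x = ‖x‖ := by
    conv_lhs => rw [← Complex.norm_mul_exp_arg_mul_I x]
    rw [mul_left_comm, ← Complex.exp_add]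
    simp
  have h2 : x = ‖x‖ * Complex.exp (-((-x.arg : ℝ) * Complex.I)) := by
    rw [← h1]
    linear_combination -x * exp_mul_exp_neg ((-x.arg : ℝ) * Complex.I)
  have h3 := Complex.abs_arg_lt_pi_div_two_iff.2 (Or.inl hx)
  rw [abs_lt] at h3
  refine ⟨-x.arg, ⟨by linarith, by linarith⟩, h1, h2, ?_⟩
  conv_lhs => rw [h2]
  rw [Complex.re_ofReal_mul, ← neg_mul, ← Complex.ofReal_neg, Complex.exp_ofReal_mul_I_re,
    Real.cos_neg]

/-- Two consecutive solutions are related by one transfer step. -/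
lemma IsSolution.consecutive {m X X' : AddCircle T → ℂ} {κ ψ : ℝ} (hκ : κ < 1)
    (hm : ∀ᵐ t ∂haarAddCircle, m (-t) = -conj (m t))
    (hms : AEStronglyMeasurable m (haarAddCircle (T := T)))
    (hmκ : ∀ᵐ t ∂haarAddCircle, ‖m t‖ ≤ κ) (h : IsSolution m 1 X)
    (h' : IsSolution (fun t => fourier (-1) t * m t) 1 X')
    (hψ : Complex.exp (ψ * Complex.I) * fourierCoeff X 0 = ‖fourierCoeff X 0‖) :
    (∀ᵐ t ∂haarAddCircle, Real.cos ψ * X' t =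
      (1 + fourier (-1) t) / 2 * (Complex.exp (ψ * Complex.I) * X t) +
        (1 - fourier (-1) t) / 2 * (Complex.exp (-(ψ * Complex.I)) * conj (X (-t)))) ∧
      Real.cos ψ * (fourierCoeff X' 0).re = ‖fourierCoeff X 0‖ := by
  obtain ⟨h1, h2⟩ := h.strip hm (ψ := ψ) (by rw [hψ]; exact Complex.ofReal_im _)
  have h3 := h'.const_mul (Real.cos ψ)
  rw [mul_one] at h3
  have h4 := h3.unique hκ ((fourier (-1)).continuous.aestronglyMeasurable.mul hms) (by
    filter_upwards [hmκ] with t ht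
    rw [Pi.mul_apply, norm_mul, norm_fourier_apply, one_mul]
    exact ht) h1
  refine ⟨h4, ?_⟩
  rwa [← fourierCoeff_congr_ae h4, fourierCoeff_const_mul', Complex.re_ofReal_mul, hψ,
    Complex.ofReal_re] at h2

/-- Dividing by the `L²` norms absorbs the factor `cos ψ`, so the inverted stripping relation
becomes an exact unitary step for the normalized solutions. -/
lemma step_of_consecutive {X X' : AddCircle T → ℂ} {ψ ℓ ℓ' : ℝ} (hcos : Real.cos ψ ≠ 0)
    (hℓ : ℓ = Real.cos ψ * ℓ')
    (h : ∀ᵐ t ∂haarAddCircle, Real.cos ψ * X' t =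
      (1 + fourier (-1) t) / 2 * (Complex.exp (ψ * Complex.I) * X t) +
        (1 - fourier (-1) t) / 2 * (Complex.exp (-(ψ * Complex.I)) * conj (X (-t)))) :
    ∀ᵐ t ∂haarAddCircle, ((ℓ : ℂ)⁻¹ * X t, conj ((ℓ : ℂ)⁻¹ * X (-t))) =
      step ψ (fourier 1 t) ((ℓ' : ℂ)⁻¹ * X' t, conj ((ℓ' : ℂ)⁻¹ * X' (-t))) := by
  filter_upwards [h, ae_refl h] with t ht ht'
  have hne : (Real.cos ψ : ℂ) ≠ 0 := by exact_mod_cast hcos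
  have hz := fourier_neg_mul t
  have he := exp_mul_exp_neg (ψ * Complex.I)
  replace ht' := congrArg conj ht'
  simp only [neg_neg, map_mul, map_add, map_sub, map_div₀, map_one, Complex.conj_ofNat,
    Complex.conj_conj, Complex.conj_ofReal, conj_exp_mul_I, conj_exp_neg_mul_I,
    fourier_refl] at ht'
  have hl : (ℓ : ℂ)⁻¹ = (Real.cos ψ : ℂ)⁻¹ * (ℓ' : ℂ)⁻¹ := by
    rw [hℓ]; push_cast; rw [mul_inv]
  have hc1 : X' t = (Real.cos ψ : ℂ)⁻¹ * (Real.cos ψ * X' t) := by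
    rw [inv_mul_cancel_left₀ hne]
  have hc2 : conj (X' (-t)) = (Real.cos ψ : ℂ)⁻¹ * (Real.cos ψ * conj (X' (-t))) := by
    rw [inv_mul_cancel_left₀ hne]
  simp only [map_mul, map_inv₀, Complex.conj_ofReal]
  rw [hc1, hc2, ht, ht', hl]
  set u := (Real.cos ψ : ℂ)⁻¹
  set v := (ℓ' : ℂ)⁻¹
  set E := Complex.exp (ψ * Complex.I)
  set E' := Complex.exp (-(ψ * Complex.I))
  set z := fourier 1 t
  set w := fourier (-1) t
  ext
  · simp only [step]
    linear_combination (-u * v * X t) * he - (u * v * E' / 2) * (E * X t - E' * conj (X (-t))) * hz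
  · simp only [step]
    linear_combination (-u * v * conj (X (-t))) * he + (u * v * E / 2) * (E * X t - E' * conj (X (-t))) * hz

/-- The normalized solutions and their phases. -/
structure IsStripping (F : AddCircle T → ℝ) (Ψ : ℕ → ℝ) (ξ : ℕ → AddCircle T → ℂ) (ℓ : ℕ → ℝ) :
    Prop where
  phase : ∀ k, Ψ k ∈ Set.Ioo (-(Real.pi / 2)) (Real.pi / 2)
  sqInt : ∀ k, SqInt (ξ k)
  tendsto : Tendsto (fun k => l2 (fun t => ξ k t - 1)) atTop (𝓝 0)
  scale_pos : ∀ k, 0 < ℓ k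
  scale : ∀ k, ℓ k = Real.cos (Ψ k) * ℓ (k + 1)
  scale_lim : Tendsto ℓ atTop (𝓝 1)
  scale_mul : ℓ 0 * ℓ 1 = Real.exp (∫ t, Real.log (1 - F t ^ 2) / 2 ∂haarAddCircle)
  step : ∀ k, ∀ᵐ t ∂haarAddCircle,
    (ξ k t, conj (ξ k (-t))) = step (Ψ k) (fourier 1 t) (ξ (k + 1) t, conj (ξ (k + 1) (-t)))
  signal : ∀ᵐ t ∂haarAddCircle, ‖ξ 0 t‖ ^ 2 + ‖conj (ξ 0 (-t))‖ ^ 2 = 2 →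
    F t = -(Complex.exp (Ψ 0 * Complex.I) * (ξ 0 t * conj (conj (ξ 0 (-t))))).im

lemma SqInt.abs_l2_sub_one_le {X : AddCircle T → ℂ} (h : SqInt X) :
    |l2 X - 1| ≤ l2 (fun t => X t - 1) := by
  have hone : l2 (fun _ : AddCircle T => (1 : ℂ)) = 1 := by rw [l2_const, norm_one]
  have hX1 : SqInt (fun t => X t - 1) := h.sub (SqInt.const 1)
  have h1 := h.l2_sub_le hX1
  have h2 := hX1.l2_add_le (SqInt.const 1)
  simp only [sub_sub_cancel, sub_add_cancel, hone] at h1 h2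
  rw [abs_le]
  constructor <;> linarith

lemma SqInt.l2_normalize_sub_one_le {X : AddCircle T → ℂ} (h : SqInt X) (h0 : 0 < l2 X) :
    l2 (fun t => (l2 X : ℂ)⁻¹ * X t - 1) ≤ (l2 X)⁻¹ * (2 * l2 (fun t => X t - 1)) := by
  have hX1 : SqInt (fun t => X t - 1) := h.sub (SqInt.const 1)
  have hne : (l2 X : ℂ) ≠ 0 := by exact_mod_cast h0.ne'
  have e : (fun t => (l2 X : ℂ)⁻¹ * X t - 1) =
      fun t => (l2 X : ℂ)⁻¹ * ((X t - 1) - ((l2 X : ℂ) - 1)) := by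
    ext t; field_simp; ring
  rw [e, l2_const_mul, norm_inv, Complex.norm_real, Real.norm_of_nonneg h0.le]
  refine mul_le_mul_of_nonneg_left ?_ (inv_pos.2 h0).le
  refine (hX1.l2_sub_le (SqInt.const _)).trans ?_
  rw [l2_const, ← Complex.ofReal_one, ← Complex.ofReal_sub, Complex.norm_real, Real.norm_eq_abs]
  have := h.abs_l2_sub_one_le
  simp only [Complex.ofReal_one]
  linarith

lemma signal_of_symmetric {F : AddCircle T → ℝ} {g X : AddCircle T → ℂ} {ψ ℓ : ℝ}
    (hF : ∀ t, F (-t) = F t) (hg : ∀ᵐ t ∂haarAddCircle, g (-t) = conj (g t))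
    (hx : fourierCoeff X 0 = ‖fourierCoeff X 0‖ * Complex.exp (-(ψ * Complex.I)))
    (hx0 : (‖fourierCoeff X 0‖ : ℂ) ≠ 0)
    (h : ∀ᵐ t ∂haarAddCircle, ‖fourierCoeff X 0‖ * (Complex.exp (g t) * X t +
      Complex.I * F t * X (-t)) = fourierCoeff X 0 * conj (X t)) :
    ∀ᵐ t ∂haarAddCircle, ‖(ℓ : ℂ)⁻¹ * X t‖ ^ 2 + ‖conj ((ℓ : ℂ)⁻¹ * X (-t))‖ ^ 2 = 2 →
      F t = -(Complex.exp (ψ * Complex.I) *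
        ((ℓ : ℂ)⁻¹ * X t * conj (conj ((ℓ : ℂ)⁻¹ * X (-t))))).im := by
  have h' : ∀ᵐ t ∂haarAddCircle, Complex.exp (g t) * X t + Complex.I * F t * X (-t) =
      Complex.exp (-(ψ * Complex.I)) * conj (X t) := by
    filter_upwards [h] with t ht
    refine mul_left_cancel₀ hx0 (ht.trans ?_)
    conv_lhs => rw [hx]
    ring
  filter_upwards [h', ae_refl h', hg] with t h1 h2 h3 h4
  refine signal_eq_of_symmetric (a := Complex.exp (g t)) ?_ ?_ h4
  · simp only [Complex.conj_conj, map_mul, map_inv₀, Complex.conj_ofReal, conj_exp_mul_I]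
    linear_combination (ℓ : ℂ)⁻¹ * h1
  · rw [neg_neg, hF, h3, Complex.exp_conj] at h2
    simp only [Complex.conj_conj, map_mul, map_inv₀, Complex.conj_ofReal, conj_exp_mul_I]
    linear_combination (ℓ : ℂ)⁻¹ * h2

section family

variable {r : AddCircle T → ℂ} {κ : ℝ} {X : ℕ → AddCircle T → ℂ}

lemma shift_meas (hr : AEStronglyMeasurable r (haarAddCircle (T := T))) (k : ℕ) :
    AEStronglyMeasurable (fun t => fourier (-k) t * r t) (haarAddCircle (T := T)) :=
  (fourier (-(k : ℤ))).continuous.aestronglyMeasurable.mul hr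

lemma shift_bound (hrκ : ∀ᵐ t ∂haarAddCircle, ‖r t‖ ≤ κ) (k : ℕ) :
    ∀ᵐ t ∂haarAddCircle (T := T), ‖fourier (-k) t * r t‖ ≤ κ := by
  filter_upwards [hrκ] with t ht
  rwa [norm_mul, norm_fourier_apply, one_mul]

lemma shift_refl (hrr : ∀ᵐ t ∂haarAddCircle, r (-t) = -conj (r t)) (k : ℕ) :
    ∀ᵐ t ∂haarAddCircle (T := T),
      fourier (-k) (-t) * r (-t) = -conj (fourier (-k) t * r t) := by
  filter_upwards [hrr] with t ht
  rw [ht, fourier_refl, map_mul]; ring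

lemma shift_succ {T : ℝ} (r : AddCircle T → ℂ) (k : ℕ) :
    (fun t : AddCircle T => fourier (-1) t * (fourier (-k) t * r t)) =
        fun t => fourier (-((k + 1 : ℕ) : ℤ)) t * r t := by
  ext t
  rw [← mul_assoc, ← fourier_add, show (-((k + 1 : ℕ) : ℤ)) = -1 + -(k : ℤ) by push_cast; ring]

lemma IsSolution.exists_transfer_phase {m x x' : AddCircle T → ℂ} (hκ : κ < 1)
    (hm : ∀ᵐ t ∂haarAddCircle, m (-t) = -conj (m t))
    (hms : AEStronglyMeasurable m (haarAddCircle (T := T)))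
    (hmκ : ∀ᵐ t ∂haarAddCircle, ‖m t‖ ≤ κ) (h : IsSolution m 1 x)
    (h' : IsSolution (fun t => fourier (-1) t * m t) 1 x')
    (hre' : (fourierCoeff x' 0).re = l2 x' ^ 2) :
    ∃ ψ : ℝ, ψ ∈ Set.Ioo (-(Real.pi / 2)) (Real.pi / 2) ∧
      fourierCoeff x 0 = ‖fourierCoeff x 0‖ * Complex.exp (-(ψ * Complex.I)) ∧
      l2 x = Real.cos ψ * l2 x' ∧ ‖fourierCoeff x 0‖ = l2 x * l2 x' ∧
      ∀ᵐ t ∂haarAddCircle, Real.cos ψ * x' t =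
      (1 + fourier (-1) t) / 2 * (Complex.exp (ψ * Complex.I) * x t) +
        (1 - fourier (-1) t) / 2 * (Complex.exp (-(ψ * Complex.I)) * conj (x (-t))) := by
  have hl := h.l2_pos
  have hl' := h'.l2_pos
  have hre : (fourierCoeff x 0).re = l2 x ^ 2 := h.re_mean hm hms hmκ
  obtain ⟨ψ, hψ, hψ1, hψ2, hψ3⟩ := exists_phase (x := fourierCoeff x 0)
    (by rw [hre]; exact pow_pos hl 2)
  have hcos : 0 < Real.cos ψ := Real.cos_pos_of_mem_Ioo hψ
  obtain ⟨h1, h2⟩ := h.consecutive hκ hm hms hmκ h' hψ1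
  rw [hre'] at h2
  -- Here `‖x‖²` is the real part of the mean of `x`, which equals `cos ψ` times its modulus, and
  -- that modulus is `cos ψ · ‖x'‖²`.
  have hs : l2 x = Real.cos ψ * l2 x' := by
    refine (sq_eq_sq₀ hl.le (mul_pos hcos hl').le).1 ?_
    rw [← hre, hψ3, ← h2]; ring
  refine ⟨ψ, hψ, hψ2, hs, ?_, h1⟩
  rw [← h2, hs]; ring

lemma exists_phases (hκ : κ < 1) (hr : AEStronglyMeasurable r (haarAddCircle (T := T)))
    (hrκ : ∀ᵐ t ∂haarAddCircle, ‖r t‖ ≤ κ)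
    (hrr : ∀ᵐ t ∂haarAddCircle, r (-t) = -conj (r t))
    (hX : ∀ k : ℕ, IsSolution (fun t => fourier (-k) t * r t) 1 (X k)) :
    ∃ Ψ : ℕ → ℝ, ∀ k, Ψ k ∈ Set.Ioo (-(Real.pi / 2)) (Real.pi / 2) ∧
      fourierCoeff (X k) 0 = ‖fourierCoeff (X k) 0‖ * Complex.exp (-(Ψ k * Complex.I)) ∧
      l2 (X k) = Real.cos (Ψ k) * l2 (X (k + 1)) ∧
      ‖fourierCoeff (X k) 0‖ = l2 (X k) * l2 (X (k + 1)) ∧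
      ∀ᵐ t ∂haarAddCircle, Real.cos (Ψ k) * X (k + 1) t =
      (1 + fourier (-1) t) / 2 * (Complex.exp (Ψ k * Complex.I) * X k t) +
        (1 - fourier (-1) t) / 2 * (Complex.exp (-(Ψ k * Complex.I)) * conj (X k (-t))) := by
  have key : ∀ k, ∃ ψ : ℝ, ψ ∈ Set.Ioo (-(Real.pi / 2)) (Real.pi / 2) ∧
      fourierCoeff (X k) 0 = ‖fourierCoeff (X k) 0‖ * Complex.exp (-(ψ * Complex.I)) ∧
      l2 (X k) = Real.cos ψ * l2 (X (k + 1)) ∧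
      ‖fourierCoeff (X k) 0‖ = l2 (X k) * l2 (X (k + 1)) ∧
      ∀ᵐ t ∂haarAddCircle, Real.cos ψ * X (k + 1) t =
      (1 + fourier (-1) t) / 2 * (Complex.exp (ψ * Complex.I) * X k t) +
        (1 - fourier (-1) t) / 2 * (Complex.exp (-(ψ * Complex.I)) * conj (X k (-t))) := by
    intro k
    have hr1 := shift_refl hrr (k + 1)
    have hr2 := shift_meas hr (k + 1)
    have hr3 := shift_bound hrκ (k + 1)
    have hre' : (fourierCoeff (X (k + 1)) 0).re = l2 (X (k + 1)) ^ 2 :=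
      IsSolution.re_mean (m := fun t => fourier (-((k + 1 : ℕ) : ℤ)) t * r t) hr1 hr2 hr3
        (hX (k + 1))
    have hX' : IsSolution (fun t => fourier (-1) t * (fourier (-k) t * r t)) 1 (X (k + 1)) := by
      rw [shift_succ]
      exact hX (k + 1)
    exact IsSolution.exists_transfer_phase (m := fun t => fourier (-k) t * r t) hκ
      (shift_refl hrr k) (shift_meas hr k) (shift_bound hrκ k) (hX k) hX' hre'
  exact ⟨fun k => (key k).choose, fun k => (key k).choose_spec⟩

end family

lemma IsStripping.of_solutions {F : AddCircle T → ℝ} {g r : AddCircle T → ℂ} {κ : ℝ}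
    {X : ℕ → AddCircle T → ℂ} (hκ : κ < 1)
    (hr : AEStronglyMeasurable r (haarAddCircle (T := T)))
    (hrκ : ∀ᵐ t ∂haarAddCircle, ‖r t‖ ≤ κ)
    (hrr : ∀ᵐ t ∂haarAddCircle, r (-t) = -conj (r t))
    (hX : ∀ k : ℕ, IsSolution (fun t => fourier (-k) t * r t) 1 (X k))
    (hF : ∀ t, F (-t) = F t) (hg : ∀ᵐ t ∂haarAddCircle, g (-t) = conj (g t))
    (hnorm : ‖fourierCoeff (X 0) 0‖ =
      Real.exp (∫ t, Real.log (1 - F t ^ 2) / 2 ∂haarAddCircle))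
    (hsym : ∀ᵐ t ∂haarAddCircle, ‖fourierCoeff (X 0) 0‖ * (Complex.exp (g t) * X 0 t +
      Complex.I * F t * X 0 (-t)) = fourierCoeff (X 0) 0 * conj (X 0 t)) :
    ∃ Ψ, IsStripping F Ψ (fun k t => (l2 (X k) : ℂ)⁻¹ * X k t) (fun k => l2 (X k)) := by
  obtain ⟨Ψ, hΨ⟩ := exists_phases hκ hr hrκ hrr hX
  have hl0 : ∀ k, 0 < l2 (X k) := fun k => (hX k).l2_pos
  have hlim : Tendsto (fun k => l2 (fun t => X k t - 1)) atTop (𝓝 0) :=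
    tendsto_l2_solution hκ hr hrκ hX
  have hXs : ∀ k, SqInt (X k) := fun k => (hX k).analytic.sqInt
  have hllim : Tendsto (fun k => l2 (X k)) atTop (𝓝 1) := by
    rw [tendsto_iff_norm_sub_tendsto_zero]
    exact squeeze_zero (fun _ => norm_nonneg _) (fun k => (hXs k).abs_l2_sub_one_le) hlim
  have hx0 : (‖fourierCoeff (X 0) 0‖ : ℂ) ≠ 0 := by
    rw [hnorm]; exact_mod_cast (Real.exp_pos _).ne'
  refine ⟨Ψ, ?_⟩
  constructor
  · exact fun k => (hΨ k).1
  · exact fun k => (hXs k).const_mul _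
  · have hl := (hllim.inv₀ one_ne_zero).mul (hlim.const_mul 2)
    simp only [mul_zero] at hl
    exact squeeze_zero (fun _ => l2_nonneg _)
      (fun k => (hXs k).l2_normalize_sub_one_le (hl0 k)) hl
  · exact hl0
  · exact fun k => (hΨ k).2.2.1
  · exact hllim
  · rw [← hnorm]; exact (hΨ 0).2.2.2.1.symm
  · exact fun k => step_of_consecutive
      (Real.cos_pos_of_mem_Ioo (hΨ k).1).ne' (hΨ k).2.2.1 (hΨ k).2.2.2.2
  · exact signal_of_symmetric hF hg (hΨ 0).2.1 hx0 hsym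

lemma IsSignal.exists_stripping {b : ℝ} {F : AddCircle T → ℝ} (hF : IsSignal b F)
    (hb : b ^ 2 < 1 / 2) : ∃ Ψ ξ ℓ, IsStripping F Ψ ξ ℓ := by
  obtain ⟨g, hg⟩ := hF.exists_outer hb.le
  obtain ⟨κ, hκ, hrκ⟩ := hg.exists_reflCoeff_bound hF hb
  have hr := hg.reflCoeff_meas hF
  choose X hX using fun k : ℕ => IsSolution.exists hκ (shift_meas hr k) (shift_bound hrκ k)
  have hX0 : IsSolution (reflCoeff F g) 1 (X 0) := by
    have e : (fun t : AddCircle T => fourier (-((0 : ℕ) : ℤ)) t * reflCoeff F g t) =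
        reflCoeff F g := by
      ext t; simp
    rw [← e]; exact hX 0
  obtain ⟨hnorm, hsym⟩ := hX0.symmetric hg hF hb
  obtain ⟨Ψ, hΨ⟩ := IsStripping.of_solutions hκ hr hrκ (hg.reflCoeff_refl hF) hX hF.even hg.refl
    hnorm hsym
  exact ⟨Ψ, _, _, hΨ⟩

lemma IsStripping.cosProd_mul {F : AddCircle T → ℝ} {Ψ : ℕ → ℝ} {ξ : ℕ → AddCircle T → ℂ}
    {ℓ : ℕ → ℝ} (h : IsStripping F Ψ ξ ℓ) (n k : ℕ) : cosProd Ψ n k * ℓ (k + n) = ℓ k := by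
  induction n generalizing k with
  | zero => simp [cosProd]
  | succ n ih => rw [cosProd_succ, mul_assoc, show k + (n + 1) = k + 1 + n by ring, ih, ← h.scale]

lemma IsStripping.chain {F : AddCircle T → ℝ} {Ψ : ℕ → ℝ} {ξ : ℕ → AddCircle T → ℂ}
    {ℓ : ℕ → ℝ} (h : IsStripping F Ψ ξ ℓ) : ∀ᵐ t ∂haarAddCircle, ∀ n,
      (ξ 0 t, conj (ξ 0 (-t))) = chain Ψ (fourier 1 t) n 0 (ξ n t, conj (ξ n (-t))) := by
  filter_upwards [ae_all_iff.2 h.step] with t ht n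
  induction n with
  | zero => rfl
  | succ n ih => rw [chain_succ_right, zero_add, ← ht, ih]

lemma abs_norm_sq_sub_one_le (w : ℂ) : |‖w‖ ^ 2 - 1| ≤ ‖w - 1‖ ^ 2 + 2 * ‖w - 1‖ := by
  have h1 : |‖w‖ - 1| ≤ ‖w - 1‖ := by simpa using abs_norm_sub_norm_le w 1
  have h2 : ‖w‖ + 1 ≤ ‖w - 1‖ + 2 := by
    have := norm_add_le (w - 1) 1
    simp only [sub_add_cancel, norm_one] at this
    linarith
  have e : ‖w‖ ^ 2 - 1 = (‖w‖ - 1) * (‖w‖ + 1) := by ring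
  rw [e, abs_mul, abs_of_nonneg (by positivity : (0 : ℝ) ≤ ‖w‖ + 1)]
  calc _ ≤ ‖w - 1‖ * (‖w - 1‖ + 2) := mul_le_mul h1 h2 (by positivity) (norm_nonneg _)
    _ = _ := by ring

lemma SqInt.integral_norm_le {φ : AddCircle T → ℂ} (h : SqInt φ) :
    ∫ t, ‖φ t‖ ∂haarAddCircle ≤ l2 φ := by
  have hn : SqInt (fun t => ((‖φ t‖ : ℝ) : ℂ)) := h.norm.ofReal
  have h8 := hn.norm_integral_le
  have e : ∫ t, ((‖φ t‖ : ℝ) : ℂ) ∂haarAddCircle =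
      ((∫ t, ‖φ t‖ ∂haarAddCircle : ℝ) : ℂ) := integral_ofReal
  rw [e, Complex.norm_real] at h8
  refine (le_abs_self _).trans (h8.trans (le_of_eq ?_))
  simp [l2]

section stripping

variable {F : AddCircle T → ℝ} {Ψ : ℕ → ℝ} {ξ : ℕ → AddCircle T → ℂ} {ℓ : ℕ → ℝ}

lemma SqInt.integral_bump_le {x : AddCircle T → ℂ} (h : SqInt x) :
    ∫ t, (‖x t - 1‖ ^ 2 + 2 * ‖x t - 1‖) ∂haarAddCircle ≤
      l2 (fun t => x t - 1) ^ 2 + 2 * l2 (fun t => x t - 1) := by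
  have h1 : SqInt (fun t => x t - 1) := h.sub (SqInt.const 1)
  rw [integral_add h1.integrable_sq (h1.integrable'.norm.const_mul 2), integral_const_mul, l2_sq]
  have := h1.integral_norm_le
  linarith

/-- The pair for `ξ 0` is the unitary image of the pair for `ξ n`, so both have the same pointwise
norm; since `ξ n → 1` in `L²`, that norm squared must be `2` almost everywhere. -/
lemma IsStripping.norm_sq (h : IsStripping F Ψ ξ ℓ) :
    ∀ᵐ t ∂haarAddCircle, ‖ξ 0 t‖ ^ 2 + ‖conj (ξ 0 (-t))‖ ^ 2 = 2 := by
  obtain ⟨β, hβ⟩ : ∃ β : ℕ → AddCircle T → ℝ, β = fun n t => ‖ξ n t - 1‖ ^ 2 + 2 * ‖ξ n t - 1‖ :=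
    ⟨_, rfl⟩
  have hs : ∀ n, SqInt (fun t => ξ n t - 1) := fun n => (h.sqInt n).sub (SqInt.const 1)
  have hβi : ∀ n, Integrable (β n) (haarAddCircle (T := T)) := fun n => by
    rw [hβ]
    exact (hs n).integrable_sq.add ((hs n).integrable'.norm.const_mul 2)
  have hβr : ∀ n, Integrable (fun t => β n (-t)) (haarAddCircle (T := T)) := fun n =>
    (hβi n).comp_neg
  have hle : ∀ n, ∫ t, |‖ξ 0 t‖ ^ 2 + ‖conj (ξ 0 (-t))‖ ^ 2 - 2| ∂haarAddCircle ≤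
      2 * (l2 (fun t => ξ n t - 1) ^ 2 + 2 * l2 (fun t => ξ n t - 1)) := by
    intro n
    have h1 : ∫ t, (β n t + β n (-t)) ∂haarAddCircle ≤
        2 * (l2 (fun t => ξ n t - 1) ^ 2 + 2 * l2 (fun t => ξ n t - 1)) := by
      rw [integral_add (hβi n) (hβr n), integral_neg_eq_self (β n)]
      have := (h.sqInt n).integral_bump_le
      rw [hβ]
      linarith
    refine (integral_mono_of_nonneg (ae_of_all _ fun _ => abs_nonneg _)
      ((hβi n).add (hβr n)) ?_).trans h1
    filter_upwards [h.chain] with t ht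
    have h2 := congrArg pairNormSq (ht n)
    rw [pairNormSq_chain _ (norm_fourier_apply 1 t)] at h2
    simp only [pairNormSq] at h2
    have h3 := abs_norm_sq_sub_one_le (ξ n t)
    have h4 := abs_norm_sq_sub_one_le (ξ n (-t))
    rw [h2, RCLike.norm_conj, hβ]
    simp only [Pi.add_apply]
    rw [abs_le] at h3 h4 ⊢
    constructor <;> linarith
  have hz : ∫ t, |‖ξ 0 t‖ ^ 2 + ‖conj (ξ 0 (-t))‖ ^ 2 - 2| ∂haarAddCircle = 0 := by
    refine le_antisymm ?_ (integral_nonneg fun _ => abs_nonneg _)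
    have hl := ((h.tendsto.pow 2).add (h.tendsto.const_mul 2)).const_mul 2
    norm_num at hl
    exact ge_of_tendsto' hl hle
  have hi : Integrable (fun t => |‖ξ 0 t‖ ^ 2 + ‖conj (ξ 0 (-t))‖ ^ 2 - 2|)
      (haarAddCircle (T := T)) :=
    (((h.sqInt 0).integrable_sq.add (h.sqInt 0).refl.conj.integrable_sq).sub
      (integrable_const 2)).abs
  have := (integral_eq_zero_iff_of_nonneg (fun _ => abs_nonneg _) hi).1 hz
  filter_upwards [this] with t ht
  have := abs_eq_zero.1 ht
  linarith

/-- The imaginary part of a rotated product is Lipschitz on bounded sets. -/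
lemma abs_im_mul_conj_sub_le {E x y x' y' : ℂ} {C : ℝ} (hE : ‖E‖ = 1) (hx : ‖x‖ ≤ C)
    (hy' : ‖y'‖ ≤ C) : |-(E * (x' * conj y')).im - -(E * (x * conj y)).im| ≤
      C * ‖x' - x‖ + C * ‖y' - y‖ := by
  have e : -(E * (x' * conj y')).im - -(E * (x * conj y)).im =
      -(E * ((x' - x) * conj y' + x * conj (y' - y))).im := by
    rw [map_sub, ← sub_eq_zero, ← neg_eq_zero]
    simp only [Complex.mul_im, Complex.add_im, Complex.add_re, Complex.mul_re, Complex.sub_re,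
      Complex.sub_im]
    ring
  rw [e, abs_neg]
  refine (Complex.abs_im_le_norm _).trans ?_
  rw [norm_mul, hE, one_mul]
  refine (norm_add_le _ _).trans ?_
  rw [norm_mul, norm_mul, RCLike.norm_conj, RCLike.norm_conj, mul_comm ‖x' - x‖]
  gcongr

lemma norm_le_add_of_pairNormSq {v w : ℂ × ℂ} (h : pairNormSq v = pairNormSq w) :
    ‖v.1‖ ≤ ‖w.1‖ + ‖w.2‖ ∧ ‖v.2‖ ≤ ‖w.1‖ + ‖w.2‖ := by
  simp only [pairNormSq] at h
  have h1 := norm_nonneg w.1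
  have h2 := norm_nonneg w.2
  constructor <;> refine abs_le_of_sq_le_sq' ?_ (by positivity) |>.2 <;>
    nlinarith [sq_nonneg ‖v.1‖, sq_nonneg ‖v.2‖, mul_nonneg h1 h2]

/-- The difference between the exact chain and the chain started at `(1, 1)` is the unitary image of
the difference of the starting vectors. Each component costs a factor `√2`, the bound on the other
component. -/
lemma abs_chainIm_sub_le {T : ℝ} (Ψ : ℕ → ℝ) (N : ℕ) (t : AddCircle T) {x y a b : ℂ}
    (h : (x, y) = chain Ψ (fourier 1 t) N 0 (a, b)) (h2 : ‖x‖ ^ 2 + ‖y‖ ^ 2 = 2) :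
    |chainIm Ψ N t - -(Complex.exp (Ψ 0 * Complex.I) * (x * conj y)).im| ≤
      2 * Real.sqrt 2 * (‖a - 1‖ + ‖b - 1‖) := by
  have h5 : (x, y) - (chainX Ψ N 0 t, chainY Ψ N 0 t) =
      chain Ψ (fourier 1 t) N 0 ((a, b) - (1, 1)) := by
    rw [chain_sub, ← h, chainX, chainY]
  have h6 := norm_le_add_of_pairNormSq ((congrArg pairNormSq h5).trans
    (pairNormSq_chain _ (norm_fourier_apply 1 t) _ _ _))
  simp only [Prod.fst_sub, Prod.snd_sub] at h6
  have h8 : ‖x‖ ≤ Real.sqrt 2 := Real.le_sqrt_of_sq_le (by linarith [sq_nonneg ‖y‖])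
  have h9 := abs_im_mul_conj_sub_le (E := Complex.exp (Ψ 0 * Complex.I)) (x' := chainX Ψ N 0 t)
    (y := y) (Complex.norm_exp_ofReal_mul_I _) h8 (norm_chainY_le (Ψ := Ψ) N 0 t)
  rw [norm_sub_rev (chainX Ψ N 0 t), norm_sub_rev (chainY Ψ N 0 t)] at h9
  refine h9.trans ?_
  have h10 := Real.sqrt_nonneg 2
  linarith [mul_le_mul_of_nonneg_left h6.1 h10, mul_le_mul_of_nonneg_left h6.2 h10]

lemma l2_norm_add_refl_le {φ : AddCircle T → ℂ} (h : SqInt φ) :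
    SqInt (fun t => ((‖φ t‖ : ℝ) : ℂ) + ((‖φ (-t)‖ : ℝ) : ℂ)) ∧
      l2 (fun t => ((‖φ t‖ : ℝ) : ℂ) + ((‖φ (-t)‖ : ℝ) : ℂ)) ≤ 2 * l2 φ := by
  have h1 : SqInt (fun t => ((‖φ t‖ : ℝ) : ℂ)) := h.norm.ofReal
  have h2 : SqInt (fun t => ((‖φ (-t)‖ : ℝ) : ℂ)) := h.refl.norm.ofReal
  refine ⟨h1.add h2, (h1.l2_add_le h2).trans (le_of_eq ?_)⟩
  have h3 : l2 (fun t => ((‖φ t‖ : ℝ) : ℂ)) = l2 φ := by simp [l2]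
  have h4 : l2 (fun t => ((‖φ (-t)‖ : ℝ) : ℂ)) = l2 φ :=
    (l2_refl (fun t => ((‖φ t‖ : ℝ) : ℂ))).trans h3
  rw [h3, h4, two_mul]

lemma IsStripping.l2_chainIm_sub_le (h : IsStripping F Ψ ξ ℓ) (N : ℕ) :
    l2 (fun t => (chainIm Ψ N t : ℂ) - F t) ≤
      2 * Real.sqrt 2 * (2 * l2 (fun t => ξ N t - 1)) := by
  have hs : SqInt (fun t => ξ N t - 1) := (h.sqInt N).sub (SqInt.const 1)
  obtain ⟨hsum, h1⟩ := l2_norm_add_refl_le hs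
  refine (hsum.l2_le (C := 2 * Real.sqrt 2) (by positivity) ?_).trans
    (mul_le_mul_of_nonneg_left h1 (by positivity))
  filter_upwards [h.chain, h.signal, h.norm_sq] with t h2 h3 h4
  have h7 : ‖conj (ξ N (-t)) - 1‖ = ‖ξ N (-t) - 1‖ := by
    rw [← RCLike.norm_conj (ξ N (-t) - 1), map_sub, map_one]
  rw [h3 h4, ← Complex.ofReal_sub, Complex.norm_real, Real.norm_eq_abs,
    ← Complex.ofReal_add, Complex.norm_real, Real.norm_of_nonneg (by positivity), ← h7]
  exact abs_chainIm_sub_le Ψ N t (h2 N) h4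

end stripping

theorem IsSignal.exists_represents {b : ℝ} {F : AddCircle T → ℝ} (hF : IsSignal b F)
    (hb : b ^ 2 < 1 / 2) : ∃ Ψ, CircleRepresents F Ψ := by
  obtain ⟨Ψ, ξ, ℓ, h⟩ := hF.exists_stripping hb
  refine ⟨Ψ, h.phase, ?_, ?_⟩
  · have h1 : ∀ N, cosProd Ψ (N + 1) 0 * cosProd Ψ N 1 = ℓ 0 * ℓ 1 * ((ℓ (N + 1))⁻¹ ^ 2) := by
      intro N
      have := h.cosProd_mul (N + 1) 0
      have h2 := h.cosProd_mul N 1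
      rw [zero_add] at this
      rw [add_comm 1 N] at h2
      have h3 := (h.scale_pos (N + 1)).ne'
      rw [← this, ← h2]
      field_simp
    simp only [h1, h.scale_mul]
    have := ((h.scale_lim.comp (tendsto_add_atTop_nat 1)).inv₀ one_ne_zero).pow 2
    simpa using this.const_mul (Real.exp (∫ t, Real.log (1 - F t ^ 2) / 2 ∂haarAddCircle))
  · have hl := (h.tendsto.comp (tendsto_add_atTop_nat 1)).const_mul 2 |>.const_mul (2 * Real.sqrt 2)
    simp only [mul_zero] at hl
    exact squeeze_zero (fun _ => l2_nonneg _) (fun N => h.l2_chainIm_sub_le (N + 1)) hl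

end QSP

end

/-! ### Passage between the interval with Chebyshev weight and the circle -/

noncomputable section

namespace QSP

open MeasureTheory AddCircle Filter Topology ComplexConjugate
open scoped ENNReal

instance : Fact (0 < Real.pi) := ⟨Real.pi_pos⟩

lemma fourier_one_coe (θ : ℝ) :
    fourier 1 (θ : AddCircle Real.pi) = Complex.exp (2 * (θ * Complex.I)) := by
  rw [fourier_coe_apply]
  congr 1
  have : (Real.pi : ℂ) ≠ 0 := by exact_mod_cast Real.pi_ne_zero
  field_simp
  push_cast
  ring

/-- The function `|cos|` on the circle of length `π`. -/
def absCos (t : AddCircle Real.pi) : ℝ := Real.sqrt ((1 + (fourier 1 t).re) / 2)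

lemma absCos_coe (θ : ℝ) : absCos θ = |Real.cos θ| := by
  have h : (Complex.exp (2 * (θ * Complex.I))).re = 2 * Real.cos θ ^ 2 - 1 := by
    rw [← Real.cos_two_mul, ← Complex.exp_ofReal_mul_I_re]
    congr 2
    push_cast; ring
  rw [absCos, fourier_one_coe, h, ← Real.sqrt_sq_eq_abs]
  congr 1
  ring

lemma absCos_neg (t : AddCircle Real.pi) : absCos (-t) = absCos t := by
  rw [absCos, fourier_refl, Complex.conj_re, absCos]

lemma continuous_absCos : Continuous absCos := by
  unfold absCos
  fun_prop

lemma absCos_mem (t : AddCircle Real.pi) : absCos t ∈ Set.Icc (0 : ℝ) 1 := by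
  refine ⟨Real.sqrt_nonneg _, ?_⟩
  rw [absCos, Real.sqrt_le_left zero_le_one]
  have := Complex.re_le_norm (fourier 1 t)
  rw [norm_fourier_apply] at this
  linarith

/-- Change of variables between the Chebyshev weight and the circle. -/
lemma integral_absCos (G : ℝ → ℝ) : ∫ t, G (absCos t) ∂haarAddCircle =
    2 / Real.pi * ∫ x in (0 : ℝ)..1, G x * (1 / Real.sqrt (1 - x ^ 2)) := by
  have h1 : ∫ t : AddCircle Real.pi, G (absCos t) = ∫ θ in 0..Real.pi, G |Real.cos θ| := by
    rw [← AddCircle.intervalIntegral_preimage Real.pi 0, zero_add]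
    simp only [absCos_coe]
  -- The even extension `G |x|` brings the integral over `[0, 1]` to the full interval `[-1, 1]` of
  -- the Chebyshev measure.
  have h2 := Polynomial.Chebyshev.integral_measureT_eq_integral_cos (f := fun x => G |x|)
  rw [Polynomial.Chebyshev.integral_measureT] at h2
  have h3 : ∫ x in (-1 : ℝ)..1, G |x| * Real.sqrt (1 - x ^ 2)⁻¹ =
      2 * ∫ x in (0 : ℝ)..1, G x * (1 / Real.sqrt (1 - x ^ 2)) := by
    have h4 := integral_comp_abs (f := (Set.Iic (1 : ℝ)).indicator
      fun x => G x * (1 / Real.sqrt (1 - x ^ 2)))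
    rw [setIntegral_indicator measurableSet_Iic, Set.Ioi_inter_Iic,
      ← intervalIntegral.integral_of_le zero_le_one] at h4
    rw [← h4, intervalIntegral.integral_of_le (by norm_num), ← integral_Icc_eq_integral_Ioc,
      ← integral_indicator measurableSet_Icc]
    congr 1
    ext x
    simp only [Set.indicator_apply, Set.mem_Icc, Set.mem_Iic, ← abs_le, sq_abs, Real.sqrt_inv,
      one_div]
  rw [integral_haarAddCircle, h1, ← h2, h3, smul_eq_mul]
  ring

lemma chebNorm_eq_l2 (h : ℝ → ℝ) : chebNorm h = l2 (fun t => (h (absCos t) : ℂ)) := by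
  rw [chebNorm, l2, ← integral_absCos (fun x => |h x| ^ 2)]
  simp only [Complex.norm_real, Real.norm_eq_abs]

/-- The change of variables formula needs no hypothesis on its integrand, so it can be applied to
the indicator of a measurable null set containing the exceptions. -/
lemma ae_absCos_of_ae {p : ℝ → Prop} (h : ∀ᵐ x ∂volume.restrict (Set.Icc (0 : ℝ) 1), p x) :
    ∀ᵐ t ∂haarAddCircle, p (absCos t) := by
  obtain ⟨N, hN, hNm, hN0⟩ := exists_measurable_superset_of_null (ae_iff.1 h)
  have h1 : ∫ t, N.indicator (fun _ => (1 : ℝ)) (absCos t) ∂haarAddCircle = 0 := by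
    rw [integral_absCos]
    have e : ∫ x in (0 : ℝ)..1, N.indicator (fun _ => (1 : ℝ)) x * (1 / Real.sqrt (1 - x ^ 2)) =
        0 := by
      rw [intervalIntegral.integral_of_le zero_le_one, ← integral_Icc_eq_integral_Ioc]
      refine integral_eq_zero_of_ae ?_
      filter_upwards [measure_eq_zero_iff_ae_notMem.1 hN0] with x hx
      simp [hx]
    rw [e, mul_zero]
  have hm : AEStronglyMeasurable (fun t => N.indicator (fun _ => (1 : ℝ)) (absCos t))
      haarAddCircle :=
    ((measurable_const.indicator hNm).comp continuous_absCos.measurable).aestronglyMeasurable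
  have hb : ∀ x, 0 ≤ N.indicator (fun _ => (1 : ℝ)) x ∧ N.indicator (fun _ => (1 : ℝ)) x ≤ 1 :=
    fun x => by by_cases hx : x ∈ N <;> simp [hx]
  have hi : Integrable (fun t => N.indicator (fun _ => (1 : ℝ)) (absCos t)) haarAddCircle :=
    Integrable.of_bound hm 1 (ae_of_all _ fun t => by
      rw [Real.norm_of_nonneg (hb _).1]; exact (hb _).2)
  filter_upwards [(integral_eq_zero_iff_of_nonneg (fun t => (hb _).1) hi).1 h1] with t ht
  by_contra hp
  have : absCos t ∈ N := hN hp
  simp [this] at ht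

lemma aestronglyMeasurable_comp_absCos {f : ℝ → ℝ}
    (hf : AEMeasurable f (volume.restrict (Set.Icc (0 : ℝ) 1))) :
    AEStronglyMeasurable (fun t => f (absCos t)) haarAddCircle := by
  obtain ⟨f', hf', he⟩ := hf
  have h1 : AEStronglyMeasurable (fun t => f' (absCos t)) haarAddCircle :=
    (hf'.comp continuous_absCos.measurable).aestronglyMeasurable
  refine h1.congr ?_
  filter_upwards [ae_absCos_of_ae he] with t ht
  exact ht.symm

lemma isSignal_of_mem {ε : ℝ} {f : ℝ → ℝ} (hf : f ∈ signalSpace ε) :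
    IsSignal ((2 : ℝ) ^ (-(1 / 2) : ℝ) - ε) (fun t => f (absCos t)) where
  meas := aestronglyMeasurable_comp_absCos hf.1
  bound t := hf.2 _ (absCos_mem t)
  even t := by rw [absCos_neg]

lemma chainIm_neg {T : ℝ} (Ψ : ℕ → ℝ) (N : ℕ) (t : AddCircle T) :
    chainIm Ψ N (-t) = chainIm Ψ N t := by
  rw [chainIm, chainX_refl, chainY_refl, Complex.conj_conj, chainIm, mul_comm (conj _)]

lemma im_u_absCos (Ψ : ℕ → ℝ) (d : ℕ) (t : AddCircle Real.pi) :
    (u d Ψ (absCos t)).im = chainIm Ψ (d + 1) t := by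
  -- On this range sine and cosine are nonnegative, so the square root in `W` is the sine; the other
  -- half of the circle follows because both sides are even.
  have key : ∀ θ ∈ Set.Icc (0 : ℝ) (Real.pi / 2),
      (u d Ψ (absCos θ)).im = chainIm Ψ (d + 1) (θ : AddCircle Real.pi) := by
    intro θ hθ
    have hc := Real.cos_nonneg_of_mem_Icc (x := θ) ⟨by linarith [hθ.1, Real.pi_pos], hθ.2⟩
    have hs := Real.sin_nonneg_of_nonneg_of_le_pi hθ.1 (by linarith [hθ.2, Real.pi_pos])
    rw [absCos_coe, abs_of_nonneg hc, im_u_eq Ψ (by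
      rw [← Real.sin_sq, Real.sqrt_sq hs]) d, chainIm, chainX, chainY, fourier_one_coe]
  have ht : t ∈ ((↑) : ℝ → AddCircle Real.pi) '' Set.Ico (-(Real.pi / 2))
      (-(Real.pi / 2) + Real.pi) := by
    rw [AddCircle.coe_image_Ico_eq]; trivial
  obtain ⟨θ, hθ, rfl⟩ := ht
  rcases le_total 0 θ with h | h
  · exact key θ ⟨h, by linarith [hθ.2]⟩
  · have := key (-θ) ⟨by linarith, by linarith [hθ.1]⟩
    rwa [AddCircle.coe_neg, absCos_neg, chainIm_neg] at this

/-- Index `0` occurs once in the sum over `ℤ` and every other index twice; nonnegativity makes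
convergence of these partial sums equivalent to summability. -/
lemma hasSum_natAbs_iff {L : ℕ → ℝ} (hL : ∀ n, 0 ≤ L n) (S : ℝ) :
    HasSum (fun k : ℤ => L k.natAbs) S ↔
      Tendsto (fun N => 2 * ∑ j ∈ Finset.range (N + 1), L j - L 0) atTop (𝓝 S) := by
  have hsum : ∀ a, HasSum L a → HasSum (fun k : ℤ => L k.natAbs) (a + (a - L 0)) := by
    intro a ha
    have h1 : HasSum (fun n => L (n + 1)) (a - L 0) := by
      simpa using (hasSum_nat_add_iff' 1).2 ha
    refine HasSum.of_nat_of_neg_add_one (by simpa using ha) ?_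
    refine h1.congr_fun fun n => ?_
    congr 1
  constructor
  · intro h
    have hs : Summable L := by
      simpa [Function.comp_def] using h.summable.comp_injective (Nat.cast_injective (R := ℤ))
    obtain ⟨a, ha⟩ := hs
    rw [h.unique (hsum a ha), show a + (a - L 0) = 2 * a - L 0 by ring]
    exact ((ha.tendsto_sum_nat.comp (tendsto_add_atTop_nat 1)).const_mul 2).sub_const _
  · intro h
    have h1 : Tendsto (fun N => ∑ j ∈ Finset.range (N + 1), L j) atTop (𝓝 ((S + L 0) / 2)) := by
      refine ((h.add_const (L 0)).div_const 2).congr fun N => ?_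
      ring
    have ha : HasSum L ((S + L 0) / 2) :=
      (hasSum_iff_tendsto_nat_of_nonneg hL _).2 ((tendsto_add_atTop_iff_nat 1).1 h1)
    convert hsum _ ha using 1
    ring

lemma log_one_add_tan_sq {ψ : ℝ} (hψ : ψ ∈ Set.Ioo (-(Real.pi / 2)) (Real.pi / 2)) :
    Real.log (1 + Real.tan ψ ^ 2) = -2 * Real.log (Real.cos ψ) := by
  have hc := Real.cos_pos_of_mem_Ioo hψ
  rw [← inv_inv (1 + Real.tan ψ ^ 2), Real.inv_one_add_tan_sq hc.ne', Real.log_inv, Real.log_pow]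
  norm_num

lemma log_cosProd {Ψ : ℕ → ℝ} (hΨ : ∀ k, Ψ k ∈ Set.Ioo (-(Real.pi / 2)) (Real.pi / 2)) (n k : ℕ) :
    -2 * Real.log (cosProd Ψ n k) =
      ∑ j ∈ Finset.range n, Real.log (1 + Real.tan (Ψ (k + j)) ^ 2) := by
  rw [cosProd, Real.log_prod fun j _ => (Real.cos_pos_of_mem_Ioo (hΨ _)).ne', Finset.mul_sum]
  exact Finset.sum_congr rfl fun j _ => (log_one_add_tan_sq (hΨ _)).symm

lemma log_cosProd_mul {Ψ : ℕ → ℝ} (hΨ : ∀ k, Ψ k ∈ Set.Ioo (-(Real.pi / 2)) (Real.pi / 2))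
    (N : ℕ) : -2 * Real.log (cosProd Ψ (N + 1) 0 * cosProd Ψ N 1) =
      2 * ∑ j ∈ Finset.range (N + 1), Real.log (1 + Real.tan (Ψ j) ^ 2) -
        Real.log (1 + Real.tan (Ψ 0) ^ 2) := by
  rw [Real.log_mul (cosProd_pos hΨ _ _).ne' (cosProd_pos hΨ _ _).ne', mul_add, log_cosProd hΨ,
    log_cosProd hΨ]
  have h := Finset.sum_range_succ' (fun j => Real.log (1 + Real.tan (Ψ j) ^ 2)) N
  simp only [zero_add, add_comm 1]
  linarith

lemma tendsto_exp_iff_log {P : ℕ → ℝ} (hP : ∀ n, 0 < P n) (a : ℝ) :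
    Tendsto P atTop (𝓝 (Real.exp a)) ↔
      Tendsto (fun n => -2 * Real.log (P n)) atTop (𝓝 (-2 * a)) := by
  constructor
  · intro h
    have := (h.log (Real.exp_pos a).ne').const_mul (-2)
    rwa [Real.log_exp] at this
  · intro h
    have h1 := (Real.continuous_exp.tendsto _).comp (h.const_mul (-(1 / 2)))
    have e : Real.exp (-(1 / 2) * (-2 * a)) = Real.exp a := by congr 1; ring
    rw [e] at h1
    refine h1.congr fun n => ?_
    rw [Function.comp_apply, show -(1 / 2) * (-2 * Real.log (P n)) = Real.log (P n) by ring,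
      Real.exp_log (hP n)]

lemma represents_iff (f : ℝ → ℝ) (Ψ : ℕ → ℝ) :
    Represents f Ψ ↔ CircleRepresents (fun t => f (absCos t)) Ψ := by
  have hS : -(2 / Real.pi) * ∫ x in (0 : ℝ)..1, Real.log |1 - f x ^ 2| *
      (1 / Real.sqrt (1 - x ^ 2)) =
      -2 * ∫ t, Real.log (1 - f (absCos t) ^ 2) / 2 ∂haarAddCircle := by
    rw [neg_mul, ← integral_absCos (fun x => Real.log |1 - f x ^ 2|), integral_div]
    simp only [Real.log_abs]
    ring
  have hconv : ∀ d, chebNorm (fun x => (u d Ψ x).im - f x) =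
      l2 (fun t : AddCircle Real.pi => (chainIm Ψ (d + 1) t : ℂ) - (f (absCos t) : ℝ)) := by
    intro d
    rw [chebNorm_eq_l2]
    simp only [im_u_absCos, Complex.ofReal_sub]
  have hL : ∀ n, 0 ≤ Real.log (1 + Real.tan (Ψ n) ^ 2) := fun n =>
    Real.log_nonneg (by linarith [sq_nonneg (Real.tan (Ψ n))])
  have hprod : (∀ k, Ψ k ∈ Set.Ioo (-(Real.pi / 2)) (Real.pi / 2)) →
      (HasSum (fun k : ℤ => Real.log (1 + Real.tan (Ψ k.natAbs) ^ 2))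
        (-(2 / Real.pi) *
          ∫ x in (0 : ℝ)..1, Real.log |1 - f x ^ 2| * (1 / Real.sqrt (1 - x ^ 2))) ↔
      Tendsto (fun N => cosProd Ψ (N + 1) 0 * cosProd Ψ N 1) atTop
        (𝓝 (Real.exp (∫ t, Real.log (1 - f (absCos t) ^ 2) / 2 ∂haarAddCircle)))) := by
    intro hΨ
    rw [hS, tendsto_exp_iff_log fun N => mul_pos (cosProd_pos hΨ _ _) (cosProd_pos hΨ _ _),
      hasSum_natAbs_iff (L := fun n => Real.log (1 + Real.tan (Ψ n) ^ 2)) hL]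
    simp only [log_cosProd_mul hΨ]
  constructor
  · rintro ⟨h1, h2, h3⟩
    simp only [hconv] at h3
    exact ⟨h1, (hprod h1).1 h2, h3⟩
  · rintro ⟨h1, h2, h3⟩
    refine ⟨h1, (hprod h1).2 h2, ?_⟩
    simpa only [hconv] using h3

lemma signal_bound {ε : ℝ} (hε : 0 < ε) {f : ℝ → ℝ} (hf : f ∈ signalSpace ε) :
    ε ≤ (2 : ℝ) ^ (-(1 / 2) : ℝ) ∧ ((2 : ℝ) ^ (-(1 / 2) : ℝ) - ε) ^ 2 < 1 / 2 := by
  -- A nonempty signal space forces `ε ≤ 2^{-1/2}`, as evaluation at `0` shows.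
  have h1 := (abs_nonneg _).trans (hf.2 0 ⟨le_rfl, zero_le_one⟩)
  refine ⟨by linarith, ?_⟩
  have h2 : ((2 : ℝ) ^ (-(1 / 2) : ℝ)) ^ 2 = 1 / 2 := by
    rw [← Real.rpow_natCast, ← Real.rpow_mul (by norm_num)]
    norm_num
  exact (pow_lt_pow_left₀ (sub_lt_self _ hε) h1 two_ne_zero).trans_eq h2

/-- The bound on `ε` gives `ε^{-3/2} ≥ 2^{3/4} ≥ 1.6`, and `7.3 · 1.6 = 11.68` exceeds `3.15 ·
3.42`, hence `π (2 + √2)`. -/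
lemma lipschitz_const_le {ε : ℝ} (hε : 0 < ε) (h : ε ≤ (2 : ℝ) ^ (-(1 / 2) : ℝ)) :
    Real.pi * (2 + Real.sqrt 2) ≤ 7.3 * ε ^ (-(3 / 2) : ℝ) := by
  have h1 : (2 : ℝ) ^ (3 / 4 : ℝ) ≤ ε ^ (-(3 / 2) : ℝ) := by
    have := Real.rpow_le_rpow_of_nonpos hε h (by norm_num : (-(3 / 2) : ℝ) ≤ 0)
    rw [← Real.rpow_mul (by norm_num)] at this
    norm_num at this ⊢
    exact this
  have h2 : (1.6 : ℝ) ≤ 2 ^ (3 / 4 : ℝ) := by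
    refine le_of_pow_le_pow_left₀ (n := 4) (by norm_num) (by positivity) ?_
    rw [← Real.rpow_natCast (2 ^ (3 / 4 : ℝ)), ← Real.rpow_mul (by norm_num)]
    norm_num
  have h3 : Real.sqrt 2 ≤ 1.42 := by
    rw [Real.sqrt_le_left (by norm_num)]; norm_num
  have h4 := Real.pi_lt_d2
  have h5 := Real.sqrt_nonneg 2
  nlinarith [Real.pi_pos]

end QSP

end

/-! ### Conclusion -/

theorem theorem1 (ε : ℝ) (hε : 0 < ε) :
    (∀ f ∈ QSP.signalSpace ε, ∃! Ψ : ℕ → ℝ, QSP.Represents f Ψ) ∧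
    (∀ f ∈ QSP.signalSpace ε, ∀ g ∈ QSP.signalSpace ε, ∀ Ψ Φ : ℕ → ℝ,
      QSP.Represents f Ψ → QSP.Represents g Φ →
        QSP.supNorm (fun k => Ψ k - Φ k) ≤
          7.3 * ε ^ (-(3 / 2) : ℝ) * QSP.chebNorm (fun x => f x - g x)) := by
  have key : ∀ f ∈ QSP.signalSpace ε, ∀ g ∈ QSP.signalSpace ε, ∀ Ψ Φ : ℕ → ℝ,
      QSP.Represents f Ψ → QSP.Represents g Φ → ∀ k, |Ψ k - Φ k| ≤
        7.3 * ε ^ (-(3 / 2) : ℝ) * QSP.chebNorm (fun x => f x - g x) := by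
    intro f hf g hg Ψ Φ h h' k
    obtain ⟨hle, hb⟩ := QSP.signal_bound hε hf
    have hF := QSP.isSignal_of_mem hf
    have hG := QSP.isSignal_of_mem hg
    have h1 := QSP.CircleRepresents.abs_sub_le hF hG hb.le
      ((QSP.represents_iff f Ψ).1 h) ((QSP.represents_iff g Φ).1 h') k
    rw [QSP.chebNorm_eq_l2]
    simp only [Complex.ofReal_sub]
    exact h1.trans (mul_le_mul_of_nonneg_right (QSP.lipschitz_const_le hε hle) (QSP.l2_nonneg _))
  refine ⟨fun f hf => ?_, fun f hf g hg Ψ Φ h h' => ciSup_le (key f hf g hg Ψ Φ h h')⟩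
  obtain ⟨_, hb⟩ := QSP.signal_bound hε hf
  have hF := QSP.isSignal_of_mem hf
  obtain ⟨Ψ, hΨ⟩ := hF.exists_represents hb
  refine ⟨Ψ, (QSP.represents_iff f Ψ).2 hΨ, fun Φ hΦ => ?_⟩
  funext k
  -- Uniqueness is the Lipschitz estimate with both signals equal.
  have := key f hf f hf Φ Ψ hΦ ((QSP.represents_iff f Ψ).2 hΨ) k
  simp only [sub_self, QSP.chebNorm_eq_l2, Complex.ofReal_zero, QSP.l2_const, norm_zero,
    mul_zero] at this
  exact sub_eq_zero.1 (abs_nonpos_iff.1 this)
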